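/- Let $X_n$ and $P_n$, $n\ge 1$, be $n\times n$ random matrices defined on one probability space, either all real symmetric or all complex Hermitian. (As $P_n$ has rank $r$, only $n\ge r$ matters for $P_n$.) Write $\lambda_1(M)\ge\cdots\ge\lambda_n(M)$ for the ordered eigenvalues of an $n\times n$ matrix $M$ with real spectrum. Assume the following. - Every $X_n$ is nonnegative definite. Almost surely, the empirical eigenvalue distribution $\frac1n\sum_{k=1}^n\delta_{\lambda_k(X_n)}$ converges weakly, as $n\to\infty$, to a non-random compactly supported probability measure $\mu_X\ne\delta_0$ on $\mathbb R$. With $a$ and $b$ the infimum and the supremum of the support of $\mu_X$, almost surely $\lambda_n(X_n)\to a$ and $\lambda_1(X_n)\to b$. - $r\ge 1$, $0\le s\le r$, and $\theta_1\ge\cdots\ge\theta_s>0>\theta_{s+1}\ge\cdots\ge\theta_r$ are real numbers that do not depend on $n$. Every $P_n$ (with $n \ge r$) is symmetric (respectively Hermitian), of rank $r$, and its $r$ non-zero eigenvalues, counted with multiplicity, are $\theta_1,\dots,\theta_r$. - For every $n\ge r$, $X_n$ and $P_n$ are independent, and the law of at least one of $X_n$ and $P_n$ is invariant under conjugation by orthogonal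 (respectively unitary) matrices. Let $\widetilde X_n=X_n(I_n+P_n)$, and for real $z\notin\operatorname{supp}\mu_X$ let $$T_{\mu_X}(z)=\int\frac{t}{z-t}\,d\mu_X(t).$$ Let $T_{\mu_X}(b^+)=\lim_{z\downarrow b}T_{\mu_X}(z)\in(0,+\infty]$ and $T_{\mu_X}(a^-)=\lim_{z\uparrow a}T_{\mu_X}(z)\in[-\infty,0)$, with $1/\pm\infty=0$. Then all eigenvalues of $\widetilde X_n$ $(n\ge r)$ are real, $T_{\mu_X}$ maps $(b,\infty)$ bijectively onto $(0,T_{\mu_X}(b^+))$ and $(-\infty,a)$ bijectively onto $(T_{\mu_X}(a^-),0)$, and, with $T_{\mu_X}^{-1}$ denoting the inverses of these two bijections (the first at positive arguments, the second at negative arguments), the following hold as $n\to\infty$. 1. For each $1\le i\le s$, almost surely $$\lambda_i(\widetilde X_n)\longrightarrow\begin{cases}T_{\mu_X}^{-1}(1/\theta_i)&\text{if }\theta_i>1/T_{\mu_X}(b^+),\\ b&\text{otherwise.}\end{cases}$$ 2. For each fixed $i>s$, almost surely $\lambda_i(\widetilde X_n)\to b$. 3. For each $0\le j<r-s$, almost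 surely $$\lambda_{n-j}(\widetilde X_n)\longrightarrow\begin{cases}T_{\mu_X}^{-1}(1/\theta_{r-j})&\text{if }\theta_{r-j}<1/T_{\mu_X}(a^-),\\ a&\text{otherwise.}\end{cases}$$ 4. For each fixed $j\ge r-s$, almost surely $\lambda_{n-j}(\widetilde X_n)\to a$. -/

import Mathlib

open MeasureTheory ProbabilityTheory Filter Topology Set Polynomial
open scoped BoundedContinuousFunction ENNReal ComplexOrder

noncomputable section

namespace SpikedMatrix

/-- The Borel σ-algebra on matrices: the product σ-algebra of the entries. -/
instance instMeasurableSpaceMatrix (n : ℕ) (𝕜 : Type*) [RCLike 𝕜] :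
    MeasurableSpace (Matrix (Fin n) (Fin n) 𝕜) :=
  inferInstanceAs (MeasurableSpace (Fin n → Fin n → 𝕜))

/-- For a square matrix `M` all of whose eigenvalues are real, `eigenvalueDesc M k` is the `k`-th
largest eigenvalue `λ_k(M)`, `k = 1, …, n` (with multiplicity, in the characteristic polynomial),
so that `λ_1(M) ≥ ⋯ ≥ λ_n(M)`. -/
def eigenvalueDesc {𝕜 : Type*} [RCLike 𝕜] {n : ℕ} (M : Matrix (Fin n) (Fin n) 𝕜) (k : ℕ) : ℝ :=
  ((M.charpoly.roots.map RCLike.re).sort (· ≥ ·)).getD (k - 1) 0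

/-- The empirical eigenvalue distribution `(1/n) ∑_{k=1}^n δ_{λ_k(M)}`. -/
def empiricalSpectralMeasure {𝕜 : Type*} [RCLike 𝕜] {n : ℕ} (M : Matrix (Fin n) (Fin n) 𝕜) :
    Measure ℝ :=
  (n : ℝ≥0∞)⁻¹ • ∑ k ∈ Finset.Icc 1 n, Measure.dirac (eigenvalueDesc M k)

/-- Weak convergence of a sequence of measures on `ℝ`. -/
def ConvergesWeakly (ν : ℕ → Measure ℝ) (μ : Measure ℝ) : Prop :=
  ∀ f : ℝ →ᵇ ℝ, Tendsto (fun n => ∫ t, f t ∂(ν n)) atTop (𝓝 (∫ t, f t ∂μ))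

/-- The law of the random matrix `M` is invariant under conjugation by the unitary group of `𝕜^n`:
the orthogonal group if `𝕜 = ℝ`, the unitary group if `𝕜 = ℂ`. -/
def IsConjInvariant {Ω : Type*} [MeasurableSpace Ω] (Pr : Measure Ω) {𝕜 : Type*} [RCLike 𝕜] {n : ℕ}
    (M : Ω → Matrix (Fin n) (Fin n) 𝕜) : Prop :=
  ∀ U ∈ Matrix.unitaryGroup (Fin n) 𝕜, Measure.map (fun ω => U * M ω * star U) Pr = Measure.map M Pr

/-- The T-transform `T_μ(z) = ∫ t / (z - t) dμ(t)` at real points `z` outside the support. -/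
def Ttransform (μ : Measure ℝ) (z : ℝ) : ℝ := ∫ t, t / (z - t) ∂μ

/-- `T_μ(b^+)`, the limit of `T_μ(z)` as `z` decreases to `b`, in `[-∞, ∞]`. -/
def TtransformRight (μ : Measure ℝ) (b : ℝ) : EReal :=
  Function.rightLim (fun z : ℝ => (Ttransform μ z : EReal)) b

/-- `T_μ(a^-)`, the limit of `T_μ(z)` as `z` increases to `a`, in `[-∞, ∞]`. -/
def TtransformLeft (μ : Measure ℝ) (a : ℝ) : EReal :=
  Function.leftLim (fun z : ℝ => (Ttransform μ z : EReal)) a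

/-- The inverse of `T_μ` restricted to `(b, ∞)`. -/
def TinvRight (μ : Measure ℝ) (b y : ℝ) : ℝ := Function.invFunOn (Ttransform μ) (Ioi b) y

/-- The inverse of `T_μ` restricted to `(-∞, a)`. -/
def TinvLeft (μ : Measure ℝ) (a y : ℝ) : ℝ := Function.invFunOn (Ttransform μ) (Iio a) y

end SpikedMatrix

end

/-! Write X = S² with S Hermitian. Then X(1 + P) has the characteristic polynomial of the Hermitian
matrix S(1 + P)S, so its eigenvalues are real and min-max applies. After a joint conjugation P is
diagonal with entries θ_1, …, θ_r, 0, …, 0. If z lies above the spectrum of X, then D = z − X is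
positive definite and S(1 + P)S − z = SPS − D. Besides P, the number of positive squares of this
form depends only on the r × r corner of A = S D⁻¹ S = X(z − X)⁻¹. If that corner were T times the
identity with T = T_μ(z), exactly the spikes with θ_i T > 1 would produce an eigenvalue above z.
`quadForm_sub_pos` and `quadForm_sub_nonpos` are the two halves of this count, with an error η
allowed. As T_μ is strictly decreasing on (b, ∞), the crossing takes place at T_μ⁻¹(1/θ_i). To the
left of a the same argument runs with D = X − z and all signs reversed.

The corner is nearly scalar because independence and the invariance of one law allow a Haar unitary
to be inserted between X and P (`lintegral_conj_right_eq`). For a traceless Hermitian B and a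
Haar-rotated unit vector, the quadratic form has fourth moment of order ‖B‖_F⁴/n⁴. Eighth moments of
coordinates come from averaging over signs and Khintchine's inequality; the fourth moment of a
centred combination of the exchangeable squared coordinates comes from exchangeable pairs
(`integral_pow_four_le_of_exchangeable`). The normalised deviation then has second moment O(n⁻²),
which is summable, so it tends to 0 almost surely, simultaneously for all rational z. The remaining
scalar, the normalised trace of X(z − X)⁻¹, converges to T_μ(z) by weak convergence and convergence
of the extreme eigenvalues.

Eigenvalues that do not detach are held at the edges by interlacing: a perturbation of rank r shifts
indices by at most r, while the number of eigenvalues of X near each edge tends to infinity, since a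
and b belong to the support. -/

noncomputable section

namespace SpikedMatrix

open Matrix

/-! ### Quadratic forms, ordered eigenvalues and the min-max principle. -/

section LinearAlgebra

variable {𝕜 : Type*} [RCLike 𝕜] {n : ℕ}

/-- The real part of the quadratic form of `H` at `x`. -/
def quadForm (H : Matrix (Fin n) (Fin n) 𝕜) (x : Fin n → 𝕜) : ℝ :=
  RCLike.re (star x ⬝ᵥ H *ᵥ x)

/-- The squared Euclidean norm of a vector. -/
def normSq (x : Fin n → 𝕜) : ℝ := ∑ i, ‖x i‖ ^ 2

lemma normSq_nonneg (x : Fin n → 𝕜) : 0 ≤ normSq x :=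
  Finset.sum_nonneg fun _ _ => by positivity

lemma re_star_dotProduct_self (x : Fin n → 𝕜) : RCLike.re (star x ⬝ᵥ x) = normSq x := by
  simp only [dotProduct, Pi.star_apply, map_sum, normSq, RCLike.star_def, RCLike.conj_mul]
  norm_cast

lemma normSq_eq_zero {x : Fin n → 𝕜} : normSq x = 0 ↔ x = 0 := by
  unfold normSq
  rw [Finset.sum_eq_zero_iff_of_nonneg fun _ _ => by positivity]
  simp [funext_iff]

lemma normSq_pos {x : Fin n → 𝕜} (hx : x ≠ 0) : 0 < normSq x :=
  lt_of_le_of_ne (normSq_nonneg x) fun h => hx (normSq_eq_zero.1 h.symm)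

lemma star_dotProduct_mulVec (x y : Fin n → 𝕜) (A : Matrix (Fin n) (Fin n) 𝕜) :
    star x ⬝ᵥ A *ᵥ y = star (star A *ᵥ x) ⬝ᵥ y := by
  rw [star_mulVec, dotProduct_mulVec, star_eq_conjTranspose, conjTranspose_conjTranspose]

lemma normSq_unitary_mulVec {U : Matrix (Fin n) (Fin n) 𝕜} (hU : U ∈ unitaryGroup (Fin n) 𝕜)
    (x : Fin n → 𝕜) : normSq (U *ᵥ x) = normSq x := by
  rw [← re_star_dotProduct_self, star_dotProduct_mulVec, mulVec_mulVec,
    mem_unitaryGroup_iff'.1 hU, one_mulVec, re_star_dotProduct_self]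

lemma star_mem_unitaryGroup {U : Matrix (Fin n) (Fin n) 𝕜} (hU : U ∈ unitaryGroup (Fin n) 𝕜) :
    star U ∈ unitaryGroup (Fin n) 𝕜 := Unitary.star_mem hU

lemma quadForm_conj (W H : Matrix (Fin n) (Fin n) 𝕜) (x : Fin n → 𝕜) :
    quadForm (W * H * star W) x = quadForm H (star W *ᵥ x) := by
  unfold quadForm
  rw [← mulVec_mulVec, ← mulVec_mulVec, star_dotProduct_mulVec]

lemma quadForm_diagonal (d : Fin n → ℝ) (x : Fin n → 𝕜) :
    quadForm (diagonal fun i => (d i : 𝕜)) x = ∑ i, d i * ‖x i‖ ^ 2 := by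
  simp only [quadForm, dotProduct, mulVec_diagonal, Pi.star_apply, map_sum, RCLike.star_def]
  refine Finset.sum_congr rfl fun i _ => ?_
  rw [mul_left_comm, RCLike.conj_mul]
  norm_cast

lemma quadForm_sub (A B : Matrix (Fin n) (Fin n) 𝕜) (x : Fin n → 𝕜) :
    quadForm (A - B) x = quadForm A x - quadForm B x := by
  simp [quadForm, sub_mulVec, dotProduct_sub]

lemma quadForm_add (A B : Matrix (Fin n) (Fin n) 𝕜) (x : Fin n → 𝕜) :
    quadForm (A + B) x = quadForm A x + quadForm B x := by
  simp [quadForm, add_mulVec, dotProduct_add]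

lemma quadForm_smul_one (c : ℝ) (x : Fin n → 𝕜) :
    quadForm ((c : 𝕜) • (1 : Matrix (Fin n) (Fin n) 𝕜)) x = c * normSq x := by
  rw [quadForm, smul_mulVec, one_mulVec, dotProduct_smul, smul_eq_mul, RCLike.re_ofReal_mul,
    re_star_dotProduct_self]

/-- Hermitian matrices with the same characteristic polynomial are unitarily conjugate. -/
lemma exists_unitary_conj_of_charpoly_eq {M N : Matrix (Fin n) (Fin n) 𝕜} (hM : M.IsHermitian)
    (hN : N.IsHermitian) (h : M.charpoly = N.charpoly) :
    ∃ W ∈ unitaryGroup (Fin n) 𝕜, M = W * N * star W := by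
  have he := (hM.eigenvalues_eq_eigenvalues_iff hN).2 h
  have h1 := hM.spectral_theorem
  have h2 := hN.spectral_theorem
  rw [Unitary.conjStarAlgAut_apply] at h1 h2
  rw [he] at h1
  refine ⟨hM.eigenvectorUnitary * star (hN.eigenvectorUnitary : Matrix (Fin n) (Fin n) 𝕜),
    mul_mem hM.eigenvectorUnitary.2 (star_mem_unitaryGroup hN.eigenvectorUnitary.2), ?_⟩
  set V : Matrix (Fin n) (Fin n) 𝕜 := ↑hN.eigenvectorUnitary
  set W : Matrix (Fin n) (Fin n) 𝕜 := ↑hM.eigenvectorUnitary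
  have hV : star V * V = 1 := mem_unitaryGroup_iff'.1 hN.eigenvectorUnitary.2
  conv_rhs => rw [h2]
  rw [h1, star_mul, star_star]
  simp only [Matrix.mul_assoc]
  rw [← Matrix.mul_assoc (star V) V, hV, Matrix.one_mul, ← Matrix.mul_assoc (star V) V, hV,
    Matrix.one_mul]

lemma isHermitian_diagonal_ofReal (d : Fin n → ℝ) :
    (diagonal fun i => (d i : 𝕜)).IsHermitian := by
  apply isHermitian_diagonal_of_self_adjoint
  ext i; simp

lemma exists_unitary_diagonal_of_charpoly_eq {M : Matrix (Fin n) (Fin n) 𝕜} (hM : M.IsHermitian)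
    (d : Fin n → ℝ) (h : M.charpoly = ∏ i, (Polynomial.X - Polynomial.C (d i : 𝕜))) :
    ∃ W ∈ unitaryGroup (Fin n) 𝕜, M = W * (diagonal fun i => (d i : 𝕜)) * star W :=
  exists_unitary_conj_of_charpoly_eq hM (isHermitian_diagonal_ofReal d)
    (by rw [h, charpoly_diagonal])

/-- The `i`-th eigenvalue in decreasing order, `i = 0, …, n - 1`. -/
def eig (M : Matrix (Fin n) (Fin n) 𝕜) (i : Fin n) : ℝ := eigenvalueDesc M (i + 1)

lemma eig_eq_eigenvalues₀ {M : Matrix (Fin n) (Fin n) 𝕜} (hM : M.IsHermitian) (i : Fin n) :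
    eig M i = hM.eigenvalues₀ (Fin.cast (Fintype.card_fin n).symm i) := by
  unfold eig eigenvalueDesc
  rw [hM.sort_roots_charpoly_eq_eigenvalues₀]
  simp [List.getD_eq_getElem?_getD]

lemma eig_antitone {M : Matrix (Fin n) (Fin n) 𝕜} (hM : M.IsHermitian) : Antitone (eig M) := by
  intro i j hij
  rw [eig_eq_eigenvalues₀ hM, eig_eq_eigenvalues₀ hM]
  exact hM.eigenvalues₀_antitone hij

lemma charpoly_eq_prod_eig {M : Matrix (Fin n) (Fin n) 𝕜} (hM : M.IsHermitian) :
    M.charpoly = ∏ i, (Polynomial.X - Polynomial.C (eig M i : 𝕜)) := by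
  rw [hM.charpoly_eq]
  simp only [IsHermitian.eigenvalues, eig_eq_eigenvalues₀ hM]
  exact ((Equiv.prod_comp (Fintype.equivOfCardEq (Fintype.card_fin _)).symm
    fun i => Polynomial.X - Polynomial.C (hM.eigenvalues₀ i : 𝕜)).trans
    (Equiv.prod_comp (finCongr (Fintype.card_fin n).symm)
      fun i => Polynomial.X - Polynomial.C (hM.eigenvalues₀ i : 𝕜)).symm)

lemma charpoly_eq_prod_eigenvalueDesc {M : Matrix (Fin n) (Fin n) 𝕜} (hM : M.IsHermitian) :
    M.charpoly =
      ∏ k ∈ Finset.Icc 1 n, (Polynomial.X - Polynomial.C (eigenvalueDesc M k : 𝕜)) := by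
  rw [charpoly_eq_prod_eig hM]
  simp only [eig]
  rw [Fin.prod_univ_eq_prod_range
    (fun k => Polynomial.X - Polynomial.C (eigenvalueDesc M (k + 1) : 𝕜)) n,
    Finset.range_eq_Ico, Finset.prod_Ico_add'
    (fun k => Polynomial.X - Polynomial.C (eigenvalueDesc M k : 𝕜)) 0 n 1]
  rfl

lemma exists_unitary_diagonal_eig {M : Matrix (Fin n) (Fin n) 𝕜} (hM : M.IsHermitian) :
    ∃ W ∈ unitaryGroup (Fin n) 𝕜, M = W * (diagonal fun i => (eig M i : 𝕜)) * star W :=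
  exists_unitary_diagonal_of_charpoly_eq hM _ (charpoly_eq_prod_eig hM)

lemma eigenvalueDesc_congr {M N : Matrix (Fin n) (Fin n) 𝕜} (h : M.charpoly = N.charpoly) (k : ℕ) :
    eigenvalueDesc M k = eigenvalueDesc N k := by
  simp [eigenvalueDesc, h]

/-- A linear map has a nonzero vector in its kernel if its domain has more dimensions than
its codomain has coordinates. -/
lemma exists_ne_zero_of_card_lt_finrank {E : Type*} [AddCommGroup E] [Module 𝕜 E]
    [FiniteDimensional 𝕜 E] {ι : Type*} [Fintype ι] (L : E →ₗ[𝕜] (ι → 𝕜))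
    (h : Fintype.card ι < Module.finrank 𝕜 E) : ∃ w : E, w ≠ 0 ∧ L w = 0 := by
  have : 0 < Module.finrank 𝕜 (LinearMap.ker L) := by
    have h1 := L.finrank_range_add_finrank_ker
    have h2 := Submodule.finrank_le (LinearMap.range L)
    simp only [Module.finrank_fintype_fun_eq_card] at h2
    omega
  obtain ⟨w, hw⟩ := Module.finrank_pos_iff_exists_ne_zero.1 this
  exact ⟨w, fun h => hw (Subtype.ext h), w.2⟩

/-- Upper half of the Courant-Fischer principle: on a space of dimension at least `k`, the form
of `M` somewhere does not exceed `λ_k(M)`. -/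
lemma exists_quadForm_le {M : Matrix (Fin n) (Fin n) 𝕜} (hM : M.IsHermitian) {E : Type*}
    [AddCommGroup E] [Module 𝕜 E] [FiniteDimensional 𝕜 E] (G : E →ₗ[𝕜] (Fin n → 𝕜))
    (i : Fin n) (h : (i : ℕ) + 1 ≤ Module.finrank 𝕜 E) :
    ∃ w : E, w ≠ 0 ∧ quadForm M (G w) ≤ eig M i * normSq (G w) := by
  obtain ⟨W, hW, hMW⟩ := exists_unitary_diagonal_eig hM
  let R : (Fin n → 𝕜) →ₗ[𝕜] ({j : Fin n // j < i} → 𝕜) :=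
    LinearMap.funLeft 𝕜 𝕜 Subtype.val
  -- These conditions kill the eigendirections of the i largest eigenvalues, fewer than dim E. `G`
  -- need not be injective, so G w may vanish; the callers exclude this themselves.
  obtain ⟨w, hw, hLw⟩ := exists_ne_zero_of_card_lt_finrank
    (R ∘ₗ (star W).mulVecLin ∘ₗ G) (by
      rw [Fintype.card_subtype, Finset.filter_gt_eq_Iio, Fin.card_Iio]; omega)
  refine ⟨w, hw, ?_⟩
  conv_lhs => rw [hMW]
  rw [quadForm_conj, quadForm_diagonal, ← normSq_unitary_mulVec (star_mem_unitaryGroup hW),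
    normSq, Finset.mul_sum]
  refine Finset.sum_le_sum fun j _ => ?_
  rcases lt_or_ge j i with hj | hj
  · have : (star W *ᵥ G w) j = 0 := congrFun hLw ⟨j, hj⟩
    simp [this]
  · exact mul_le_mul_of_nonneg_right (eig_antitone hM hj) (by positivity)

/-- Lower half of the Courant-Fischer principle. -/
lemma exists_le_quadForm {M : Matrix (Fin n) (Fin n) 𝕜} (hM : M.IsHermitian) {E : Type*}
    [AddCommGroup E] [Module 𝕜 E] [FiniteDimensional 𝕜 E] (G : E →ₗ[𝕜] (Fin n → 𝕜))
    (i : Fin n) (h : n - i ≤ Module.finrank 𝕜 E) :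
    ∃ w : E, w ≠ 0 ∧ eig M i * normSq (G w) ≤ quadForm M (G w) := by
  obtain ⟨W, hW, hMW⟩ := exists_unitary_diagonal_eig hM
  let R : (Fin n → 𝕜) →ₗ[𝕜] ({j : Fin n // i < j} → 𝕜) :=
    LinearMap.funLeft 𝕜 𝕜 Subtype.val
  obtain ⟨w, hw, hLw⟩ := exists_ne_zero_of_card_lt_finrank
    (R ∘ₗ (star W).mulVecLin ∘ₗ G) (by
      rw [Fintype.card_subtype, Finset.filter_lt_eq_Ioi, Fin.card_Ioi]; omega)
  refine ⟨w, hw, ?_⟩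
  conv_rhs => rw [hMW]
  rw [quadForm_conj, quadForm_diagonal, ← normSq_unitary_mulVec (star_mem_unitaryGroup hW),
    normSq, Finset.mul_sum]
  refine Finset.sum_le_sum fun j _ => ?_
  rcases lt_or_ge i j with hj | hj
  · have : (star W *ᵥ G w) j = 0 := congrFun hLw ⟨j, hj⟩
    simp [this]
  · exact mul_le_mul_of_nonneg_right (eig_antitone hM hj) (by positivity)

end LinearAlgebra

end SpikedMatrix

namespace SpikedMatrix

open Matrix

/-! ### The sign of the form SPS − D when S D⁻¹ S is nearly scalar. -/

section Perturbation

variable {𝕜 : Type*} [RCLike 𝕜] {n : ℕ}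

lemma quadForm_hermitian_conj {S : Matrix (Fin n) (Fin n) 𝕜} (hS : S.IsHermitian)
    (H : Matrix (Fin n) (Fin n) 𝕜) (x : Fin n → 𝕜) :
    quadForm (S * H * S) x = quadForm H (S *ᵥ x) := by
  have : star S = S := hS
  conv_lhs => rw [← this]
  nth_rewrite 1 [this]
  rw [quadForm_conj, this]

lemma re_star_mul_eq (w a e : 𝕜) (T : ℝ) (h : a = T * w + e) :
    RCLike.re (star w * a) = T * ‖w‖ ^ 2 + RCLike.re (star w * e) := by
  subst h
  rw [mul_add, map_add, mul_left_comm, RCLike.star_def, RCLike.conj_mul, RCLike.re_ofReal_mul]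
  norm_cast

lemma norm_sq_eq_of_eq (w a e : 𝕜) (T : ℝ) (h : a = T * w + e) :
    ‖a‖ ^ 2 = T ^ 2 * ‖w‖ ^ 2 + 2 * T * RCLike.re (star w * e) + ‖e‖ ^ 2 := by
  subst h
  simp only [RCLike.norm_sq_eq_def, map_add, RCLike.mul_re, RCLike.mul_im, RCLike.ofReal_re,
    RCLike.ofReal_im, RCLike.star_def, RCLike.conj_re, RCLike.conj_im]
  ring

lemma two_mul_abs_re_star_mul_le (w e : 𝕜) {η : ℝ} (hη : 0 < η) :
    2 * |RCLike.re (star w * e)| ≤ η * ‖w‖ ^ 2 + ‖e‖ ^ 2 / η := by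
  have h1 : |RCLike.re (star w * e)| ≤ ‖w‖ * ‖e‖ := by
    refine (RCLike.abs_re_le_norm _).trans ?_
    simp
  have h2 : η * ‖w‖ ^ 2 + ‖e‖ ^ 2 / η - 2 * (‖w‖ * ‖e‖) = (η * ‖w‖ - ‖e‖) ^ 2 / η := by
    field_simp
    ring
  have h3 : 0 ≤ (η * ‖w‖ - ‖e‖) ^ 2 / η := by positivity
  linarith

/-- On the coordinates in `I`, the compression of `A` is within `η` of `T` times the identity. -/
def IsNearScalar (A : Matrix (Fin n) (Fin n) 𝕜) (I : Finset (Fin n)) (T η : ℝ) : Prop :=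
  ∀ w : Fin n → 𝕜, (∀ i ∉ I, w i = 0) →
    ∑ i ∈ I, ‖(A *ᵥ w) i - T * w i‖ ^ 2 ≤ η ^ 2 * normSq w

/-- The operator norm of the I × I block of A − T is at most its Frobenius norm. -/
lemma isNearScalar_of_sum_le {A : Matrix (Fin n) (Fin n) 𝕜} {I : Finset (Fin n)} {T η : ℝ}
    (h : ∑ i ∈ I, ∑ j ∈ I, ‖(A - (T : 𝕜) • (1 : Matrix (Fin n) (Fin n) 𝕜)) i j‖ ^ 2 ≤ η ^ 2) :
    IsNearScalar A I T η := by
  intro w hw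
  set B := A - (T : 𝕜) • (1 : Matrix (Fin n) (Fin n) 𝕜)
  have hB : ∀ i, (A *ᵥ w) i - T * w i = ∑ j ∈ I, B i j * w j := by
    intro i
    have : (A *ᵥ w) i - T * w i = (B *ᵥ w) i := by
      simp only [B, sub_mulVec, smul_mulVec, one_mulVec, Pi.sub_apply, Pi.smul_apply, smul_eq_mul]
    rw [this, mulVec, dotProduct]
    exact (Finset.sum_subset (Finset.subset_univ I) fun j _ hj => by simp [hw j hj]).symm
  have hwI : ∑ j ∈ I, ‖w j‖ ^ 2 ≤ normSq w :=
    Finset.sum_le_sum_of_subset_of_nonneg (Finset.subset_univ I) fun _ _ _ => by positivity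
  calc ∑ i ∈ I, ‖(A *ᵥ w) i - T * w i‖ ^ 2
      ≤ ∑ i ∈ I, (∑ j ∈ I, ‖B i j‖ ^ 2) * normSq w := by
        refine Finset.sum_le_sum fun i _ => ?_
        rw [hB]
        calc ‖∑ j ∈ I, B i j * w j‖ ^ 2 ≤ (∑ j ∈ I, ‖B i j‖ * ‖w j‖) ^ 2 := by
              gcongr
              exact (norm_sum_le _ _).trans (by simp)
          _ ≤ (∑ j ∈ I, ‖B i j‖ ^ 2) * ∑ j ∈ I, ‖w j‖ ^ 2 := Finset.sum_mul_sq_le_sq_mul_sq ..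
          _ ≤ _ := by gcongr
    _ = (∑ i ∈ I, ∑ j ∈ I, ‖B i j‖ ^ 2) * normSq w := by rw [Finset.sum_mul]
    _ ≤ _ := by gcongr; exact normSq_nonneg w

variable {S D : Matrix (Fin n) (Fin n) 𝕜} {d : Fin n → ℝ} {I J : Finset (Fin n)} {T η c C : ℝ}

lemma quadForm_inv_mulVec (hS : S.IsHermitian) (hD : D.PosDef) (w : Fin n → 𝕜) :
    quadForm D (D⁻¹ *ᵥ (S *ᵥ w)) = quadForm (S * D⁻¹ * S) w := by
  rw [quadForm_hermitian_conj hS]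
  unfold quadForm
  rw [mulVec_mulVec _ D, mul_nonsing_inv _ ((isUnit_iff_isUnit_det _).1 hD.isUnit), one_mulVec,
    star_dotProduct_mulVec (S *ᵥ w)]
  congr 3
  have : star D⁻¹ = D⁻¹ := hD.isHermitian.inv
  rw [this]

/-- For x = D⁻¹S w one has S x = A w with A = S D⁻¹ S, and the form is ∑ d_i |(A w)_i|² − ⟨w, A w⟩.
If A were T on I, this would be at least (cT² − T)|w|², positive because cT > 1; the other terms of
`hlt` pay for the error η. -/
lemma quadForm_sub_pos (hS : S.IsHermitian) (hD : D.PosDef) (hdI : ∀ i ∉ I, d i = 0)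
    (hJI : J ⊆ I) (hc : ∀ i ∈ J, c ≤ d i) (hC : ∀ i, |d i| ≤ C) (hη : 0 < η) (hcT : 1 < c * T)
    (hc0 : 0 ≤ c)
    (hA : IsNearScalar (S * D⁻¹ * S) I T η)
    (hlt : 0 < c * T ^ 2 - T - (2 * c * T - 1) * η - C * η ^ 2)
    (w : Fin n → 𝕜) (hw : ∀ i ∉ J, w i = 0) (hw0 : w ≠ 0) :
    0 < quadForm (S * (diagonal fun i => (d i : 𝕜)) * S - D) (D⁻¹ *ᵥ (S *ᵥ w)) := by
  rw [quadForm_sub, quadForm_hermitian_conj hS, quadForm_diagonal, quadForm_inv_mulVec hS hD]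
  set A := S * D⁻¹ * S
  have hAw : S *ᵥ (D⁻¹ *ᵥ (S *ᵥ w)) = A *ᵥ w := by simp [A, mulVec_mulVec, Matrix.mul_assoc]
  rw [hAw]
  have hq : quadForm A w = ∑ i, RCLike.re (star (w i) * (A *ᵥ w) i) := by
    simp [quadForm, dotProduct]
  rw [hq, ← Finset.sum_sub_distrib]
  set e : Fin n → 𝕜 := fun i => (A *ᵥ w) i - T * w i
  have he := hA w fun i hi => hw i fun h => hi (hJI h)
  have hae : ∀ i, (A *ᵥ w) i = T * w i + e i := fun i => by simp [e]
  have hC0 : 0 ≤ C := by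
    obtain ⟨i, -⟩ := Function.ne_iff.1 hw0
    exact (abs_nonneg _).trans (hC i)
  -- Write A w = T w + e. On J the cross term is (2cT − 1) Re(w̄e), split with weight η; on I \ J, w
  -- vanishes and d_i may be as low as −C; outside I both w and d vanish. Summing |e|² ≤ η²|w|² over
  -- I doubles the loss in η and adds Cη².
  have key : ∀ i, (c * T ^ 2 - T - (2 * c * T - 1) / 2 * η) * ‖w i‖ ^ 2
      - (if i ∈ I then ((2 * c * T - 1) / (2 * η) + C) * ‖e i‖ ^ 2 else 0)
      ≤ d i * ‖(A *ᵥ w) i‖ ^ 2 - RCLike.re (star (w i) * (A *ᵥ w) i) := by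
    intro i
    have hCe : 0 ≤ C * ‖e i‖ ^ 2 := by positivity
    by_cases hiJ : i ∈ J
    · rw [if_pos (hJI hiJ), re_star_mul_eq _ _ _ T (hae i)]
      have h1 : c * ‖(A *ᵥ w) i‖ ^ 2 ≤ d i * ‖(A *ᵥ w) i‖ ^ 2 := by
        gcongr; exact hc i hiJ
      rw [norm_sq_eq_of_eq _ _ _ T (hae i)] at h1 ⊢
      have h2 := two_mul_abs_re_star_mul_le (w i) (e i) hη
      have h3 := neg_abs_le (RCLike.re (star (w i) * e i))
      have h4 : 0 ≤ c * ‖e i‖ ^ 2 := mul_nonneg hc0 (sq_nonneg _)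
      have h5 : (2 * c * T - 1) * (-(η * ‖w i‖ ^ 2 + ‖e i‖ ^ 2 / η) / 2)
          ≤ (2 * c * T - 1) * RCLike.re (star (w i) * e i) := by
        apply mul_le_mul_of_nonneg_left <;> linarith
      have h6 : ((2 * c * T - 1) / (2 * η) + C) * ‖e i‖ ^ 2
        = (2 * c * T - 1) * (‖e i‖ ^ 2 / η / 2) + C * ‖e i‖ ^ 2 := by field_simp
      rw [h6]
      linarith
    · have hwi := hw i hiJ
      have hai := hae i
      rw [hwi, mul_zero, zero_add] at hai
      rw [hwi, hai]
      by_cases hiI : i ∈ I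
      · rw [if_pos hiI]
        have h1 : -C * ‖e i‖ ^ 2 ≤ d i * ‖e i‖ ^ 2 := by
          gcongr
          linarith [neg_abs_le (d i), hC i]
        have h2 : 0 ≤ (2 * c * T - 1) / (2 * η) * ‖e i‖ ^ 2 :=
          mul_nonneg (div_nonneg (by linarith) (by linarith)) (by positivity)
        simp only [norm_zero, star_zero, zero_mul, map_zero]
        linarith
      · simp [hiI, hdI i hiI]
  refine lt_of_lt_of_le ?_ (Finset.sum_le_sum fun i _ => key i)
  rw [Finset.sum_sub_distrib, ← Finset.mul_sum, Finset.sum_ite_mem, Finset.univ_inter,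
    ← Finset.mul_sum]
  change 0 < _ * normSq w - _
  have hpos : 0 ≤ (2 * c * T - 1) / (2 * η) + C :=
    add_nonneg (div_nonneg (by linarith) (by linarith)) hC0
  have h7 := mul_le_mul_of_nonneg_left he hpos
  have h8 : ((2 * c * T - 1) / (2 * η) + C) * (η ^ 2 * normSq w)
      = ((2 * c * T - 1) / 2 * η + C * η ^ 2) * normSq w := by field_simp
  have h9 := mul_pos hlt (normSq_pos hw0)
  rw [h8] at h7
  linarith

/-- Completing a square in D shows that ⟨x, D x⟩ is at least |y|²/(T + η), where y is the part of S
x on I \ J, whereas the perturbation contributes at most c|y|². -/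
lemma quadForm_sub_nonpos (hS : S.IsHermitian) (hD : D.PosDef) (hdI : ∀ i ∉ I, d i = 0)
    (hc : ∀ i ∉ J, d i ≤ c) (hc0 : 0 ≤ c) (hη : 0 < η) (hT : 0 < T + η)
    (hcT : c * (T + η) ≤ 1) (hA : IsNearScalar (S * D⁻¹ * S) I T η)
    (x : Fin n → 𝕜) (hx : ∀ i ∈ J, (S *ᵥ x) i = 0) :
    quadForm (S * (diagonal fun i => (d i : 𝕜)) * S - D) x ≤ 0 := by
  rw [quadForm_sub, quadForm_hermitian_conj hS, quadForm_diagonal]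
  set A := S * D⁻¹ * S
  -- Only these coordinates of S x can contribute: those in J vanish, and d vanishes outside I.
  set y : Fin n → 𝕜 := fun i => if i ∈ I \ J then (S *ᵥ x) i else 0
  have h1 : ∑ i, d i * ‖(S *ᵥ x) i‖ ^ 2 ≤ c * normSq y := by
    rw [normSq, Finset.mul_sum]
    refine Finset.sum_le_sum fun i _ => ?_
    by_cases hiJ : i ∈ J
    · simp [y, hx i hiJ]
    · by_cases hiI : i ∈ I
      · simp only [y, Finset.mem_sdiff, hiI, hiJ, not_false_eq_true, and_self, if_true]
        gcongr
        exact hc i hiJ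
      · simp [y, hiI, hdI i hiI]
  have hyI : ∀ i ∉ I, y i = 0 := fun i hi => by simp [y, hi]
  have hAy : quadForm A y ≤ (T + η) * normSq y := by
    have h2 : quadForm A y ≤ ∑ i, ((T + η / 2) * ‖y i‖ ^ 2 +
        if i ∈ I then ‖(A *ᵥ y) i - T * y i‖ ^ 2 / (2 * η) else 0) := by
      simp only [quadForm, dotProduct, map_sum, Pi.star_apply]
      refine Finset.sum_le_sum fun i _ => ?_
      by_cases hi : i ∈ I
      · rw [if_pos hi, re_star_mul_eq (y i) _ ((A *ᵥ y) i - T * y i) T (by ring)]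
        have h3 := two_mul_abs_re_star_mul_le (y i) ((A *ᵥ y) i - T * y i) hη
        have h4 := le_abs_self (RCLike.re (star (y i) * ((A *ᵥ y) i - T * y i)))
        have h5 : ‖(A *ᵥ y) i - T * y i‖ ^ 2 / (2 * η) = ‖(A *ᵥ y) i - T * y i‖ ^ 2 / η / 2 := by
          field_simp
        rw [h5]
        linarith
      · simp [hi, hyI i hi]
    rw [Finset.sum_add_distrib, ← Finset.mul_sum, Finset.sum_ite_mem, Finset.univ_inter,
      ← Finset.sum_div] at h2
    have h3 := div_le_div_of_nonneg_right (hA y hyI) (by positivity : 0 ≤ 2 * η)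
    have h4 : η ^ 2 * normSq y / (2 * η) = η / 2 * normSq y := by field_simp
    change quadForm A y ≤ (T + η / 2) * normSq y + _ at h2
    linarith
  have hxy : RCLike.re (star x ⬝ᵥ S *ᵥ y) = normSq y := by
    have : star S = S := hS
    rw [star_dotProduct_mulVec, this]
    simp only [dotProduct, map_sum, normSq, Pi.star_apply]
    refine Finset.sum_congr rfl fun i _ => ?_
    by_cases hi : i ∈ I \ J
    · simp only [y, hi, if_true, RCLike.star_def, RCLike.conj_mul]
      norm_cast
    · have : y i = 0 := if_neg hi
      simp [this]
  have hdet : IsUnit D.det := (isUnit_iff_isUnit_det _).1 hD.isUnit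
  -- With u = D⁻¹S y, positivity of D at x − tu gives ⟨x, D x⟩ ≥ 2t|y|² − t²⟨y, A y⟩ ≥ (2t − t²(T +
  -- η))|y|². This t maximises the last coefficient, with value t ≥ c.
  set t : ℝ := (T + η)⁻¹
  have hexp : quadForm D (x - (t : 𝕜) • (D⁻¹ *ᵥ (S *ᵥ y)))
      = quadForm D x - 2 * t * normSq y + t ^ 2 * quadForm A y := by
    rw [← quadForm_inv_mulVec hS hD y, ← hxy]
    have hDv : D *ᵥ (D⁻¹ *ᵥ (S *ᵥ y)) = S *ᵥ y := by
      rw [mulVec_mulVec, mul_nonsing_inv _ hdet, one_mulVec]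
    set v := D⁻¹ *ᵥ (S *ᵥ y)
    have hsym : RCLike.re (star v ⬝ᵥ D *ᵥ x) = RCLike.re (star x ⬝ᵥ S *ᵥ y) := by
      have hDs : star D = D := hD.isHermitian
      rw [star_dotProduct_mulVec, hDs, hDv, ← star_star x, star_dotProduct_star, star_star,
        dotProduct_comm, RCLike.star_def, RCLike.conj_re]
    simp only [quadForm, mulVec_sub, mulVec_smul, star_sub, star_smul, sub_dotProduct,
      dotProduct_sub, smul_dotProduct, dotProduct_smul, hDv, map_sub, smul_eq_mul,
      RCLike.star_def, RCLike.conj_ofReal, RCLike.re_ofReal_mul, hsym]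
    ring
  have hnn : 0 ≤ quadForm D (x - (t : 𝕜) • (D⁻¹ *ᵥ (S *ᵥ y))) :=
    hD.posSemidef.re_dotProduct_nonneg _
  rw [hexp] at hnn
  have ht : 0 < t := inv_pos.2 hT
  have htT : t * (T + η) = 1 := inv_mul_cancel₀ hT.ne'
  have h5 : t ^ 2 * quadForm A y ≤ t * normSq y := by
    calc t ^ 2 * quadForm A y ≤ t ^ 2 * ((T + η) * normSq y) := by gcongr
      _ = t * (t * (T + η)) * normSq y := by ring
      _ = t * normSq y := by rw [htT, mul_one]
  have h6 : c ≤ t := by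
    rw [← mul_le_mul_iff_left₀ hT, htT]; exact hcT
  have h7 := mul_le_mul_of_nonneg_right h6 (normSq_nonneg y)
  linarith

end Perturbation

end SpikedMatrix

namespace SpikedMatrix

open Matrix

/-! ### Locating single eigenvalues of X(1 + P) for diagonal P. -/

section EigenvalueBounds

variable {𝕜 : Type*} [RCLike 𝕜] {n : ℕ}

/-- The matrix `X (z - X)⁻¹`. -/
def tMat (X : Matrix (Fin n) (Fin n) 𝕜) (z : ℝ) : Matrix (Fin n) (Fin n) 𝕜 :=
  X * ((z : 𝕜) • (1 : Matrix (Fin n) (Fin n) 𝕜) - X)⁻¹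

lemma conj_unitary_mul {W : Matrix (Fin n) (Fin n) 𝕜} (hW : W ∈ unitaryGroup (Fin n) 𝕜)
    (A B : Matrix (Fin n) (Fin n) 𝕜) :
    (W * A * star W) * (W * B * star W) = W * (A * B) * star W := by
  simp only [Matrix.mul_assoc]
  rw [← Matrix.mul_assoc (star W) W, mem_unitaryGroup_iff'.1 hW, Matrix.one_mul]

lemma eig_nonneg {X : Matrix (Fin n) (Fin n) 𝕜} (hX : X.PosSemidef) (i : Fin n) : 0 ≤ eig X i := by
  have h := hX.eigenvalues_nonneg (Fintype.equivOfCardEq (Fintype.card_fin _)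
    (Fin.cast (Fintype.card_fin n).symm i))
  rw [eig_eq_eigenvalues₀ hX.isHermitian]
  simpa [IsHermitian.eigenvalues] using h

lemma isHermitian_conj_unitary {A : Matrix (Fin n) (Fin n) 𝕜} (hA : A.IsHermitian)
    (W : Matrix (Fin n) (Fin n) 𝕜) : (W * A * star W).IsHermitian := by
  rw [IsHermitian, ← star_eq_conjTranspose, star_mul, star_mul, star_star,
    (show star A = A from hA), Matrix.mul_assoc]

lemma exists_isHermitian_mul_self {X : Matrix (Fin n) (Fin n) 𝕜} (hX : X.PosSemidef) :
    ∃ S : Matrix (Fin n) (Fin n) 𝕜, S.IsHermitian ∧ S * S = X := by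
  obtain ⟨W, hW, hXW⟩ := exists_unitary_diagonal_eig hX.isHermitian
  refine ⟨W * (diagonal fun i => ((√(eig X i) : ℝ) : 𝕜)) * star W,
    isHermitian_conj_unitary (isHermitian_diagonal_ofReal _) W, ?_⟩
  rw [conj_unitary_mul hW, diagonal_mul_diagonal]
  conv_rhs => rw [hXW]
  congr 3
  ext i
  rw [← RCLike.ofReal_mul, Real.mul_self_sqrt (eig_nonneg hX i)]

section

variable {X S P : Matrix (Fin n) (Fin n) 𝕜}

/-- AB and BA have the same characteristic polynomial. This trades the non-Hermitian product for a
Hermitian matrix. -/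
lemma charpoly_mul_eq (hSX : S * S = X) :
    (X * (1 + P)).charpoly = (S * (1 + P) * S).charpoly := by
  rw [← hSX, Matrix.mul_assoc, charpoly_mul_comm]

lemma isHermitian_sandwich (hS : S.IsHermitian) (hP : P.IsHermitian) :
    (S * (1 + P) * S).IsHermitian := by
  have := isHermitian_conj_unitary (isHermitian_one.add hP) S
  rwa [show star S = S from hS] at this

lemma quadForm_sandwich (hSX : S * S = X) (x : Fin n → 𝕜) :
    quadForm (S * (1 + P) * S) x = quadForm X x + quadForm (S * P * S) x := by
  rw [Matrix.mul_add, Matrix.add_mul, quadForm_add, Matrix.mul_one, hSX]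

/-- S commutes with z − S². Thus the matrix governing the perturbation is a function of X alone,
independent of the chosen root. -/
lemma sandwich_inv_eq_tMat (hSX : S * S = X) (z : ℝ)
    (hu : IsUnit ((z : 𝕜) • (1 : Matrix (Fin n) (Fin n) 𝕜) - X)) :
    S * ((z : 𝕜) • (1 : Matrix (Fin n) (Fin n) 𝕜) - X)⁻¹ * S = tMat X z := by
  unfold tMat
  set M := (z : 𝕜) • (1 : Matrix (Fin n) (Fin n) 𝕜) - X with hM
  have hdet := (isUnit_iff_isUnit_det _).1 hu
  have hc : M * S = S * M := by
    rw [hM, ← hSX]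
    simp [Matrix.sub_mul, Matrix.mul_sub, Matrix.mul_assoc]
  have : M⁻¹ * S = S * M⁻¹ := by
    calc M⁻¹ * S = M⁻¹ * (S * M) * M⁻¹ := by
          rw [Matrix.mul_assoc, Matrix.mul_assoc, mul_nonsing_inv _ hdet, Matrix.mul_one]
      _ = S * M⁻¹ := by
          rw [← hc, ← Matrix.mul_assoc, nonsing_inv_mul _ hdet, Matrix.one_mul]
  rw [Matrix.mul_assoc, this, ← Matrix.mul_assoc, hSX]

end

variable {X : Matrix (Fin n) (Fin n) 𝕜} {d : Fin n → ℝ} {I J : Finset (Fin n)} {T η c C z : ℝ}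

lemma eig_congr {M N : Matrix (Fin n) (Fin n) 𝕜} (h : M.charpoly = N.charpoly) (i : Fin n) :
    eig M i = eig N i := eigenvalueDesc_congr h _

/-- Extension of a vector on a finite set of coordinates by zero. -/
def extendZero (𝕜 : Type*) [RCLike 𝕜] (J : Finset (Fin n)) : (J → 𝕜) →ₗ[𝕜] (Fin n → 𝕜) where
  toFun w i := if h : i ∈ J then w ⟨i, h⟩ else 0
  map_add' w v := by ext i; by_cases h : i ∈ J <;> simp [h]
  map_smul' a w := by ext i; by_cases h : i ∈ J <;> simp [h]

lemma extendZero_of_notMem (w : J → 𝕜) {i : Fin n} (hi : i ∉ J) : extendZero 𝕜 J w i = 0 := by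
  simp [extendZero, hi]

lemma extendZero_ne_zero {w : J → 𝕜} (hw : w ≠ 0) : extendZero 𝕜 J w ≠ 0 := by
  obtain ⟨⟨i, hi⟩, h⟩ := Function.ne_iff.1 hw
  refine Function.ne_iff.2 ⟨i, ?_⟩
  simpa [extendZero, hi] using h

lemma quadForm_scalar_sub (M : Matrix (Fin n) (Fin n) 𝕜) (z : ℝ) (x : Fin n → 𝕜) :
    quadForm ((z : 𝕜) • (1 : Matrix (Fin n) (Fin n) 𝕜) - M) x = z * normSq x - quadForm M x := by
  rw [quadForm_sub, quadForm_smul_one]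

lemma quadForm_sub_scalar (M : Matrix (Fin n) (Fin n) 𝕜) (z : ℝ) (x : Fin n → 𝕜) :
    quadForm (M - (z : 𝕜) • (1 : Matrix (Fin n) (Fin n) 𝕜)) x = quadForm M x - z * normSq x := by
  rw [quadForm_sub, quadForm_smul_one]

/-- Stands in for injectivity of the map producing the test vectors: a nonzero value of the form
shows that the vector is nonzero. -/
lemma normSq_pos_of_quadForm_ne {M : Matrix (Fin n) (Fin n) 𝕜} {x : Fin n → 𝕜}
    (h : quadForm M x ≠ 0) : 0 < normSq x :=
  normSq_pos fun hx => h (by simp [hx, quadForm])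

/-- A sufficient condition for the `i`-th eigenvalue to exceed `z`. -/
lemma lt_eig_mul_one_add (hX : X.PosSemidef)
    (hz : ((z : 𝕜) • (1 : Matrix (Fin n) (Fin n) 𝕜) - X).PosDef) (hdI : ∀ i ∉ I, d i = 0)
    (hJI : J ⊆ I) (hc : ∀ i ∈ J, c ≤ d i) (hC : ∀ i, |d i| ≤ C) (hη : 0 < η) (hcT : 1 < c * T)
    (hc0 : 0 ≤ c) (hA : IsNearScalar (tMat X z) I T η)
    (hlt : 0 < c * T ^ 2 - T - (2 * c * T - 1) * η - C * η ^ 2)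
    (i : Fin n) (hi : (i : ℕ) + 1 ≤ J.card) :
    z < eig (X * (1 + diagonal fun i => (d i : 𝕜))) i := by
  obtain ⟨S, hS, hSX⟩ := exists_isHermitian_mul_self hX
  rw [eig_congr (charpoly_mul_eq hSX)]
  set D := (z : 𝕜) • (1 : Matrix (Fin n) (Fin n) 𝕜) - X
  -- On the vectors D⁻¹S w with w ≠ 0 supported on J the form of S(1 + P)S exceeds z times the
  -- squared norm, while at one of them it is at most the i-th eigenvalue times the squared norm.
  obtain ⟨w, hw, hle⟩ := exists_quadForm_le
    (isHermitian_sandwich hS (isHermitian_diagonal_ofReal d))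
    (D⁻¹.mulVecLin ∘ₗ S.mulVecLin ∘ₗ extendZero 𝕜 J) i (by simpa using hi)
  have hpos := quadForm_sub_pos hS hz hdI hJI hc hC hη hcT hc0
    (by rwa [sandwich_inv_eq_tMat hSX z hz.isUnit]) hlt _
    (fun i hi => extendZero_of_notMem w hi) (extendZero_ne_zero hw)
  simp only [LinearMap.comp_apply, mulVecLin_apply] at hle
  rw [quadForm_sandwich hSX] at hle
  set x := D⁻¹ *ᵥ (S *ᵥ extendZero 𝕜 J w)
  have hx := normSq_pos_of_quadForm_ne hpos.ne'
  rw [quadForm_sub, quadForm_scalar_sub] at hpos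
  exact lt_of_mul_lt_mul_right (by linarith) hx.le

/-- The vectors whose image under `S` vanishes on the coordinates in `J`. -/
def vanishingOn (S : Matrix (Fin n) (Fin n) 𝕜) (J : Finset (Fin n)) {E : Type*} [AddCommGroup E]
    [Module 𝕜 E] (G : E →ₗ[𝕜] (Fin n → 𝕜)) : Submodule 𝕜 E :=
  LinearMap.ker ((LinearMap.funLeft 𝕜 𝕜 (Subtype.val : J → Fin n)) ∘ₗ S.mulVecLin ∘ₗ G)

lemma apply_eq_zero_of_mem_vanishingOn {S : Matrix (Fin n) (Fin n) 𝕜} {E : Type*}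
    [AddCommGroup E] [Module 𝕜 E] {G : E →ₗ[𝕜] (Fin n → 𝕜)} (x : vanishingOn S J G) {i : Fin n}
    (hi : i ∈ J) : (S *ᵥ G x) i = 0 :=
  congrFun (LinearMap.mem_ker.1 x.2) ⟨i, hi⟩

lemma finrank_le_finrank_vanishingOn_add (S : Matrix (Fin n) (Fin n) 𝕜) (J : Finset (Fin n))
    {E : Type*} [AddCommGroup E] [Module 𝕜 E] [FiniteDimensional 𝕜 E]
    (G : E →ₗ[𝕜] (Fin n → 𝕜)) :
    Module.finrank 𝕜 E ≤ Module.finrank 𝕜 (vanishingOn S J G) + J.card := by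
  unfold vanishingOn
  set L := (LinearMap.funLeft 𝕜 𝕜 (Subtype.val : J → Fin n)) ∘ₗ S.mulVecLin ∘ₗ G
  have h1 := L.finrank_range_add_finrank_ker
  have h2 := Submodule.finrank_le (LinearMap.range L)
  simp only [Module.finrank_fintype_fun_eq_card, Fintype.card_coe] at h2
  omega

/-- A sufficient condition for the `i`-th eigenvalue not to exceed `z`. -/
lemma eig_mul_one_add_le (hX : X.PosSemidef)
    (hz : ((z : 𝕜) • (1 : Matrix (Fin n) (Fin n) 𝕜) - X).PosDef) (hdI : ∀ i ∉ I, d i = 0)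
    (hc : ∀ i ∉ J, d i ≤ c) (hc0 : 0 ≤ c) (hη : 0 < η) (hT : 0 < T + η)
    (hcT : c * (T + η) ≤ 1) (hA : IsNearScalar (tMat X z) I T η) (i : Fin n) (hi : J.card ≤ i) :
    eig (X * (1 + diagonal fun i => (d i : 𝕜))) i ≤ z := by
  obtain ⟨S, hS, hSX⟩ := exists_isHermitian_mul_self hX
  rw [eig_congr (charpoly_mul_eq hSX)]
  set D := (z : 𝕜) • (1 : Matrix (Fin n) (Fin n) 𝕜) - X
  have hfr := finrank_le_finrank_vanishingOn_add S J (LinearMap.id : (Fin n → 𝕜) →ₗ[𝕜] _)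
  rw [Module.finrank_fin_fun] at hfr
  -- The vectors x with S x = 0 on J have codimension at most |J| ≤ i, hence dimension at least n −
  -- i.
  obtain ⟨w, hw, hle⟩ := exists_le_quadForm
    (isHermitian_sandwich hS (isHermitian_diagonal_ofReal d))
    (vanishingOn S J (LinearMap.id : (Fin n → 𝕜) →ₗ[𝕜] _)).subtype i (by omega)
  have hnp := quadForm_sub_nonpos hS hz hdI hc hc0 hη hT hcT
    (by rwa [sandwich_inv_eq_tMat hSX z hz.isUnit]) (w : Fin n → 𝕜)
    fun i hi => apply_eq_zero_of_mem_vanishingOn w hi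
  simp only [Submodule.subtype_apply] at hle
  rw [quadForm_sandwich hSX] at hle
  have hx : 0 < normSq (w : Fin n → 𝕜) := normSq_pos fun h => hw (Subtype.ext h)
  rw [quadForm_sub, quadForm_scalar_sub] at hnp
  exact le_of_mul_le_mul_right (by linarith) hx

lemma IsNearScalar.neg {A : Matrix (Fin n) (Fin n) 𝕜} (h : IsNearScalar A I T η) :
    IsNearScalar (-A) I (-T) η := by
  intro w hw
  refine le_of_eq_of_le (Finset.sum_congr rfl fun i _ => ?_) (h w hw)
  rw [neg_mulVec, ← norm_neg]
  congr 2
  simp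
  ring

/-- Below the spectrum the positive definite matrix is X − z, which turns A into −X(z − X)⁻¹.
Replacing d and T by their negatives then carries the right-edge bounds to the left edge. -/
lemma sandwich_neg_inv_eq {S : Matrix (Fin n) (Fin n) 𝕜} (hSX : S * S = X)
    (hz : (X - (z : 𝕜) • (1 : Matrix (Fin n) (Fin n) 𝕜)).PosDef) :
    S * (X - (z : 𝕜) • (1 : Matrix (Fin n) (Fin n) 𝕜))⁻¹ * S = -tMat X z := by
  have hu : IsUnit ((z : 𝕜) • (1 : Matrix (Fin n) (Fin n) 𝕜) - X) := by
    rw [← neg_sub]; exact hz.isUnit.neg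
  rw [← sandwich_inv_eq_tMat hSX z hu, ← neg_sub]
  have hinv : (-((z : 𝕜) • (1 : Matrix (Fin n) (Fin n) 𝕜) - X))⁻¹
      = -((z : 𝕜) • (1 : Matrix (Fin n) (Fin n) 𝕜) - X)⁻¹ := by
    apply inv_eq_right_inv
    rw [neg_mul_neg, mul_nonsing_inv _ ((isUnit_iff_isUnit_det _).1 hu)]
  rw [hinv, Matrix.mul_neg, Matrix.neg_mul]

/-- A sufficient condition for the `i`-th eigenvalue to lie below `z`. -/
lemma eig_mul_one_add_lt (hX : X.PosSemidef)
    (hz : (X - (z : 𝕜) • (1 : Matrix (Fin n) (Fin n) 𝕜)).PosDef) (hdI : ∀ i ∉ I, d i = 0)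
    (hJI : J ⊆ I) (hc : ∀ i ∈ J, d i ≤ -c) (hC : ∀ i, |d i| ≤ C) (hη : 0 < η) (hcT : 1 < c * T)
    (hc0 : 0 ≤ c) (hA : IsNearScalar (tMat X z) I (-T) η)
    (hlt : 0 < c * T ^ 2 - T - (2 * c * T - 1) * η - C * η ^ 2)
    (i : Fin n) (hi : n - i ≤ J.card) :
    eig (X * (1 + diagonal fun i => (d i : 𝕜))) i < z := by
  obtain ⟨S, hS, hSX⟩ := exists_isHermitian_mul_self hX
  rw [eig_congr (charpoly_mul_eq hSX)]
  set D := X - (z : 𝕜) • (1 : Matrix (Fin n) (Fin n) 𝕜)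
  obtain ⟨w, hw, hle⟩ := exists_le_quadForm
    (isHermitian_sandwich hS (isHermitian_diagonal_ofReal d))
    (D⁻¹.mulVecLin ∘ₗ S.mulVecLin ∘ₗ extendZero 𝕜 J) i (by simpa using hi)
  -- With D = X − z the form shown to be positive is −SPS − D = z − S(1 + P)S.
  have hpos := quadForm_sub_pos (d := -d) hS hz (by simpa using hdI) hJI
    (fun i hi => by have := hc i hi; simp only [Pi.neg_apply]; linarith) (by simpa using hC) hη
    hcT hc0 (by rw [sandwich_neg_inv_eq hSX hz]; simpa using hA.neg) hlt _
    (fun i hi => extendZero_of_notMem w hi) (extendZero_ne_zero hw)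
  simp only [LinearMap.comp_apply, mulVecLin_apply] at hle
  rw [quadForm_sandwich hSX, quadForm_hermitian_conj hS, quadForm_diagonal] at hle
  set x := D⁻¹ *ᵥ (S *ᵥ extendZero 𝕜 J w)
  have hx := normSq_pos_of_quadForm_ne hpos.ne'
  rw [quadForm_sub, quadForm_sub_scalar, quadForm_hermitian_conj hS, quadForm_diagonal] at hpos
  simp only [Pi.neg_apply, neg_mul, Finset.sum_neg_distrib] at hpos
  exact lt_of_mul_lt_mul_right (by linarith) hx.le

/-- A sufficient condition for the `i`-th eigenvalue not to lie below `z`. -/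
lemma le_eig_mul_one_add (hX : X.PosSemidef)
    (hz : (X - (z : 𝕜) • (1 : Matrix (Fin n) (Fin n) 𝕜)).PosDef) (hdI : ∀ i ∉ I, d i = 0)
    (hc : ∀ i ∉ J, -c ≤ d i) (hc0 : 0 ≤ c) (hη : 0 < η) (hT : 0 < T + η)
    (hcT : c * (T + η) ≤ 1) (hA : IsNearScalar (tMat X z) I (-T) η) (i : Fin n)
    (hi : i + 1 + J.card ≤ n) :
    z ≤ eig (X * (1 + diagonal fun i => (d i : 𝕜))) i := by
  obtain ⟨S, hS, hSX⟩ := exists_isHermitian_mul_self hX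
  rw [eig_congr (charpoly_mul_eq hSX)]
  set D := X - (z : 𝕜) • (1 : Matrix (Fin n) (Fin n) 𝕜)
  have hfr := finrank_le_finrank_vanishingOn_add S J (LinearMap.id : (Fin n → 𝕜) →ₗ[𝕜] _)
  rw [Module.finrank_fin_fun] at hfr
  obtain ⟨w, hw, hle⟩ := exists_quadForm_le
    (isHermitian_sandwich hS (isHermitian_diagonal_ofReal d))
    (vanishingOn S J (LinearMap.id : (Fin n → 𝕜) →ₗ[𝕜] _)).subtype i (by omega)
  have hnp := quadForm_sub_nonpos (d := -d) hS hz (by simpa using hdI)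
    (fun i hi => by have := hc i hi; simp only [Pi.neg_apply]; linarith) hc0 hη hT hcT
    (by rw [sandwich_neg_inv_eq hSX hz]; simpa using hA.neg) (w : Fin n → 𝕜)
    fun i hi => apply_eq_zero_of_mem_vanishingOn w hi
  simp only [Submodule.subtype_apply] at hle
  rw [quadForm_sandwich hSX, quadForm_hermitian_conj hS, quadForm_diagonal] at hle
  have hx : 0 < normSq (w : Fin n → 𝕜) := normSq_pos fun h => hw (Subtype.ext h)
  rw [quadForm_sub, quadForm_sub_scalar, quadForm_hermitian_conj hS, quadForm_diagonal] at hnp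
  simp only [Pi.neg_apply, neg_mul, Finset.sum_neg_distrib] at hnp
  exact le_of_mul_le_mul_right (by linarith) hx

/-! ### Index shifts under a perturbation of finite rank. -/

section Interlacing

variable {S W : Matrix (Fin n) (Fin n) 𝕜}

lemma quadForm_sandwich_of_vanishing (hS : S.IsHermitian) (hSX : S * S = X)
    (hdI : ∀ i ∉ I, d i = 0) {x : Fin n → 𝕜} (hx : ∀ i ∈ I, (S *ᵥ x) i = 0) :
    quadForm (S * (1 + diagonal fun i => (d i : 𝕜)) * S) x = quadForm X x := by
  rw [quadForm_sandwich hSX, quadForm_hermitian_conj hS, quadForm_diagonal,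
    Finset.sum_eq_zero fun i _ => ?_, add_zero]
  by_cases hi : i ∈ I
  · simp [hx i hi]
  · simp [hdI i hi]

lemma quadForm_unitary_mulVec_of_conj (hW : W ∈ unitaryGroup (Fin n) 𝕜)
    (hXW : X = W * (diagonal fun i => (d i : 𝕜)) * star W) (v : Fin n → 𝕜) :
    quadForm X (W *ᵥ v) = ∑ i, d i * ‖v i‖ ^ 2 := by
  rw [hXW, quadForm_conj, mulVec_mulVec, mem_unitaryGroup_iff'.1 hW, one_mulVec,
    quadForm_diagonal]

/-- A perturbation of rank at most `|I|` lowers the index of an eigenvalue by at most `|I|`. -/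
lemma le_eig_of_card (hX : X.PosSemidef) (hdI : ∀ i ∉ I, d i = 0) (hJ : ∀ j ∈ J, c ≤ eig X j)
    (i : Fin n) (hi : (i : ℕ) + 1 + I.card ≤ J.card) :
    c ≤ eig (X * (1 + diagonal fun i => (d i : 𝕜))) i := by
  obtain ⟨S, hS, hSX⟩ := exists_isHermitian_mul_self hX
  obtain ⟨W, hW, hXW⟩ := exists_unitary_diagonal_eig hX.isHermitian
  rw [eig_congr (charpoly_mul_eq hSX)]
  -- The span of the eigenvectors of X indexed by J, to be cut by the |I| conditions under which the
  -- perturbation vanishes; at least |J| − |I| dimensions remain.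
  set G := W.mulVecLin ∘ₗ extendZero 𝕜 J
  have hfr := finrank_le_finrank_vanishingOn_add S I G
  rw [Module.finrank_fintype_fun_eq_card, Fintype.card_coe] at hfr
  obtain ⟨w, hw, hle⟩ := exists_quadForm_le
    (isHermitian_sandwich hS (isHermitian_diagonal_ofReal d))
    (G ∘ₗ (vanishingOn S I G).subtype) i (by omega)
  simp only [LinearMap.comp_apply, Submodule.subtype_apply] at hle
  rw [quadForm_sandwich_of_vanishing hS hSX hdI
    fun i hi => apply_eq_zero_of_mem_vanishingOn w hi] at hle
  have hG : G w = W *ᵥ extendZero 𝕜 J w := rfl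
  have hw0 : (w : J → 𝕜) ≠ 0 := fun h => hw (Subtype.ext h)
  rw [hG, quadForm_unitary_mulVec_of_conj hW hXW, normSq_unitary_mulVec hW] at hle
  refine le_of_mul_le_mul_right (le_trans ?_ hle) (normSq_pos (extendZero_ne_zero hw0))
  rw [normSq, Finset.mul_sum]
  refine Finset.sum_le_sum fun j _ => ?_
  by_cases hj : j ∈ J
  · exact mul_le_mul_of_nonneg_right (hJ j hj) (by positivity)
  · simp [extendZero_of_notMem _ hj]

/-- The dimension count of `le_eig_of_card`, with the other half of min-max. -/
lemma eig_le_of_card (hX : X.PosSemidef) (hdI : ∀ i ∉ I, d i = 0) (hJ : ∀ j ∈ J, eig X j ≤ c)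
    (i : Fin n) (hi : n - i + I.card ≤ J.card) :
    eig (X * (1 + diagonal fun i => (d i : 𝕜))) i ≤ c := by
  obtain ⟨S, hS, hSX⟩ := exists_isHermitian_mul_self hX
  obtain ⟨W, hW, hXW⟩ := exists_unitary_diagonal_eig hX.isHermitian
  rw [eig_congr (charpoly_mul_eq hSX)]
  set G := W.mulVecLin ∘ₗ extendZero 𝕜 J
  have hfr := finrank_le_finrank_vanishingOn_add S I G
  rw [Module.finrank_fintype_fun_eq_card, Fintype.card_coe] at hfr
  obtain ⟨w, hw, hle⟩ := exists_le_quadForm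
    (isHermitian_sandwich hS (isHermitian_diagonal_ofReal d))
    (G ∘ₗ (vanishingOn S I G).subtype) i (by omega)
  simp only [LinearMap.comp_apply, Submodule.subtype_apply] at hle
  rw [quadForm_sandwich_of_vanishing hS hSX hdI
    fun i hi => apply_eq_zero_of_mem_vanishingOn w hi] at hle
  have hG : G w = W *ᵥ extendZero 𝕜 J w := rfl
  have hw0 : (w : J → 𝕜) ≠ 0 := fun h => hw (Subtype.ext h)
  rw [hG, quadForm_unitary_mulVec_of_conj hW hXW, normSq_unitary_mulVec hW] at hle
  refine le_of_mul_le_mul_right (le_trans hle ?_) (normSq_pos (extendZero_ne_zero hw0))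
  rw [normSq, Finset.mul_sum]
  refine Finset.sum_le_sum fun j _ => ?_
  by_cases hj : j ∈ J
  · exact mul_le_mul_of_nonneg_right (hJ j hj) (by positivity)
  · simp [extendZero_of_notMem _ hj]

end Interlacing

lemma posDef_scalar_sub (hX : X.IsHermitian) (h : ∀ i, eig X i < z) :
    ((z : 𝕜) • (1 : Matrix (Fin n) (Fin n) 𝕜) - X).PosDef := by
  obtain ⟨W, hW, hXW⟩ := exists_unitary_diagonal_eig hX
  have hW1 : W * star W = 1 := mem_unitaryGroup_iff.1 hW
  have : (z : 𝕜) • (1 : Matrix (Fin n) (Fin n) 𝕜) - X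
      = W * (diagonal fun i => ((z - eig X i : ℝ) : 𝕜)) * star W := by
    conv_lhs => rw [hXW, ← hW1]
    have hd : (diagonal fun i => ((z - eig X i : ℝ) : 𝕜))
        = (z : 𝕜) • (1 : Matrix (Fin n) (Fin n) 𝕜) - diagonal fun i => (eig X i : 𝕜) := by
      rw [smul_one_eq_diagonal, diagonal_sub]
      simp
    rw [hd, Matrix.mul_sub, Matrix.sub_mul]
    simp
  rw [this]
  refine (PosDef.diagonal fun i => ?_).mul_mul_conjTranspose_same ?_
  · exact_mod_cast sub_pos.2 (h i)
  · intro u v huv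
    have h' : u ᵥ* W = v ᵥ* W := huv
    have := congrArg (fun x => x ᵥ* star W) h'
    simpa [vecMul_vecMul, hW1] using this

lemma posDef_sub_scalar (hX : X.IsHermitian) (h : ∀ i, z < eig X i) :
    (X - (z : 𝕜) • (1 : Matrix (Fin n) (Fin n) 𝕜)).PosDef := by
  obtain ⟨W, hW, hXW⟩ := exists_unitary_diagonal_eig hX
  have hW1 : W * star W = 1 := mem_unitaryGroup_iff.1 hW
  have : X - (z : 𝕜) • (1 : Matrix (Fin n) (Fin n) 𝕜)
      = W * (diagonal fun i => ((eig X i - z : ℝ) : 𝕜)) * star W := by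
    conv_lhs => rw [hXW, ← hW1]
    have hd : (diagonal fun i => ((eig X i - z : ℝ) : 𝕜))
        = (diagonal fun i => (eig X i : 𝕜)) - (z : 𝕜) • (1 : Matrix (Fin n) (Fin n) 𝕜) := by
      rw [smul_one_eq_diagonal, diagonal_sub]
      simp
    rw [hd, Matrix.mul_sub, Matrix.sub_mul]
    simp
  rw [this]
  refine (PosDef.diagonal fun i => ?_).mul_mul_conjTranspose_same ?_
  · exact_mod_cast sub_pos.2 (h i)
  · intro u v huv
    have h' : u ᵥ* W = v ᵥ* W := huv
    have := congrArg (fun x => x ᵥ* star W) h'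
    simpa [vecMul_vecMul, hW1] using this

end EigenvalueBounds

end SpikedMatrix

namespace SpikedMatrix

/-! ### The T-transform outside the support and its inverses. -/

section Transform

variable {μ : Measure ℝ} {a b : ℝ}

lemma measurable_div_sub (z : ℝ) : Measurable fun t : ℝ => t / (z - t) := by fun_prop

lemma ae_mem_Icc_of_support (ha : IsGLB μ.support a) (hb : IsLUB μ.support b) :
    ∀ᵐ t ∂μ, t ∈ Icc a b := by
  filter_upwards [Measure.support_mem_ae (μ := μ)] with t ht
  exact ⟨ha.1 ht, hb.1 ht⟩

lemma abs_div_sub_le_right {t z w : ℝ} (ha : 0 ≤ a) (ht : t ∈ Icc a b) (hw : b < w) (hz : w ≤ z) :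
    |t / (z - t)| ≤ b / (w - b) := by
  have h1 : 0 < z - t := by linarith [ht.2]
  rw [abs_of_nonneg (div_nonneg (ha.trans ht.1) h1.le)]
  exact div_le_div₀ (by linarith [ht.1, ht.2]) ht.2 (by linarith) (by linarith [ht.2])

lemma abs_div_sub_le_left {t z w : ℝ} (ha : 0 ≤ a) (ht : t ∈ Icc a b) (hw : w < a) (hz : z ≤ w) :
    |t / (z - t)| ≤ b / (a - w) := by
  have h1 : z - t < 0 := by linarith [ht.1]
  rw [abs_div, abs_of_nonneg (ha.trans ht.1), abs_of_neg h1]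
  exact div_le_div₀ (by linarith [ht.1, ht.2]) ht.2 (by linarith) (by linarith [ht.1])

lemma integral_lt_integral_of_ae_le_of_measure_lt_ne_zero {f g : ℝ → ℝ} (hf : Integrable f μ)
    (hg : Integrable g μ) (hle : f ≤ᵐ[μ] g) (hlt : μ {t | f t < g t} ≠ 0) :
    ∫ t, f t ∂μ < ∫ t, g t ∂μ := by
  rw [← sub_pos, ← integral_sub' hg hf, integral_pos_iff_support_of_nonneg_ae
    (by filter_upwards [hle] with t ht using sub_nonneg.2 ht) (hg.sub hf)]
  refine (pos_iff_ne_zero.2 hlt).trans_le (measure_mono fun t ht => ?_)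
  exact (sub_pos.2 (show f t < g t from ht)).ne'

variable [IsProbabilityMeasure μ]

lemma integrable_Ttransform_right (hab : ∀ᵐ t ∂μ, t ∈ Icc a b) (ha0 : 0 ≤ a) {z : ℝ} (hz : b < z) :
    Integrable (fun t => t / (z - t)) μ := by
  refine Integrable.of_bound (measurable_div_sub _).aestronglyMeasurable (b / (z - b)) ?_
  filter_upwards [hab] with t ht
  exact abs_div_sub_le_right ha0 ht hz le_rfl

lemma integrable_Ttransform_left (hab : ∀ᵐ t ∂μ, t ∈ Icc a b) (ha0 : 0 ≤ a) {z : ℝ} (hz : z < a) :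
    Integrable (fun t => t / (z - t)) μ := by
  refine Integrable.of_bound (measurable_div_sub _).aestronglyMeasurable (b / (a - z)) ?_
  filter_upwards [hab] with t ht
  exact abs_div_sub_le_left ha0 ht hz le_rfl

/-- If t = 0 almost everywhere, pushing μ forward by the identity gives δ_0. This is the source of
strictness in the sign and monotonicity of T. -/
lemma measure_ne_zero_of_ne_dirac (hμ : μ ≠ Measure.dirac 0) : μ {t | t ≠ 0} ≠ 0 := by
  intro h
  refine hμ ?_
  have h1 : (fun t : ℝ => t) =ᵐ[μ] fun _ => (0 : ℝ) := by
    rw [Filter.EventuallyEq, ae_iff]; exact h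
  have h2 : Measure.map (fun t : ℝ => t) μ = Measure.map (fun _ => (0 : ℝ)) μ :=
    Measure.map_congr h1
  rwa [Measure.map_id', Measure.map_const, measure_univ, one_smul] at h2

/-- For t > 0 the integrand t/(z − t) is strictly decreasing in z > b; at t = 0 it is constant, so
strictness needs mass away from 0. -/
lemma Ttransform_strictAntiOn_right (hab : ∀ᵐ t ∂μ, t ∈ Icc a b) (ha0 : 0 ≤ a)
    (hμ : μ ≠ Measure.dirac 0) : StrictAntiOn (Ttransform μ) (Ioi b) := by
  intro z hz w hw hzw
  simp only [mem_Ioi] at hz hw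
  refine integral_lt_integral_of_ae_le_of_measure_lt_ne_zero
    (integrable_Ttransform_right hab ha0 hw) (integrable_Ttransform_right hab ha0 hz) ?_ ?_
  · filter_upwards [hab] with t ht
    exact div_le_div_of_nonneg_left (ha0.trans ht.1) (by linarith [ht.2]) (by linarith)
  · refine fun h => measure_ne_zero_of_ne_dirac hμ (measure_mono_null_ae ?_ h)
    filter_upwards [hab] with t ht ht0
    exact div_lt_div_of_pos_left (lt_of_le_of_ne (ha0.trans ht.1) (Ne.symm ht0))
      (by linarith [ht.2]) (by linarith)

lemma Ttransform_strictAntiOn_left (hab : ∀ᵐ t ∂μ, t ∈ Icc a b) (ha0 : 0 ≤ a)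
    (hμ : μ ≠ Measure.dirac 0) : StrictAntiOn (Ttransform μ) (Iio a) := by
  intro z hz w hw hzw
  simp only [mem_Iio] at hz hw
  have key : ∀ t : ℝ, ∀ v : ℝ, t / (v - t) = -(t / (t - v)) := fun t v => by
    rw [← div_neg, neg_sub]
  refine integral_lt_integral_of_ae_le_of_measure_lt_ne_zero
    (integrable_Ttransform_left hab ha0 hw) (integrable_Ttransform_left hab ha0 hz) ?_ ?_
  · filter_upwards [hab] with t ht
    rw [key t w, key t z, neg_le_neg_iff]
    exact div_le_div_of_nonneg_left (ha0.trans ht.1) (by linarith [ht.1]) (by linarith)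
  · refine fun h => measure_ne_zero_of_ne_dirac hμ (measure_mono_null_ae ?_ h)
    filter_upwards [hab] with t ht ht0
    change t / (w - t) < t / (z - t)
    rw [key t w, key t z, neg_lt_neg_iff]
    exact div_lt_div_of_pos_left (lt_of_le_of_ne (ha0.trans ht.1) (Ne.symm ht0))
      (by linarith [ht.1]) (by linarith)

lemma Ttransform_pos (hab : ∀ᵐ t ∂μ, t ∈ Icc a b) (ha0 : 0 ≤ a)
    (hμ : μ ≠ Measure.dirac 0) {z : ℝ} (hz : b < z) : 0 < Ttransform μ z := by
  have h := integral_lt_integral_of_ae_le_of_measure_lt_ne_zero (μ := μ)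
    (integrable_zero ℝ ℝ μ) (integrable_Ttransform_right hab ha0 hz) ?_ ?_
  · simpa [Ttransform] using h
  · filter_upwards [hab] with t ht
    exact div_nonneg (ha0.trans ht.1) (by linarith [ht.2])
  · refine fun h => measure_ne_zero_of_ne_dirac hμ (measure_mono_null_ae ?_ h)
    filter_upwards [hab] with t ht ht0
    exact div_pos (lt_of_le_of_ne (ha0.trans ht.1) (Ne.symm ht0)) (by linarith [ht.2])

lemma Ttransform_neg (hab : ∀ᵐ t ∂μ, t ∈ Icc a b) (ha0 : 0 ≤ a)
    (hμ : μ ≠ Measure.dirac 0) {z : ℝ} (hz : z < a) : Ttransform μ z < 0 := by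
  have h := integral_lt_integral_of_ae_le_of_measure_lt_ne_zero (μ := μ)
    (integrable_Ttransform_left hab ha0 hz) (integrable_zero ℝ ℝ μ) ?_ ?_
  · simpa [Ttransform] using h
  · filter_upwards [hab] with t ht
    exact div_nonpos_of_nonneg_of_nonpos (ha0.trans ht.1) (by linarith [ht.1])
  · refine fun h => measure_ne_zero_of_ne_dirac hμ (measure_mono_null_ae ?_ h)
    filter_upwards [hab] with t ht ht0
    exact div_neg_of_pos_of_neg (lt_of_le_of_ne (ha0.trans ht.1) (Ne.symm ht0))
      (by linarith [ht.1])

lemma Ttransform_continuousOn_right (hab : ∀ᵐ t ∂μ, t ∈ Icc a b) (ha0 : 0 ≤ a) :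
    ContinuousOn (Ttransform μ) (Ioi b) := by
  intro z hz
  simp only [mem_Ioi] at hz
  -- Staying to the right of w > b bounds the integrand uniformly near z.
  obtain ⟨w, hbw, hwz⟩ := exists_between hz
  refine (continuousAt_of_dominated (bound := fun _ => b / (w - b)) ?_ ?_
    (integrable_const _) ?_).continuousWithinAt
  · exact Eventually.of_forall fun _ => (measurable_div_sub _).aestronglyMeasurable
  · filter_upwards [lt_mem_nhds hwz] with v hv
    filter_upwards [hab] with t ht
    exact abs_div_sub_le_right ha0 ht hbw hv.le
  · filter_upwards [hab] with t ht
    have : z - t ≠ 0 := by linarith [ht.2]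
    fun_prop (disch := assumption)

lemma Ttransform_continuousOn_left (hab : ∀ᵐ t ∂μ, t ∈ Icc a b) (ha0 : 0 ≤ a) :
    ContinuousOn (Ttransform μ) (Iio a) := by
  intro z hz
  simp only [mem_Iio] at hz
  obtain ⟨w, hzw, hwa⟩ := exists_between hz
  refine (continuousAt_of_dominated (bound := fun _ => b / (a - w)) ?_ ?_
    (integrable_const _) ?_).continuousWithinAt
  · exact Eventually.of_forall fun _ => (measurable_div_sub _).aestronglyMeasurable
  · filter_upwards [gt_mem_nhds hzw] with v hv
    filter_upwards [hab] with t ht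
    exact abs_div_sub_le_left ha0 ht hwa hv.le
  · filter_upwards [hab] with t ht
    have : z - t ≠ 0 := by linarith [ht.1]
    fun_prop (disch := assumption)

/-- Decay at infinity, which brings values arbitrarily close to 0 into the range. -/
lemma abs_Ttransform_le_right (hab : ∀ᵐ t ∂μ, t ∈ Icc a b) (ha0 : 0 ≤ a) {z : ℝ} (hz : b < z) :
    |Ttransform μ z| ≤ b / (z - b) := by
  have := norm_integral_le_of_norm_le_const (μ := μ) (f := fun t => t / (z - t))
    (C := b / (z - b)) (by
      filter_upwards [hab] with t ht
      exact abs_div_sub_le_right ha0 ht hz le_rfl)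
  simpa [Ttransform] using this

lemma abs_Ttransform_le_left (hab : ∀ᵐ t ∂μ, t ∈ Icc a b) (ha0 : 0 ≤ a) {z : ℝ} (hz : z < a) :
    |Ttransform μ z| ≤ b / (a - z) := by
  have := norm_integral_le_of_norm_le_const (μ := μ) (f := fun t => t / (z - t))
    (C := b / (a - z)) (by
      filter_upwards [hab] with t ht
      exact abs_div_sub_le_left ha0 ht hz le_rfl)
  simpa [Ttransform] using this

/-- By monotonicity the one-sided limit exists in [−∞, ∞] and is the supremum, so
`Function.rightLim` is a genuine limit and not its default value. -/
lemma TtransformRight_eq (hab : ∀ᵐ t ∂μ, t ∈ Icc a b) (ha0 : 0 ≤ a) (hμ : μ ≠ Measure.dirac 0) :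
    TtransformRight μ b = sSup ((fun z : ℝ => (Ttransform μ z : EReal)) '' Ioi b) := by
  refine rightLim_eq_of_tendsto (AntitoneOn.tendsto_nhdsGT ?_ (OrderTop.bddAbove _))
  intro z hz w hw hzw
  exact EReal.coe_le_coe_iff.2
    ((Ttransform_strictAntiOn_right hab ha0 hμ).antitoneOn hz hw hzw)

lemma TtransformLeft_eq (hab : ∀ᵐ t ∂μ, t ∈ Icc a b) (ha0 : 0 ≤ a) (hμ : μ ≠ Measure.dirac 0) :
    TtransformLeft μ a = sInf ((fun z : ℝ => (Ttransform μ z : EReal)) '' Iio a) := by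
  refine leftLim_eq_of_tendsto (AntitoneOn.tendsto_nhdsLT ?_ (OrderBot.bddBelow _))
  intro z hz w hw hzw
  exact EReal.coe_le_coe_iff.2
    ((Ttransform_strictAntiOn_left hab ha0 hμ).antitoneOn hz hw hzw)

lemma coe_lt_TtransformRight_iff (hab : ∀ᵐ t ∂μ, t ∈ Icc a b) (ha0 : 0 ≤ a)
    (hμ : μ ≠ Measure.dirac 0) (y : ℝ) :
    (y : EReal) < TtransformRight μ b ↔ ∃ z, b < z ∧ y < Ttransform μ z := by
  rw [TtransformRight_eq hab ha0 hμ, lt_sSup_iff]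
  simp

lemma TtransformLeft_lt_coe_iff (hab : ∀ᵐ t ∂μ, t ∈ Icc a b) (ha0 : 0 ≤ a)
    (hμ : μ ≠ Measure.dirac 0) (y : ℝ) :
    TtransformLeft μ a < (y : EReal) ↔ ∃ z, z < a ∧ Ttransform μ z < y := by
  rw [TtransformLeft_eq hab ha0 hμ, sInf_lt_iff]
  simp

/-- Injectivity is strict monotonicity. A target value is bracketed by the supremum formula on one
side and the decay at infinity on the other, and the intermediate value theorem applies. -/
lemma Ttransform_bijOn_right (hab : ∀ᵐ t ∂μ, t ∈ Icc a b) (ha0 : 0 ≤ a)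
    (hμ : μ ≠ Measure.dirac 0) :
    BijOn (Ttransform μ) (Ioi b) {y : ℝ | 0 < y ∧ (y : EReal) < TtransformRight μ b} := by
  have hanti := Ttransform_strictAntiOn_right hab ha0 hμ
  refine ⟨fun z hz => ⟨Ttransform_pos hab ha0 hμ hz, ?_⟩, hanti.injOn, fun y hy => ?_⟩
  · obtain ⟨w, hbw, hwz⟩ := exists_between (mem_Ioi.1 hz)
    exact (coe_lt_TtransformRight_iff hab ha0 hμ _).2 ⟨w, hbw, hanti hbw hz hwz⟩
  · obtain ⟨z₁, hz₁, hy₁⟩ := (coe_lt_TtransformRight_iff hab ha0 hμ _).1 hy.2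
    have hlim : Tendsto (fun z => b / (z - b)) atTop (𝓝 0) :=
      tendsto_const_nhds.div_atTop (tendsto_atTop_add_const_right _ (-b) tendsto_id)
    obtain ⟨z₂, hz₂, hzz⟩ := ((hlim.eventually_lt_const hy.1).and (eventually_gt_atTop z₁)).exists
    have hy₂ : Ttransform μ z₂ < y :=
      ((le_abs_self _).trans (abs_Ttransform_le_right hab ha0 (hz₁.trans hzz))).trans_lt hz₂
    obtain ⟨z, hz, hzy⟩ := intermediate_value_Icc' hzz.le
      ((Ttransform_continuousOn_right hab ha0).mono fun z hz => hz₁.trans_le hz.1)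
      ⟨hy₂.le, hy₁.le⟩
    exact ⟨z, hz₁.trans_le hz.1, hzy⟩

lemma Ttransform_bijOn_left (hab : ∀ᵐ t ∂μ, t ∈ Icc a b) (ha0 : 0 ≤ a)
    (hμ : μ ≠ Measure.dirac 0) :
    BijOn (Ttransform μ) (Iio a) {y : ℝ | TtransformLeft μ a < (y : EReal) ∧ y < 0} := by
  have hanti := Ttransform_strictAntiOn_left hab ha0 hμ
  refine ⟨fun z hz => ⟨?_, Ttransform_neg hab ha0 hμ hz⟩, hanti.injOn, fun y hy => ?_⟩
  · obtain ⟨w, hzw, hwa⟩ := exists_between (mem_Iio.1 hz)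
    exact (TtransformLeft_lt_coe_iff hab ha0 hμ _).2 ⟨w, hwa, hanti hz hwa hzw⟩
  · obtain ⟨z₁, hz₁, hy₁⟩ := (TtransformLeft_lt_coe_iff hab ha0 hμ _).1 hy.1
    have hlim : Tendsto (fun z => b / (a - z)) atBot (𝓝 0) :=
      tendsto_const_nhds.div_atTop (tendsto_atTop_add_const_left _ a tendsto_neg_atBot_atTop)
    obtain ⟨z₂, hz₂, hzz⟩ := ((hlim.eventually_lt_const (neg_pos.2 hy.2)).and
      (eventually_lt_atBot z₁)).exists
    have hy₂ : y < Ttransform μ z₂ := by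
      have h1 := abs_Ttransform_le_left hab ha0 (hzz.trans hz₁)
      have h2 := neg_abs_le (Ttransform μ z₂)
      linarith
    obtain ⟨z, hz, hzy⟩ := intermediate_value_Icc' hzz.le
      ((Ttransform_continuousOn_left hab ha0).mono fun z hz => lt_of_le_of_lt hz.2 hz₁)
      ⟨hy₁.le, hy₂.le⟩
    exact ⟨z, lt_of_le_of_lt hz.2 hz₁, hzy⟩

/-- The case L = ⊤ is the convention 1/∞ = 0: both sides then hold. -/
lemma coe_gt_one_div_iff {θ : ℝ} (hθ : 0 < θ) {L : EReal} (hL : 0 < L) :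
    (θ : EReal) > 1 / L ↔ ((1 / θ : ℝ) : EReal) < L := by
  induction L with
  | bot => simp at hL
  | top => simp [hθ]
  | coe x =>
    have hx : 0 < x := by exact_mod_cast hL
    rw [← EReal.coe_one, ← EReal.coe_div, gt_iff_lt, EReal.coe_lt_coe_iff, EReal.coe_lt_coe_iff,
      one_div_lt hx hθ]

lemma coe_lt_one_div_iff {θ : ℝ} (hθ : θ < 0) {L : EReal} (hL : L < 0) :
    (θ : EReal) < 1 / L ↔ L < ((1 / θ : ℝ) : EReal) := by
  induction L with
  | top => simp at hL
  | bot => simp [hθ]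
  | coe x =>
    have hx : x < 0 := by exact_mod_cast hL
    rw [← EReal.coe_one, ← EReal.coe_div, EReal.coe_lt_coe_iff, EReal.coe_lt_coe_iff,
      lt_one_div_of_neg hθ hx]

/-- Identification of the limit of an eigenvalue from above-or-below tests at rational points. -/
lemma tendsto_ite_TinvRight (hab : ∀ᵐ t ∂μ, t ∈ Icc a b) (ha0 : 0 ≤ a)
    (hμ : μ ≠ Measure.dirac 0) {θ : ℝ} (hθ : 0 < θ) {l : ℕ → ℝ}
    (h1 : ∀ q : ℚ, b < q → 1 < θ * Ttransform μ q → ∀ᶠ n in atTop, (q : ℝ) < l n)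
    (h2 : ∀ q : ℚ, b < q → θ * Ttransform μ q < 1 → ∀ᶠ n in atTop, l n ≤ q)
    (h3 : ∀ c < b, ∀ᶠ n in atTop, c ≤ l n) :
    Tendsto l atTop (𝓝 (if (θ : EReal) > 1 / TtransformRight μ b
      then TinvRight μ b (1 / θ) else b)) := by
  have hanti := Ttransform_strictAntiOn_right hab ha0 hμ
  have hL : 0 < TtransformRight μ b := (coe_lt_TtransformRight_iff hab ha0 hμ 0).2
    ⟨b + 1, by linarith, Ttransform_pos hab ha0 hμ (by linarith)⟩
  simp only [coe_gt_one_div_iff hθ hL]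
  split_ifs with h
  · have hmem : 1 / θ ∈ Ttransform μ '' Ioi b :=
      (Ttransform_bijOn_right hab ha0 hμ).surjOn ⟨by positivity, h⟩
    have hT : Ttransform μ (TinvRight μ b (1 / θ)) = 1 / θ := Function.invFunOn_eq hmem
    have hρ : b < TinvRight μ b (1 / θ) := Function.invFunOn_mem hmem
    set ρ := TinvRight μ b (1 / θ)
    have hθT : ∀ x, θ * (1 / θ) = x → x = 1 := fun x hx => by rw [← hx, mul_one_div_cancel hθ.ne']
    -- T is strictly decreasing with T(ρ) = 1/θ, so a rational q > b satisfies θ T(q) > 1 exactly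
    -- when it lies to the left of ρ.
    refine tendsto_order.2 ⟨fun c hc => ?_, fun c hc => ?_⟩
    · obtain ⟨q, hq1, hq2⟩ := exists_rat_btwn (max_lt hc hρ)
      have hbq := (le_max_right _ _).trans_lt hq1
      filter_upwards [h1 q hbq (by
        have := mul_lt_mul_of_pos_left (hanti hbq hρ hq2) hθ
        rwa [hT, hθT _ rfl] at this)] with n hn
      exact ((le_max_left _ _).trans_lt hq1).trans hn
    · obtain ⟨q, hq1, hq2⟩ := exists_rat_btwn hc
      filter_upwards [h2 q (hρ.trans hq1) (by
        have := mul_lt_mul_of_pos_left (hanti hρ (hρ.trans hq1) hq1) hθ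
        rwa [hT, hθT _ rfl] at this)] with n hn
      exact hn.trans_lt hq2
  -- Here T(q) < T(b⁺) ≤ 1/θ for every q > b, so every upper test succeeds and only the edge bound
  -- `h3` is left for the lower side.
  · refine tendsto_order.2 ⟨fun c hc => ?_, fun c hc => ?_⟩
    · obtain ⟨c', hc1, hc2⟩ := exists_between hc
      filter_upwards [h3 c' hc2] with n hn using hc1.trans_le hn
    · obtain ⟨q, hq1, hq2⟩ := exists_rat_btwn hc
      have hlt : (Ttransform μ q : EReal) < ((1 / θ : ℝ) : EReal) :=
        ((Ttransform_bijOn_right hab ha0 hμ).mapsTo hq1).2.trans_le (not_lt.1 h)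
      rw [EReal.coe_lt_coe_iff, lt_div_iff₀ hθ, mul_comm] at hlt
      filter_upwards [h2 q hq1 hlt] with n hn using hn.trans_lt hq2

lemma tendsto_ite_TinvLeft (hab : ∀ᵐ t ∂μ, t ∈ Icc a b) (ha0 : 0 ≤ a)
    (hμ : μ ≠ Measure.dirac 0) {θ : ℝ} (hθ : θ < 0) {l : ℕ → ℝ}
    (h1 : ∀ q : ℚ, q < a → 1 < θ * Ttransform μ q → ∀ᶠ n in atTop, l n < q)
    (h2 : ∀ q : ℚ, q < a → θ * Ttransform μ q < 1 → ∀ᶠ n in atTop, (q : ℝ) ≤ l n)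
    (h3 : ∀ c > a, ∀ᶠ n in atTop, l n ≤ c) :
    Tendsto l atTop (𝓝 (if (θ : EReal) < 1 / TtransformLeft μ a
      then TinvLeft μ a (1 / θ) else a)) := by
  have hanti := Ttransform_strictAntiOn_left hab ha0 hμ
  have hL : TtransformLeft μ a < 0 := (TtransformLeft_lt_coe_iff hab ha0 hμ 0).2
    ⟨a - 1, by linarith, Ttransform_neg hab ha0 hμ (by linarith)⟩
  simp only [coe_lt_one_div_iff hθ hL]
  split_ifs with h
  · have hmem : 1 / θ ∈ Ttransform μ '' Iio a :=
      (Ttransform_bijOn_left hab ha0 hμ).surjOn ⟨h, one_div_neg.2 hθ⟩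
    have hT : Ttransform μ (TinvLeft μ a (1 / θ)) = 1 / θ := Function.invFunOn_eq hmem
    have hρ : TinvLeft μ a (1 / θ) < a := Function.invFunOn_mem hmem
    set ρ := TinvLeft μ a (1 / θ)
    have hθT : ∀ x, θ * (1 / θ) = x → x = 1 := fun x hx => by rw [← hx, mul_one_div_cancel hθ.ne]
    refine tendsto_order.2 ⟨fun c hc => ?_, fun c hc => ?_⟩
    · obtain ⟨q, hq1, hq2⟩ := exists_rat_btwn hc
      filter_upwards [h2 q (hq2.trans hρ) (by
        have := mul_lt_mul_of_neg_left (hanti (hq2.trans hρ) hρ hq2) hθ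
        rwa [hT, hθT _ rfl] at this)] with n hn
      exact hq1.trans_le hn
    · obtain ⟨q, hq1, hq2⟩ := exists_rat_btwn (lt_min hc hρ)
      have hqa := hq2.trans_le (min_le_right _ _)
      filter_upwards [h1 q hqa (by
        have := mul_lt_mul_of_neg_left (hanti hρ hqa hq1) hθ
        rwa [hT, hθT _ rfl] at this)] with n hn
      exact hn.trans (hq2.trans_le (min_le_left _ _))
  · refine tendsto_order.2 ⟨fun c hc => ?_, fun c hc => ?_⟩
    · obtain ⟨q, hq1, hq2⟩ := exists_rat_btwn hc
      have hlt : ((1 / θ : ℝ) : EReal) < (Ttransform μ q : EReal) :=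
        (not_lt.1 h).trans_lt ((Ttransform_bijOn_left hab ha0 hμ).mapsTo hq2).1
      rw [EReal.coe_lt_coe_iff, div_lt_iff_of_neg hθ, mul_comm] at hlt
      filter_upwards [h2 q hq2 hlt] with n hn using hq1.trans_le hn
    · obtain ⟨c', hc1, hc2⟩ := exists_between hc
      filter_upwards [h3 c' hc1] with n hn using hn.trans_lt hc2

end Transform

end SpikedMatrix

namespace SpikedMatrix

open Matrix

/-! ### Eighth moments of Rademacher sums. -/

section Khintchine

/-- The sign attached to a Boolean. -/
def boolSign (e : Bool) : ℝ := if e then 1 else -1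

lemma boolSign_mul_self (e : Bool) : boolSign e * boolSign e = 1 := by cases e <;> simp [boolSign]

/-- Expand the product of the factors exp(c_j) + exp(−c_j) over all choices of signs. -/
lemma sum_exp_boolSign {n : ℕ} (c : Fin n → ℝ) :
    ∑ e : Fin n → Bool, Real.exp (∑ j, boolSign (e j) * c j) = 2 ^ n * ∏ j, Real.cosh (c j) := by
  simp only [Real.exp_sum]
  have h := Finset.prod_univ_sum (fun _ : Fin n => (Finset.univ : Finset Bool))
    fun j e => Real.exp (boolSign e * c j)
  rw [Fintype.piFinset_univ] at h
  rw [← h]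
  have : ∀ j, ∑ e, Real.exp (boolSign e * c j) = 2 * Real.cosh (c j) := fun j => by
    simp [boolSign, Real.cosh_eq]
    ring
  simp only [this, Finset.prod_mul_distrib, Finset.prod_const, Finset.card_univ, Fintype.card_fin]

/-- The constant in the eighth moment Khintchine inequality. -/
def khintchineConst : ℝ := 2 * 40320 * Real.exp (1 / 2)

lemma khintchineConst_pos : 0 < khintchineConst := by unfold khintchineConst; positivity

/-- One term of the exponential series; 40320 = 8!. -/
lemma pow_eight_le (s : ℝ) : s ^ 8 ≤ 40320 * (Real.exp s + Real.exp (-s)) := by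
  have h := Real.pow_div_factorial_le_exp |s| (abs_nonneg s) 8
  have h8 : |s| ^ 8 = s ^ 8 := Even.pow_abs (by decide) s
  rw [h8, div_le_iff₀ (by positivity)] at h
  have hf : ((Nat.factorial 8 : ℕ) : ℝ) = 40320 := by norm_num [Nat.factorial]
  rw [hf] at h
  have h2 : Real.exp |s| ≤ Real.exp s + Real.exp (-s) := by
    rcases abs_cases s with ⟨h, -⟩ | ⟨h, -⟩ <;> rw [h] <;>
      linarith [Real.exp_pos s, Real.exp_pos (-s)]
  linarith

/-- Khintchine's inequality for the eighth moment of a Rademacher sum. -/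
lemma sum_boolSign_pow_eight_le {n : ℕ} (c : Fin n → ℝ) :
    ∑ e : Fin n → Bool, (∑ j, boolSign (e j) * c j) ^ 8
      ≤ 2 ^ n * (khintchineConst * (∑ j, c j ^ 2) ^ 4) := by
  have hbase : ∀ c : Fin n → ℝ, ∑ j, c j ^ 2 = 1 →
      ∑ e : Fin n → Bool, (∑ j, boolSign (e j) * c j) ^ 8 ≤ 2 ^ n * khintchineConst := by
    intro c hc
    have hcosh : ∏ j, Real.cosh (c j) ≤ Real.exp (1 / 2) := by
      calc ∏ j, Real.cosh (c j) ≤ ∏ j, Real.exp (c j ^ 2 / 2) :=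
            Finset.prod_le_prod (fun j _ => (Real.cosh_pos _).le)
              fun j _ => Real.cosh_le_exp_half_sq _
        _ = Real.exp (1 / 2) := by rw [← Real.exp_sum, ← Finset.sum_div, hc]
    calc ∑ e : Fin n → Bool, (∑ j, boolSign (e j) * c j) ^ 8
        ≤ ∑ e : Fin n → Bool, 40320 * (Real.exp (∑ j, boolSign (e j) * c j)
          + Real.exp (∑ j, boolSign (e j) * -c j)) := by
          refine Finset.sum_le_sum fun e _ => ?_
          simpa only [mul_neg, Finset.sum_neg_distrib] using
            pow_eight_le (∑ j, boolSign (e j) * c j)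
      _ = 40320 * (2 * (2 ^ n * ∏ j, Real.cosh (c j))) := by
          rw [← Finset.mul_sum, Finset.sum_add_distrib, sum_exp_boolSign,
            sum_exp_boolSign fun j => -c j]
          simp only [Real.cosh_neg]
          ring
      _ ≤ 40320 * (2 * (2 ^ n * Real.exp (1 / 2))) := by gcongr
      _ = 2 ^ n * khintchineConst := by unfold khintchineConst; ring
  rcases eq_or_lt_of_le (Finset.sum_nonneg fun j _ => sq_nonneg (c j) : 0 ≤ ∑ j, c j ^ 2)
    with h0 | hpos
  · have hc : ∀ j, c j = 0 := fun j => by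
      simpa using (Finset.sum_eq_zero_iff_of_nonneg fun j _ => sq_nonneg (c j)).1 h0.symm j
        (Finset.mem_univ j)
    simp [hc]
  -- Both sides are homogeneous of degree 8, so c may be normalised.
  · set q := ∑ j, c j ^ 2
    have hq := Real.sq_sqrt hpos.le
    have hs : 0 < √q := Real.sqrt_pos.2 hpos
    have h1 := hbase (fun j => c j / √q) (by
      simp only [div_pow, hq]
      rw [← Finset.sum_div, div_self hpos.ne'])
    have h2 : ∀ e : Fin n → Bool, (∑ j, boolSign (e j) * c j) ^ 8
        = (∑ j, boolSign (e j) * (c j / √q)) ^ 8 * q ^ 4 := by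
      intro e
      have : ∑ j, boolSign (e j) * c j = (∑ j, boolSign (e j) * (c j / √q)) * √q := by
        rw [Finset.sum_mul]
        exact Finset.sum_congr rfl fun j _ => by field_simp
      have hq8 : √q ^ 8 = q ^ 4 := by rw [← hq, ← pow_mul, hq]
      rw [this, mul_pow, hq8]
    simp only [h2]
    rw [← Finset.sum_mul, ← mul_assoc]
    gcongr

/-- Real and imaginary parts are treated separately: (p² + q²)⁴ ≤ 8(p⁸ + q⁸), and two Khintchine
bounds make 16. -/
lemma sum_norm_boolSign_pow_eight_le {𝕜 : Type*} [RCLike 𝕜] {n : ℕ} (v : Fin n → 𝕜) :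
    ∑ e : Fin n → Bool, ‖∑ j, (boolSign (e j) : 𝕜) * v j‖ ^ 8
      ≤ 2 ^ n * (16 * khintchineConst * normSq v ^ 4) := by
  have hre := sum_boolSign_pow_eight_le fun j => RCLike.re (v j)
  have him := sum_boolSign_pow_eight_le fun j => RCLike.im (v j)
  have hre2 : ∑ j, RCLike.re (v j) ^ 2 ≤ normSq v :=
    Finset.sum_le_sum fun j _ => by
      rw [RCLike.norm_sq_eq_def]; nlinarith [sq_nonneg (RCLike.im (v j))]
  have him2 : ∑ j, RCLike.im (v j) ^ 2 ≤ normSq v :=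
    Finset.sum_le_sum fun j _ => by
      rw [RCLike.norm_sq_eq_def]; nlinarith [sq_nonneg (RCLike.re (v j))]
  have hK := khintchineConst_pos
  have hre3 : ∑ e : Fin n → Bool, (∑ j, boolSign (e j) * RCLike.re (v j)) ^ 8
      ≤ 2 ^ n * (khintchineConst * normSq v ^ 4) := hre.trans (by gcongr)
  have him3 : ∑ e : Fin n → Bool, (∑ j, boolSign (e j) * RCLike.im (v j)) ^ 8
      ≤ 2 ^ n * (khintchineConst * normSq v ^ 4) := him.trans (by gcongr)
  calc ∑ e : Fin n → Bool, ‖∑ j, (boolSign (e j) : 𝕜) * v j‖ ^ 8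
      ≤ ∑ e : Fin n → Bool, 8 * ((∑ j, boolSign (e j) * RCLike.re (v j)) ^ 8
        + (∑ j, boolSign (e j) * RCLike.im (v j)) ^ 8) := by
        refine Finset.sum_le_sum fun e _ => ?_
        have h1 : ‖∑ j, (boolSign (e j) : 𝕜) * v j‖ ^ 2
            = (∑ j, boolSign (e j) * RCLike.re (v j)) ^ 2
              + (∑ j, boolSign (e j) * RCLike.im (v j)) ^ 2 := by
          rw [RCLike.norm_sq_eq_def]
          simp only [map_sum, RCLike.re_ofReal_mul, RCLike.im_ofReal_mul]
          ring
        set p := ∑ j, boolSign (e j) * RCLike.re (v j)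
        set q := ∑ j, boolSign (e j) * RCLike.im (v j)
        have h2 := add_pow_le (sq_nonneg p) (sq_nonneg q) 4
        calc ‖∑ j, (boolSign (e j) : 𝕜) * v j‖ ^ 8 = (p ^ 2 + q ^ 2) ^ 4 := by rw [← h1]; ring
          _ ≤ _ := h2.trans (le_of_eq (by ring))
    _ ≤ _ := by
        rw [← Finset.mul_sum, Finset.sum_add_distrib]
        linarith

end Khintchine

/-! ### Fourth moments by exchangeable pairs. -/

section Exchangeable

/-- Fourth moment bound for a centred linear combination of exchangeable nonnegative variables. -/
lemma integral_pow_four_le_of_exchangeable {G : Type*} [TopologicalSpace G] [CompactSpace G]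
    [MeasurableSpace G] [BorelSpace G] (ν : Measure G) [IsFiniteMeasure ν] {n : ℕ}
    (x : Fin n → G → ℝ) (hx : ∀ i, Continuous (x i)) (hx0 : ∀ i g, 0 ≤ x i g)
    (hex : ∀ i j, ∀ Φ : (Fin n → ℝ) → ℝ,
      ∫ g, Φ (fun k => x (Equiv.swap i j k) g) ∂ν = ∫ g, Φ (fun k => x k g) ∂ν)
    {M : ℝ} (hM : ∀ i, ∫ g, x i g ^ 4 ∂ν ≤ M) {β : Fin n → ℝ} (hβ : ∑ i, β i = 0) :
    ∫ g, (∑ i, β i * x i g) ^ 4 ∂ν ≤ 36 * (∑ i, β i ^ 2) ^ 2 * M := by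
  have hint : ∀ {f : G → ℝ}, Continuous f → Integrable f ν := fun hf =>
    hf.integrable_of_hasCompactSupport (HasCompactSupport.of_compactSpace _)
  rcases Nat.eq_zero_or_pos n with rfl | hn
  · simp
  have hn' : (0 : ℝ) < n := by exact_mod_cast hn
  set f : G → ℝ := fun g => ∑ i, β i * x i g with hf
  have hfc : Continuous f := by fun_prop
  -- Transposing i and j turns f into f − δ i j and δ i j into its negative.
  set δ : Fin n → Fin n → G → ℝ := fun i j g => (β i - β j) * (x i g - x j g) with hδ
  have hδc : ∀ i j, Continuous (δ i j) := fun i j => by fun_prop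
  have hswap : ∀ i j g, ∑ k, β k * x (Equiv.swap i j k) g = f g - δ i j g := by
    intro i j g
    have h1 : f g - ∑ k, β k * x (Equiv.swap i j k) g
        = ∑ k, β k * (x k g - x (Equiv.swap i j k) g) := by
      simp only [hf, mul_sub, Finset.sum_sub_distrib]
    have h2 : ∑ k, β k * (x k g - x (Equiv.swap i j k) g) = δ i j g := by
      rcases eq_or_ne i j with rfl | hij
      · simp [hδ]
      rw [← Finset.sum_subset (Finset.subset_univ {i, j}), Finset.sum_pair hij]
      · simp only [Equiv.swap_apply_left, Equiv.swap_apply_right, hδ]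
        ring
      · intro k _ hk
        simp only [Finset.mem_insert, Finset.mem_singleton, not_or] at hk
        rw [Equiv.swap_apply_of_ne_of_ne hk.1 hk.2]
        simp
    linarith
  have hδswap : ∀ i j g, (β i - β j) * (x (Equiv.swap i j i) g - x (Equiv.swap i j j) g)
      = -δ i j g := by
    intro i j g
    simp only [Equiv.swap_apply_left, Equiv.swap_apply_right, hδ]
    ring
  -- By this symmetry 2∫δf³ = ∫δ(f³ − g³) with g = f − δ, and δ(f³ − g³) = δ²(f² + fg + g²) ≤
  -- (3/2)δ²(f² + g²).
  have hpair : ∀ i j, ∫ g, δ i j g * f g ^ 3 ∂ν ≤ 3 / 2 * ∫ g, δ i j g ^ 2 * f g ^ 2 ∂ν := by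
    intro i j
    have e1 := hex i j fun y => (β i - β j) * (y i - y j) * (∑ k, β k * y k) ^ 3
    have e2 := hex i j fun y => ((β i - β j) * (y i - y j)) ^ 2 * (∑ k, β k * y k) ^ 2
    simp only [hswap, hδswap] at e1 e2
    change ∫ g, -δ i j g * (f g - δ i j g) ^ 3 ∂ν = ∫ g, δ i j g * f g ^ 3 ∂ν at e1
    change ∫ g, (-δ i j g) ^ 2 * (f g - δ i j g) ^ 2 ∂ν = ∫ g, δ i j g ^ 2 * f g ^ 2 ∂ν at e2
    have hmono : ∫ g, (δ i j g * f g ^ 3 + -δ i j g * (f g - δ i j g) ^ 3) ∂ν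
        ≤ ∫ g, (3 / 2 * (δ i j g ^ 2 * f g ^ 2)
          + 3 / 2 * ((-δ i j g) ^ 2 * (f g - δ i j g) ^ 2)) ∂ν := by
      have := hδc i j
      refine integral_mono (hint (by fun_prop)) (hint (by fun_prop)) fun g => ?_
      have h : 0 ≤ δ i j g ^ 2 * (f g - (f g - δ i j g)) ^ 2 := by positivity
      simp only
      nlinarith
    have := hδc i j
    rw [integral_add (hint (by fun_prop)) (hint (by fun_prop)),
      integral_add (hint (by fun_prop)) (hint (by fun_prop)), integral_const_mul,
      integral_const_mul, e1, e2] at hmono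
    linarith
  -- Because ∑ β = 0, f is recovered from its increments.
  have hsum : ∀ g, ∑ i, ∑ j, δ i j g = 2 * n * f g := by
    intro g
    have : ∀ i j, δ i j g = β i * x i g - β i * x j g - β j * x i g + β j * x j g := fun i j => by
      simp only [hδ]; ring
    simp only [this, Finset.sum_add_distrib, Finset.sum_sub_distrib, ← Finset.mul_sum,
      ← Finset.sum_mul, hβ, Finset.sum_const, Finset.card_univ, Fintype.card_fin, nsmul_eq_mul]
    simp only [fun i => mul_left_comm (β i) (n : ℝ) (x i g), ← Finset.mul_sum, hf]
    ring
  set E : G → ℝ := fun g => ∑ i, ∑ j, δ i j g ^ 2 with hE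
  have hEc : Continuous E := by fun_prop
  have hmain : 2 * n * ∫ g, f g ^ 4 ∂ν ≤ 3 / 2 * ∫ g, E g * f g ^ 2 ∂ν := by
    calc 2 * n * ∫ g, f g ^ 4 ∂ν = ∫ g, ∑ i, ∑ j, δ i j g * f g ^ 3 ∂ν := by
          rw [← integral_const_mul]
          congr 1 with g
          simp only [← Finset.sum_mul, hsum]
          ring
      _ = ∑ i, ∑ j, ∫ g, δ i j g * f g ^ 3 ∂ν := by
          rw [integral_finsetSum _ fun i _ => hint (by fun_prop)]
          refine Finset.sum_congr rfl fun i _ => ?_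
          rw [integral_finsetSum _ fun j _ => hint (by fun_prop)]
      _ ≤ ∑ i, ∑ j, 3 / 2 * ∫ g, δ i j g ^ 2 * f g ^ 2 ∂ν :=
          Finset.sum_le_sum fun i _ => Finset.sum_le_sum fun j _ => hpair i j
      _ = 3 / 2 * ∫ g, E g * f g ^ 2 ∂ν := by
          simp only [← Finset.mul_sum, hE, Finset.sum_mul]
          rw [integral_finsetSum _ fun i _ => hint (by fun_prop)]
          congr 1
          refine Finset.sum_congr rfl fun i _ => ?_
          rw [integral_finsetSum _ fun j _ => hint (by fun_prop)]
  -- The weights are chosen so that n∫f⁴, half of the left side of `hmain`, can be absorbed; what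
  -- remains is the second moment of `E`.
  have hamgm : 3 / 2 * ∫ g, E g * f g ^ 2 ∂ν
      ≤ n * ∫ g, f g ^ 4 ∂ν + 9 / (16 * n) * ∫ g, E g ^ 2 ∂ν := by
    rw [← integral_const_mul, ← integral_const_mul, ← integral_const_mul,
      ← integral_add (hint (by fun_prop)) (hint (by fun_prop))]
    refine integral_mono (hint (by fun_prop)) (hint (by fun_prop)) fun g => ?_
    have h : 0 ≤ (n * f g ^ 2 - 3 / 4 * E g) ^ 2 / n := by positivity
    have h' : (n * f g ^ 2 - 3 / 4 * E g) ^ 2 / n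
        = n * f g ^ 4 + 9 / (16 * n) * E g ^ 2 - 3 / 2 * (E g * f g ^ 2) := by
      field_simp
      ring
    simp only
    linarith
  set p := ∑ i, β i ^ 2 with hp
  have hp0 : 0 ≤ p := Finset.sum_nonneg fun i _ => sq_nonneg _
  have hEle : ∀ g, E g ≤ 4 * n * ∑ i, β i ^ 2 * x i g ^ 2 + 4 * p * ∑ i, x i g ^ 2 := by
    intro g
    calc E g ≤ ∑ i, ∑ j, 2 * ((β i ^ 2 + β j ^ 2) * (x i g ^ 2 + x j g ^ 2)) := by
          refine Finset.sum_le_sum fun i _ => Finset.sum_le_sum fun j _ => ?_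
          have h1 : (β i - β j) ^ 2 ≤ 2 * (β i ^ 2 + β j ^ 2) := by
            nlinarith [sq_nonneg (β i + β j)]
          have h2 : (x i g - x j g) ^ 2 ≤ x i g ^ 2 + x j g ^ 2 := by
            nlinarith [mul_nonneg (hx0 i g) (hx0 j g)]
          calc δ i j g ^ 2 = (β i - β j) ^ 2 * (x i g - x j g) ^ 2 := by simp only [hδ]; ring
            _ ≤ (2 * (β i ^ 2 + β j ^ 2)) * (x i g ^ 2 + x j g ^ 2) := by gcongr
            _ = _ := by ring
      _ = _ := by
          have : ∀ i j, 2 * ((β i ^ 2 + β j ^ 2) * (x i g ^ 2 + x j g ^ 2))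
              = 2 * (β i ^ 2 * x i g ^ 2) + 2 * (β i ^ 2 * x j g ^ 2) + 2 * (β j ^ 2 * x i g ^ 2)
                + 2 * (β j ^ 2 * x j g ^ 2) := fun i j => by ring
          simp only [this, Finset.sum_add_distrib, ← Finset.mul_sum, ← Finset.sum_mul,
            Finset.sum_const, Finset.card_univ, Fintype.card_fin, nsmul_eq_mul]
          simp only [fun i => mul_left_comm (β i ^ 2) (n : ℝ) (x i g ^ 2), ← Finset.mul_sum, hp]
          ring
  have hE0 : ∀ g, 0 ≤ E g := fun g =>
    Finset.sum_nonneg fun i _ => Finset.sum_nonneg fun j _ => sq_nonneg _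
  have hE2 : ∀ g, E g ^ 2 ≤ 32 * n ^ 2 * (p * ∑ i, β i ^ 2 * x i g ^ 4)
      + 32 * p ^ 2 * (n * ∑ i, x i g ^ 4) := by
    intro g
    have h1 : (∑ i, β i ^ 2 * x i g ^ 2) ^ 2 ≤ p * ∑ i, β i ^ 2 * x i g ^ 4 := by
      have := Finset.sum_mul_sq_le_sq_mul_sq Finset.univ β fun i => β i * x i g ^ 2
      calc (∑ i, β i ^ 2 * x i g ^ 2) ^ 2 = (∑ i, β i * (β i * x i g ^ 2)) ^ 2 := by
            congr 1; exact Finset.sum_congr rfl fun i _ => by ring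
        _ ≤ _ := this
        _ = _ := by congr 1; exact Finset.sum_congr rfl fun i _ => by ring
    have h2 : (∑ i, x i g ^ 2) ^ 2 ≤ n * ∑ i, x i g ^ 4 := by
      have := sq_sum_le_card_mul_sum_sq (s := Finset.univ) (f := fun i => x i g ^ 2)
      simpa [← pow_mul] using this
    calc E g ^ 2 ≤ (4 * n * ∑ i, β i ^ 2 * x i g ^ 2 + 4 * p * ∑ i, x i g ^ 2) ^ 2 := by
          have := hE0 g
          gcongr
          exact hEle g
      _ ≤ 2 * (4 * n * ∑ i, β i ^ 2 * x i g ^ 2) ^ 2 + 2 * (4 * p * ∑ i, x i g ^ 2) ^ 2 := by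
          nlinarith [sq_nonneg (4 * n * ∑ i, β i ^ 2 * x i g ^ 2 - 4 * p * ∑ i, x i g ^ 2)]
      _ = 32 * n ^ 2 * (∑ i, β i ^ 2 * x i g ^ 2) ^ 2 + 32 * p ^ 2 * (∑ i, x i g ^ 2) ^ 2 := by
          ring
      _ ≤ _ := by gcongr
  have hEint : ∫ g, E g ^ 2 ∂ν ≤ 64 * n ^ 2 * p ^ 2 * M := by
    have h1 : ∑ i, β i ^ 2 * ∫ g, x i g ^ 4 ∂ν ≤ p * M := by
      rw [hp, Finset.sum_mul]
      exact Finset.sum_le_sum fun i _ => mul_le_mul_of_nonneg_left (hM i) (sq_nonneg _)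
    have h2 : ∑ i, ∫ g, x i g ^ 4 ∂ν ≤ n * M := by
      refine (Finset.sum_le_sum fun i _ => hM i).trans ?_
      simp
    calc ∫ g, E g ^ 2 ∂ν ≤ ∫ g, (32 * n ^ 2 * (p * ∑ i, β i ^ 2 * x i g ^ 4)
          + 32 * p ^ 2 * (n * ∑ i, x i g ^ 4)) ∂ν :=
          integral_mono (hint (by fun_prop)) (hint (by fun_prop)) hE2
      _ = 32 * n ^ 2 * (p * ∑ i, β i ^ 2 * ∫ g, x i g ^ 4 ∂ν)
          + 32 * p ^ 2 * (n * ∑ i, ∫ g, x i g ^ 4 ∂ν) := by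
          rw [integral_add (hint (by fun_prop)) (hint (by fun_prop))]
          simp only [integral_const_mul]
          rw [integral_finsetSum _ fun i _ => hint (by fun_prop),
            integral_finsetSum _ fun i _ => hint (by fun_prop)]
          simp only [integral_const_mul]
      _ ≤ 32 * n ^ 2 * (p * (p * M)) + 32 * p ^ 2 * (n * (n * M)) := by gcongr
      _ = _ := by ring
  have hfin : n * ∫ g, f g ^ 4 ∂ν ≤ n * (36 * p ^ 2 * M) := by
    have h1 : 9 / (16 * n) * ∫ g, E g ^ 2 ∂ν ≤ 9 / (16 * n) * (64 * n ^ 2 * p ^ 2 * M) := by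
      gcongr
    have h2 : 9 / (16 * (n : ℝ)) * (64 * n ^ 2 * p ^ 2 * M) = n * (36 * p ^ 2 * M) := by
      field_simp
      ring
    linarith
  exact le_of_mul_le_mul_left hfin hn'

end Exchangeable

end SpikedMatrix

namespace SpikedMatrix

open Matrix

/-! ### Quadratic forms in Haar-rotated vectors. -/

section Haar

variable {𝕜 : Type*} [RCLike 𝕜] {n : ℕ}

instance instBorelSpaceMatrix : BorelSpace (Matrix (Fin n) (Fin n) 𝕜) :=
  inferInstanceAs (BorelSpace (Fin n → Fin n → 𝕜))

instance instSecondCountableTopologyMatrix : SecondCountableTopology (Matrix (Fin n) (Fin n) 𝕜) :=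
  inferInstanceAs (SecondCountableTopology (Fin n → Fin n → 𝕜))

instance instBorelSpaceUnitaryGroup : BorelSpace (unitaryGroup (Fin n) 𝕜) := Subtype.borelSpace _

instance instCompactSpaceUnitaryGroup : CompactSpace (unitaryGroup (Fin n) 𝕜) := by
  refine isCompact_iff_compactSpace.1 ?_
  have hK : IsCompact (Set.univ.pi fun _ : Fin n => Set.univ.pi fun _ : Fin n =>
      Metric.closedBall (0 : 𝕜) 1) :=
    isCompact_univ_pi fun _ => isCompact_univ_pi fun _ => isCompact_closedBall _ _
  refine IsCompact.of_isClosed_subset (X := Matrix (Fin n) (Fin n) 𝕜) hK isClosed_unitary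
    fun U hU i _ j _ => ?_
  simpa using entry_norm_bound_of_unitary hU i j

/-- The Haar probability measure on the unitary group of `𝕜^n`. -/
def haarUnitary (n : ℕ) (𝕜 : Type*) [RCLike 𝕜] : Measure (unitaryGroup (Fin n) 𝕜) :=
  Measure.haarMeasure ⊤

instance instIsProbabilityMeasureHaarUnitary : IsProbabilityMeasure (haarUnitary n 𝕜) :=
  ⟨Measure.haarMeasure_self⟩

instance instIsMulLeftInvariantHaarUnitary : (haarUnitary n 𝕜).IsMulLeftInvariant :=
  by
  unfold haarUnitary; infer_instance

lemma integrable_haarUnitary {f : unitaryGroup (Fin n) 𝕜 → ℝ} (hf : Continuous f) :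
    Integrable f (haarUnitary n 𝕜) :=
  hf.integrable_of_hasCompactSupport (HasCompactSupport.of_compactSpace _)

lemma integral_haarUnitary_mul_left (f : Matrix (Fin n) (Fin n) 𝕜 → ℝ)
    {g : Matrix (Fin n) (Fin n) 𝕜} (hg : g ∈ unitaryGroup (Fin n) 𝕜) :
    ∫ U, f (g * (U : Matrix (Fin n) (Fin n) 𝕜)) ∂(haarUnitary n 𝕜)
      = ∫ U, f (U : Matrix (Fin n) (Fin n) 𝕜) ∂(haarUnitary n 𝕜) :=
  integral_mul_left_eq_self (μ := haarUnitary n 𝕜)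
    (fun U : unitaryGroup (Fin n) 𝕜 => f (U : Matrix (Fin n) (Fin n) 𝕜)) ⟨g, hg⟩

/-- Every unit vector is a row of a unitary matrix. -/
lemma exists_unitary_row (k : Fin n) (v : Fin n → 𝕜) (hv : normSq v = 1) :
    ∃ g ∈ unitaryGroup (Fin n) 𝕜, ∀ x : Fin n → 𝕜, (g *ᵥ x) k = star v ⬝ᵥ x := by
  set v' : EuclideanSpace 𝕜 (Fin n) := WithLp.toLp 2 v
  have hv' : ‖v'‖ = 1 := by
    rw [EuclideanSpace.norm_eq, Real.sqrt_eq_one]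
    exact hv
  have horth : Orthonormal 𝕜 (({k} : Set (Fin n)).domRestrict fun _ : Fin n => v') := by
    refine ⟨fun _ => hv', fun i j hij => ?_⟩
    exact absurd (Subsingleton.elim i j) hij
  obtain ⟨b, hb⟩ := horth.exists_orthonormalBasis_extension_of_card_eq (by simp)
  refine ⟨star ((EuclideanSpace.basisFun (Fin n) 𝕜).toBasis.toMatrix b),
    star_mem_unitaryGroup
      ((EuclideanSpace.basisFun (Fin n) 𝕜).toMatrix_orthonormalBasis_mem_unitary b), fun x => ?_⟩
  have hbk := hb k rfl
  simp only [mulVec, dotProduct, star_apply, Module.Basis.toMatrix_apply, hbk, Pi.star_apply]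
  refine Finset.sum_congr rfl fun j _ => ?_
  rfl

lemma continuous_unitary_mulVec (w : Fin n → 𝕜) (k : Fin n) :
    Continuous fun U : unitaryGroup (Fin n) 𝕜 => ((U : Matrix (Fin n) (Fin n) 𝕜) *ᵥ w) k :=
  (continuous_apply k).comp (continuous_subtype_val.matrix_mulVec continuous_const)

/-- Left multiplication by a unitary whose k-th row is n^(−1/2) times a sign vector preserves Haar
measure, so the k-th coordinate may be replaced by a normalised signed sum of all coordinates.
Averaging over the signs and Khintchine bound it by the norm of U w, which is that of w. -/
lemma integral_norm_unitary_mulVec_pow_eight_le (w : Fin n → 𝕜) (k : Fin n) :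
    ∫ U, ‖((U : Matrix (Fin n) (Fin n) 𝕜) *ᵥ w) k‖ ^ 8 ∂(haarUnitary n 𝕜)
      ≤ 16 * khintchineConst * normSq w ^ 4 / n ^ 4 := by
  have hn : (0 : ℝ) < n := by exact_mod_cast k.pos
  have hsq : √(n : ℝ) ^ 2 = n := Real.sq_sqrt hn.le
  have hs : 0 < √(n : ℝ) := Real.sqrt_pos.2 hn
  have h1 : ∀ e : Fin n → Bool,
      ∫ U, ‖((U : Matrix (Fin n) (Fin n) 𝕜) *ᵥ w) k‖ ^ 8 ∂(haarUnitary n 𝕜)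
      = ∫ U, ‖∑ j, (boolSign (e j) : 𝕜) * ((U : Matrix (Fin n) (Fin n) 𝕜) *ᵥ w) j‖ ^ 8 / n ^ 4
        ∂(haarUnitary n 𝕜) := by
    intro e
    obtain ⟨g, hg, hgk⟩ := exists_unitary_row (𝕜 := 𝕜) k
      (fun j => ((boolSign (e j) / √(n : ℝ) : ℝ) : 𝕜)) (by
        simp only [normSq, RCLike.norm_ofReal, sq_abs, div_pow, hsq]
        simp only [pow_two, boolSign_mul_self]
        simp [hn.ne'])
    rw [← integral_haarUnitary_mul_left (fun M => ‖(M *ᵥ w) k‖ ^ 8) hg]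
    congr 1 with U
    rw [← mulVec_mulVec, hgk]
    have : (star fun j => ((boolSign (e j) / √(n : ℝ) : ℝ) : 𝕜))
        ⬝ᵥ ((U : Matrix (Fin n) (Fin n) 𝕜) *ᵥ w)
        = (((√(n : ℝ))⁻¹ : ℝ) : 𝕜)
          * ∑ j, (boolSign (e j) : 𝕜) * ((U : Matrix (Fin n) (Fin n) 𝕜) *ᵥ w) j := by
      rw [dotProduct, Finset.mul_sum]
      refine Finset.sum_congr rfl fun j _ => ?_
      simp only [Pi.star_apply, RCLike.star_def, RCLike.conj_ofReal]
      rw [div_eq_inv_mul, RCLike.ofReal_mul, mul_assoc]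
    rw [this, norm_mul, mul_pow, RCLike.norm_ofReal, abs_of_pos (inv_pos.2 hs), inv_pow,
      div_eq_inv_mul]
    congr 2
    calc √(n : ℝ) ^ 8 = (√(n : ℝ) ^ 2) ^ 4 := by rw [← pow_mul]
      _ = (n : ℝ) ^ 4 := by rw [hsq]
  have hcont : ∀ e : Fin n → Bool, Continuous fun U : unitaryGroup (Fin n) 𝕜 =>
      ‖∑ j, (boolSign (e j) : 𝕜) * ((U : Matrix (Fin n) (Fin n) 𝕜) *ᵥ w) j‖ ^ 8 / n ^ 4 := by
    intro e
    have := continuous_unitary_mulVec w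
    fun_prop
  have h2 : (2 : ℝ) ^ n * ∫ U, ‖((U : Matrix (Fin n) (Fin n) 𝕜) *ᵥ w) k‖ ^ 8 ∂(haarUnitary n 𝕜)
      = ∫ U, (∑ e : Fin n → Bool,
        ‖∑ j, (boolSign (e j) : 𝕜) * ((U : Matrix (Fin n) (Fin n) 𝕜) *ᵥ w) j‖ ^ 8 / n ^ 4)
        ∂(haarUnitary n 𝕜) := by
    rw [integral_finsetSum _ fun e _ => integrable_haarUnitary (hcont e)]
    simp only [← h1, Finset.sum_const, Finset.card_univ, Fintype.card_fun, Fintype.card_fin,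
      Fintype.card_bool, nsmul_eq_mul]
    simp
  have h3 : ∫ U, (∑ e : Fin n → Bool,
        ‖∑ j, (boolSign (e j) : 𝕜) * ((U : Matrix (Fin n) (Fin n) 𝕜) *ᵥ w) j‖ ^ 8 / n ^ 4)
        ∂(haarUnitary n 𝕜)
      ≤ ∫ _, (2 : ℝ) ^ n * (16 * khintchineConst * normSq w ^ 4 / n ^ 4) ∂(haarUnitary n 𝕜) := by
    refine integral_mono (integrable_haarUnitary (by fun_prop)) (integrable_const _) fun U => ?_
    have := sum_norm_boolSign_pow_eight_le ((U : Matrix (Fin n) (Fin n) 𝕜) *ᵥ w)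
    rw [normSq_unitary_mulVec U.2] at this
    simp only
    rw [← Finset.sum_div, ← mul_div_assoc]
    gcongr
  rw [← h2] at h3
  simp only [integral_const, probReal_univ, one_smul] at h3
  exact le_of_mul_le_mul_left h3 (by positivity)

/-- The squared Frobenius norm. -/
def frobSq (M : Matrix (Fin n) (Fin n) 𝕜) : ℝ := ∑ i, ∑ j, ‖M i j‖ ^ 2

lemma frobSq_nonneg (M : Matrix (Fin n) (Fin n) 𝕜) : 0 ≤ frobSq M :=
  Finset.sum_nonneg fun _ _ => Finset.sum_nonneg fun _ _ => by positivity

lemma frobSq_eq_sum_normSq (M : Matrix (Fin n) (Fin n) 𝕜) : frobSq M = ∑ j, normSq (M.col j) := by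
  unfold frobSq normSq
  rw [Finset.sum_comm]
  rfl

lemma frobSq_star (M : Matrix (Fin n) (Fin n) 𝕜) : frobSq (star M) = frobSq M := by
  unfold frobSq
  rw [Finset.sum_comm]
  simp [star_apply]

lemma frobSq_unitary_mul {U : Matrix (Fin n) (Fin n) 𝕜} (hU : U ∈ unitaryGroup (Fin n) 𝕜)
    (M : Matrix (Fin n) (Fin n) 𝕜) : frobSq (U * M) = frobSq M := by
  simp only [frobSq_eq_sum_normSq]
  refine Finset.sum_congr rfl fun j _ => ?_
  rw [← normSq_unitary_mulVec hU (M.col j)]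
  rfl

lemma frobSq_mul_unitary {U : Matrix (Fin n) (Fin n) 𝕜} (hU : U ∈ unitaryGroup (Fin n) 𝕜)
    (M : Matrix (Fin n) (Fin n) 𝕜) : frobSq (M * U) = frobSq M := by
  rw [← frobSq_star, star_mul, frobSq_unitary_mul (star_mem_unitaryGroup hU), frobSq_star]

lemma frobSq_diagonal (d : Fin n → ℝ) :
    frobSq (diagonal fun i => (d i : 𝕜)) = ∑ i, d i ^ 2 := by
  unfold frobSq
  refine Finset.sum_congr rfl fun i _ => ?_
  rw [Finset.sum_eq_single i]
  · simp
  · intro j _ hj; simp [diagonal_apply_ne' _ hj]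
  · simp

lemma trace_conj_unitary {U : Matrix (Fin n) (Fin n) 𝕜} (hU : U ∈ unitaryGroup (Fin n) 𝕜)
    (M : Matrix (Fin n) (Fin n) 𝕜) : (U * M * star U).trace = M.trace := by
  rw [trace_mul_comm, ← Matrix.mul_assoc, mem_unitaryGroup_iff'.1 hU, Matrix.one_mul]

/-- The constant in the fourth moment bound for quadratic forms of Haar vectors. -/
def haarConst : ℝ := 36 * (16 * khintchineConst)

lemma haarConst_pos : 0 < haarConst := by
  have := khintchineConst_pos
  unfold haarConst; positivity

/-- Haar invariance absorbs the eigenbasis of B and leaves a combination of squared moduli of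
coordinates whose coefficients sum to tr B = 0. Permutation matrices are unitary, so these squares
are exchangeable. -/
lemma integral_quadForm_unitary_pow_four_le {B : Matrix (Fin n) (Fin n) 𝕜} (hB : B.IsHermitian)
    (htr : B.trace = 0) (w : Fin n → 𝕜) :
    ∫ U, quadForm B ((U : Matrix (Fin n) (Fin n) 𝕜) *ᵥ w) ^ 4 ∂(haarUnitary n 𝕜)
      ≤ haarConst * frobSq B ^ 2 * normSq w ^ 4 / n ^ 4 := by
  obtain ⟨W, hW, hBW⟩ := exists_unitary_diagonal_eig hB
  have hfrob : frobSq B = ∑ i, eig B i ^ 2 := by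
    conv_lhs => rw [hBW]
    rw [frobSq_mul_unitary (star_mem_unitaryGroup hW), frobSq_unitary_mul hW, frobSq_diagonal]
  have hsum : ∑ i, eig B i = 0 := by
    rw [hBW, trace_conj_unitary hW, trace_diagonal] at htr
    exact_mod_cast htr
  have hform : ∀ U : Matrix (Fin n) (Fin n) 𝕜,
      quadForm B (U *ᵥ w) = ∑ i, eig B i * ‖((star W * U) *ᵥ w) i‖ ^ 2 := by
    intro U
    conv_lhs => rw [hBW]
    rw [quadForm_conj, quadForm_diagonal, mulVec_mulVec]
  simp only [hform]
  rw [integral_haarUnitary_mul_left (fun M => (∑ i, eig B i * ‖(M *ᵥ w) i‖ ^ 2) ^ 4)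
    (star_mem_unitaryGroup hW)]
  have hcont := continuous_unitary_mulVec w
  have h := integral_pow_four_le_of_exchangeable (haarUnitary n 𝕜)
    (fun i U => ‖((U : Matrix (Fin n) (Fin n) 𝕜) *ᵥ w) i‖ ^ 2) (fun i => by fun_prop)
    (fun i U => by positivity) ?_ (M := 16 * khintchineConst * normSq w ^ 4 / n ^ 4) ?_ hsum
  · refine h.trans (le_of_eq ?_)
    rw [hfrob, haarConst]
    ring
  · intro i j Φ
    have hg : (Equiv.swap i j).permMatrix 𝕜 ∈ unitaryGroup (Fin n) 𝕜 := by
      rw [mem_unitaryGroup_iff, star_eq_conjTranspose, conjTranspose_permMatrix, ← permMatrix_mul]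
      simp
    rw [← integral_haarUnitary_mul_left (fun M => Φ fun k => ‖(M *ᵥ w) k‖ ^ 2) hg]
    simp only [← mulVec_mulVec, permMatrix_mulVec, Function.comp_apply]
  · intro i
    refine le_of_eq_of_le ?_ (integral_norm_unitary_mulVec_pow_eight_le w i)
    simp only [← pow_mul]

lemma four_mul_re_star_dotProduct {B : Matrix (Fin n) (Fin n) 𝕜} (hB : B.IsHermitian)
    (x y : Fin n → 𝕜) :
    4 * RCLike.re (star x ⬝ᵥ B *ᵥ y) = quadForm B (x + y) - quadForm B (x - y) := by
  have hsym : RCLike.re (star y ⬝ᵥ B *ᵥ x) = RCLike.re (star x ⬝ᵥ B *ᵥ y) := by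
    rw [star_dotProduct_mulVec, show star B = B from hB, star_dotProduct, RCLike.star_def,
      RCLike.conj_re]
  simp only [quadForm, mulVec_add, mulVec_sub, star_add, star_sub, add_dotProduct, sub_dotProduct,
    dotProduct_add, dotProduct_sub, map_add, map_sub, hsym]
  ring

lemma normSq_add_le (u v : Fin n → 𝕜) : normSq (u + v) ≤ 2 * normSq u + 2 * normSq v := by
  unfold normSq
  rw [Finset.mul_sum, Finset.mul_sum, ← Finset.sum_add_distrib]
  refine Finset.sum_le_sum fun i _ => ?_
  calc ‖(u + v) i‖ ^ 2 ≤ (‖u i‖ + ‖v i‖) ^ 2 := by gcongr; exact norm_add_le _ _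
    _ ≤ _ := by nlinarith [sq_nonneg (‖u i‖ - ‖v i‖)]

lemma normSq_smul (c : 𝕜) (v : Fin n → 𝕜) : normSq (c • v) = ‖c‖ ^ 2 * normSq v := by
  simp [normSq, Finset.mul_sum, mul_pow]

lemma continuous_quadForm_unitary (B : Matrix (Fin n) (Fin n) 𝕜) (w : Fin n → 𝕜) :
    Continuous fun U : unitaryGroup (Fin n) 𝕜 =>
      quadForm B ((U : Matrix (Fin n) (Fin n) 𝕜) *ᵥ w) := by
  have : Continuous fun U : unitaryGroup (Fin n) 𝕜 => (U : Matrix (Fin n) (Fin n) 𝕜) *ᵥ w :=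
    continuous_subtype_val.matrix_mulVec continuous_const
  exact RCLike.continuous_re.comp
    (this.star.dotProduct (continuous_const.matrix_mulVec this))

lemma continuous_star_dotProduct_unitary (B : Matrix (Fin n) (Fin n) 𝕜) (u v : Fin n → 𝕜) :
    Continuous fun U : unitaryGroup (Fin n) 𝕜 =>
      star ((U : Matrix (Fin n) (Fin n) 𝕜) *ᵥ u) ⬝ᵥ B *ᵥ ((U : Matrix (Fin n) (Fin n) 𝕜) *ᵥ v) := by
  have : ∀ w, Continuous fun U : unitaryGroup (Fin n) 𝕜 =>
      (U : Matrix (Fin n) (Fin n) 𝕜) *ᵥ w :=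
    fun w => continuous_subtype_val.matrix_mulVec continuous_const
  exact (this u).star.dotProduct (continuous_const.matrix_mulVec (this v))

/-- Polarisation. The factor is 16 = 2 · 4⁴/32: the fourth power of the real part is at most 1/32 of
the sum of those of the forms at u ± v, and these vectors have squared norm at most 4. -/
lemma integral_re_star_dotProduct_unitary_pow_four_le {B : Matrix (Fin n) (Fin n) 𝕜}
    (hB : B.IsHermitian) (htr : B.trace = 0) {u v : Fin n → 𝕜} (hu : normSq u ≤ 1)
    (hv : normSq v ≤ 1) :
    ∫ U, RCLike.re (star ((U : Matrix (Fin n) (Fin n) 𝕜) *ᵥ u) ⬝ᵥ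
        B *ᵥ ((U : Matrix (Fin n) (Fin n) 𝕜) *ᵥ v)) ^ 4 ∂(haarUnitary n 𝕜)
      ≤ 16 * (haarConst * frobSq B ^ 2 / n ^ 4) := by
  have hH := haarConst_pos
  have hplus : normSq (u + v) ≤ 4 := by linarith [normSq_add_le u v]
  have hminus : normSq (u - v) ≤ 4 := by
    have h1 := normSq_add_le u ((-1 : 𝕜) • v)
    rw [normSq_smul] at h1
    simp only [norm_neg, norm_one, one_pow, one_mul, neg_smul, one_smul] at h1
    rw [sub_eq_add_neg]
    linarith
  have hbound : ∀ w : Fin n → 𝕜, normSq w ≤ 4 →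
      ∫ U, quadForm B ((U : Matrix (Fin n) (Fin n) 𝕜) *ᵥ w) ^ 4 ∂(haarUnitary n 𝕜)
      ≤ 256 * (haarConst * frobSq B ^ 2 / n ^ 4) := by
    intro w hw
    refine (integral_quadForm_unitary_pow_four_le hB htr w).trans ?_
    have h1 : normSq w ^ 4 ≤ 4 ^ 4 := pow_le_pow_left₀ (normSq_nonneg w) hw 4
    calc haarConst * frobSq B ^ 2 * normSq w ^ 4 / n ^ 4
        = normSq w ^ 4 * (haarConst * frobSq B ^ 2 / n ^ 4) := by ring
      _ ≤ 4 ^ 4 * (haarConst * frobSq B ^ 2 / n ^ 4) := by gcongr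
      _ = _ := by norm_num
  have hp := continuous_quadForm_unitary B (u + v)
  have hm := continuous_quadForm_unitary B (u - v)
  have hr := continuous_star_dotProduct_unitary B u v
  calc _ ≤ ∫ U, 1 / 32 * (quadForm B ((U : Matrix (Fin n) (Fin n) 𝕜) *ᵥ (u + v)) ^ 4
        + quadForm B ((U : Matrix (Fin n) (Fin n) 𝕜) *ᵥ (u - v)) ^ 4) ∂(haarUnitary n 𝕜) := by
        refine integral_mono (integrable_haarUnitary ((RCLike.continuous_re.comp hr).pow 4))
          (integrable_haarUnitary (by fun_prop)) fun U => ?_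
        have h := four_mul_re_star_dotProduct hB ((U : Matrix (Fin n) (Fin n) 𝕜) *ᵥ u)
          ((U : Matrix (Fin n) (Fin n) 𝕜) *ᵥ v)
        rw [← mulVec_add, ← mulVec_sub] at h
        simp only
        set p := quadForm B ((U : Matrix (Fin n) (Fin n) 𝕜) *ᵥ (u + v))
        set q := quadForm B ((U : Matrix (Fin n) (Fin n) 𝕜) *ᵥ (u - v))
        set ρ := RCLike.re (star ((U : Matrix (Fin n) (Fin n) 𝕜) *ᵥ u) ⬝ᵥ
          B *ᵥ ((U : Matrix (Fin n) (Fin n) 𝕜) *ᵥ v))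
        have hρ : ρ ^ 2 ≤ (p ^ 2 + q ^ 2) / 8 := by
          have : ρ = (p - q) / 4 := by linarith
          rw [this]
          nlinarith [sq_nonneg (p + q)]
        calc ρ ^ 4 = (ρ ^ 2) ^ 2 := by ring
          _ ≤ ((p ^ 2 + q ^ 2) / 8) ^ 2 := by gcongr
          _ ≤ _ := by nlinarith [sq_nonneg (p ^ 2 - q ^ 2)]
    _ ≤ _ := by
        rw [integral_const_mul, integral_add (integrable_haarUnitary (by fun_prop))
          (integrable_haarUnitary (by fun_prop))]
        linarith [hbound _ hplus, hbound _ hminus]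

/-- Up to sign, the imaginary part is the real part for `RCLike.I` • v, whose squared norm is still
at most 1; over ℝ it is the zero vector. -/
lemma integral_norm_star_dotProduct_unitary_pow_four_le {B : Matrix (Fin n) (Fin n) 𝕜}
    (hB : B.IsHermitian) (htr : B.trace = 0) {u v : Fin n → 𝕜} (hu : normSq u ≤ 1)
    (hv : normSq v ≤ 1) :
    ∫ U, ‖star ((U : Matrix (Fin n) (Fin n) 𝕜) *ᵥ u) ⬝ᵥ
        B *ᵥ ((U : Matrix (Fin n) (Fin n) 𝕜) *ᵥ v)‖ ^ 4 ∂(haarUnitary n 𝕜)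
      ≤ 64 * (haarConst * frobSq B ^ 2 / n ^ 4) := by
  have hI : normSq ((RCLike.I : 𝕜) • v) ≤ 1 := by
    rw [normSq_smul]
    have h1 : ‖(RCLike.I : 𝕜)‖ ≤ 1 := by
      rcases RCLike.I_eq_zero_or_im_I_eq_one (K := 𝕜) with h | h
      · simp [h]
      · rw [RCLike.norm_I_of_ne_zero]
        rintro h0
        simp [h0] at h
    have h2 : ‖(RCLike.I : 𝕜)‖ ^ 2 ≤ 1 := pow_le_one₀ (norm_nonneg _) h1
    nlinarith [normSq_nonneg v]
  have hre := integral_re_star_dotProduct_unitary_pow_four_le hB htr hu hv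
  have him := integral_re_star_dotProduct_unitary_pow_four_le hB htr hu hI
  have hr := continuous_star_dotProduct_unitary B u v
  have hr' : Continuous fun U : unitaryGroup (Fin n) 𝕜 =>
      2 * RCLike.re (star ((U : Matrix (Fin n) (Fin n) 𝕜) *ᵥ u) ⬝ᵥ
        B *ᵥ ((U : Matrix (Fin n) (Fin n) 𝕜) *ᵥ v)) ^ 4 :=
    ((RCLike.continuous_re.comp hr).pow 4).const_mul 2
  have hi' : Continuous fun U : unitaryGroup (Fin n) 𝕜 =>
      2 * RCLike.re (star ((U : Matrix (Fin n) (Fin n) 𝕜) *ᵥ u) ⬝ᵥ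
        B *ᵥ ((U : Matrix (Fin n) (Fin n) 𝕜) *ᵥ ((RCLike.I : 𝕜) • v))) ^ 4 :=
    ((RCLike.continuous_re.comp
      (continuous_star_dotProduct_unitary B u ((RCLike.I : 𝕜) • v))).pow 4).const_mul 2
  calc _ ≤ ∫ U, (2 * RCLike.re (star ((U : Matrix (Fin n) (Fin n) 𝕜) *ᵥ u) ⬝ᵥ
        B *ᵥ ((U : Matrix (Fin n) (Fin n) 𝕜) *ᵥ v)) ^ 4
        + 2 * RCLike.re (star ((U : Matrix (Fin n) (Fin n) 𝕜) *ᵥ u) ⬝ᵥ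
        B *ᵥ ((U : Matrix (Fin n) (Fin n) 𝕜) *ᵥ ((RCLike.I : 𝕜) • v))) ^ 4)
        ∂(haarUnitary n 𝕜) := by
        refine integral_mono (integrable_haarUnitary (by fun_prop))
          (integrable_haarUnitary (hr'.add hi')) fun U => ?_
        simp only [mulVec_smul, dotProduct_smul, smul_eq_mul, RCLike.I_mul_re]
        set z := star ((U : Matrix (Fin n) (Fin n) 𝕜) *ᵥ u) ⬝ᵥ
          B *ᵥ ((U : Matrix (Fin n) (Fin n) 𝕜) *ᵥ v)
        have : ‖z‖ ^ 4 = (RCLike.re z ^ 2 + RCLike.im z ^ 2) ^ 2 := by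
          have := RCLike.norm_sq_eq_def (z := z)
          rw [show ‖z‖ ^ 4 = (‖z‖ ^ 2) ^ 2 by ring, this]
          ring
        rw [this]
        nlinarith [sq_nonneg (RCLike.re z ^ 2 - RCLike.im z ^ 2)]
    _ ≤ _ := by
        rw [integral_add (integrable_haarUnitary hr') (integrable_haarUnitary hi'),
          integral_const_mul, integral_const_mul]
        linarith

lemma normSq_unitary_col {V : Matrix (Fin n) (Fin n) 𝕜} (hV : V ∈ unitaryGroup (Fin n) 𝕜)
    (i : Fin n) : normSq (V.col i) = 1 := by
  rw [← mulVec_single_one, normSq_unitary_mulVec hV, normSq]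
  rw [Finset.sum_eq_single i] <;> simp +contextual

lemma star_mul_mul_apply (V B : Matrix (Fin n) (Fin n) 𝕜) (i j : Fin n) :
    (star V * B * V) i j = star (V.col i) ⬝ᵥ B *ᵥ V.col j := by
  rw [Matrix.mul_assoc, mul_apply]
  rfl

lemma frobSq_diagonal_mul_mul_diagonal (d : Fin n → ℝ) (M : Matrix (Fin n) (Fin n) 𝕜) :
    frobSq ((diagonal fun i => (d i : 𝕜)) * M * diagonal fun i => (d i : 𝕜))
      = ∑ i, ∑ j, (d i * d j) ^ 2 * ‖M i j‖ ^ 2 := by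
  unfold frobSq
  simp only [mul_diagonal, diagonal_mul, norm_mul, RCLike.norm_ofReal, mul_pow, sq_abs]
  exact Finset.sum_congr rfl fun i _ => Finset.sum_congr rfl fun j _ => by ring

lemma frobSq_conj_mul_mul_conj {V : Matrix (Fin n) (Fin n) 𝕜} (hV : V ∈ unitaryGroup (Fin n) 𝕜)
    (D B : Matrix (Fin n) (Fin n) 𝕜) :
    frobSq ((V * D * star V) * B * (V * D * star V)) = frobSq (D * (star V * B * V) * D) := by
  rw [← frobSq_unitary_mul hV (D * (star V * B * V) * D),
    ← frobSq_mul_unitary (star_mem_unitaryGroup hV) (V * _)]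
  simp only [Matrix.mul_assoc]

/-- Concentration of the compression of a traceless Hermitian matrix to the range of a
Haar-rotated Hermitian matrix of bounded rank. -/
lemma integral_frobSq_sq_le {B : Matrix (Fin n) (Fin n) 𝕜} (hB : B.IsHermitian)
    (htr : B.trace = 0) {d : Fin n → ℝ} {I : Finset (Fin n)} (hdI : ∀ i ∉ I, d i = 0) {C : ℝ}
    (hC : ∀ i, |d i| ≤ C) {V : Matrix (Fin n) (Fin n) 𝕜} (hV : V ∈ unitaryGroup (Fin n) 𝕜)
    {P : Matrix (Fin n) (Fin n) 𝕜} (hP : P = V * (diagonal fun i => (d i : 𝕜)) * star V) :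
    ∫ U, frobSq (((U : Matrix (Fin n) (Fin n) 𝕜) * P * star (U : Matrix (Fin n) (Fin n) 𝕜)) * B *
        ((U : Matrix (Fin n) (Fin n) 𝕜) * P * star (U : Matrix (Fin n) (Fin n) 𝕜))) ^ 2
        ∂(haarUnitary n 𝕜)
      ≤ I.card ^ 4 * C ^ 8 * (64 * haarConst) * frobSq B ^ 2 / n ^ 4 := by
  have hH := haarConst_pos
  set b : Fin n → Fin n → unitaryGroup (Fin n) 𝕜 → 𝕜 := fun i j U =>
    star ((U : Matrix (Fin n) (Fin n) 𝕜) *ᵥ V.col i) ⬝ᵥ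
      B *ᵥ ((U : Matrix (Fin n) (Fin n) 𝕜) *ᵥ V.col j)
  have hbc : ∀ i j, Continuous (b i j) := fun i j => continuous_star_dotProduct_unitary B _ _
  have hform : ∀ U : unitaryGroup (Fin n) 𝕜,
      frobSq (((U : Matrix (Fin n) (Fin n) 𝕜) * P * star (U : Matrix (Fin n) (Fin n) 𝕜)) * B *
        ((U : Matrix (Fin n) (Fin n) 𝕜) * P * star (U : Matrix (Fin n) (Fin n) 𝕜)))
      = ∑ i ∈ I, ∑ j ∈ I, (d i * d j) ^ 2 * ‖b i j U‖ ^ 2 := by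
    intro U
    have hUV : (U : Matrix (Fin n) (Fin n) 𝕜) * V ∈ unitaryGroup (Fin n) 𝕜 := mul_mem U.2 hV
    have h1 : (U : Matrix (Fin n) (Fin n) 𝕜) * P * star (U : Matrix (Fin n) (Fin n) 𝕜)
        = ((U : Matrix (Fin n) (Fin n) 𝕜) * V) * (diagonal fun i => (d i : 𝕜)) *
          star ((U : Matrix (Fin n) (Fin n) 𝕜) * V) := by
      rw [hP, star_mul]
      simp only [Matrix.mul_assoc]
    rw [h1, frobSq_conj_mul_mul_conj hUV, frobSq_diagonal_mul_mul_diagonal]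
    simp only [star_mul_mul_apply]
    change ∑ i, ∑ j, (d i * d j) ^ 2 * ‖b i j U‖ ^ 2 = _
    rw [← Finset.sum_subset (Finset.subset_univ I)]
    · refine Finset.sum_congr rfl fun i _ => (Finset.sum_subset (Finset.subset_univ I) ?_).symm
      intro j _ hj
      simp [hdI j hj]
    · intro i _ hi
      simp [hdI i hi]
  simp only [hform]
  -- Cauchy–Schwarz over I × I costs one factor |I|²; summing the entrywise bounds costs the other.
  calc _ ≤ ∫ U, (I.card : ℝ) ^ 2 * C ^ 8 * ∑ i ∈ I, ∑ j ∈ I, ‖b i j U‖ ^ 4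
        ∂(haarUnitary n 𝕜) := by
        refine integral_mono (integrable_haarUnitary (by fun_prop))
          (integrable_haarUnitary (by fun_prop)) fun U => ?_
        simp only
        rw [← Finset.sum_product']
        have h1 := sq_sum_le_card_mul_sum_sq (s := I ×ˢ I)
          (f := fun p : Fin n × Fin n => (d p.1 * d p.2) ^ 2 * ‖b p.1 p.2 U‖ ^ 2)
        have h2 : ∑ p ∈ I ×ˢ I, ((d p.1 * d p.2) ^ 2 * ‖b p.1 p.2 U‖ ^ 2) ^ 2
            ≤ C ^ 8 * ∑ p ∈ I ×ˢ I, ‖b p.1 p.2 U‖ ^ 4 := by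
          rw [Finset.mul_sum]
          refine Finset.sum_le_sum fun p _ => ?_
          calc ((d p.1 * d p.2) ^ 2 * ‖b p.1 p.2 U‖ ^ 2) ^ 2
              = |d p.1| ^ 4 * |d p.2| ^ 4 * ‖b p.1 p.2 U‖ ^ 4 := by
                rw [Even.pow_abs (by decide), Even.pow_abs (by decide)]; ring
            _ ≤ C ^ 4 * C ^ 4 * ‖b p.1 p.2 U‖ ^ 4 := by
                gcongr
                · exact hC _
                · exact hC _
            _ = _ := by ring
        rw [← Finset.sum_product', mul_assoc]
        refine h1.trans ?_
        rw [Finset.card_product, Nat.cast_mul, ← pow_two]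
        exact mul_le_mul_of_nonneg_left h2 (by positivity)
    _ = (I.card : ℝ) ^ 2 * C ^ 8 * ∑ i ∈ I, ∑ j ∈ I, ∫ U, ‖b i j U‖ ^ 4 ∂(haarUnitary n 𝕜) := by
        rw [integral_const_mul, integral_finsetSum _ fun i _ =>
          integrable_haarUnitary (by fun_prop)]
        congr 1
        refine Finset.sum_congr rfl fun i _ => ?_
        rw [integral_finsetSum _ fun j _ => integrable_haarUnitary (by fun_prop)]
    _ ≤ (I.card : ℝ) ^ 2 * C ^ 8 *
        ∑ i ∈ I, ∑ j ∈ I, 64 * (haarConst * frobSq B ^ 2 / n ^ 4) := by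
        refine mul_le_mul_of_nonneg_left (Finset.sum_le_sum fun i _ => Finset.sum_le_sum
          fun j _ => ?_) (mul_nonneg (sq_nonneg _) (by simpa using Even.pow_nonneg (by decide) C))
        exact integral_norm_star_dotProduct_unitary_pow_four_le hB htr
          (normSq_unitary_col hV i).le (normSq_unitary_col hV j).le
    _ = _ := by
        simp only [Finset.sum_const, nsmul_eq_mul]
        ring

end Haar

end SpikedMatrix

namespace SpikedMatrix

open Matrix

/-! ### The diagonal form of the perturbation. -/

section Spikes

variable {𝕜 : Type*} [RCLike 𝕜] {n : ℕ}

/-- The eigenvalues of the perturbation: `θ_1, …, θ_r` followed by zeros. -/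
def spikes (θ : ℕ → ℝ) (r n : ℕ) (i : Fin n) : ℝ := if (i : ℕ) < r then θ (i + 1) else 0

/-- The first `r` coordinates. -/
def spikeSet (r n : ℕ) : Finset (Fin n) := Finset.univ.filter fun i => (i : ℕ) < r

lemma spikes_of_notMem {θ : ℕ → ℝ} {r : ℕ} {i : Fin n} (hi : i ∉ spikeSet r n) :
    spikes θ r n i = 0 := by
  simp only [spikeSet, Finset.mem_filter, Finset.mem_univ, true_and] at hi
  simp [spikes, hi]

lemma card_filter_fin_le (S : Finset ℕ) :
    (Finset.univ.filter fun i : Fin n => (i : ℕ) ∈ S).card ≤ S.card :=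
  Finset.card_le_card_of_injOn (fun i : Fin n => (i : ℕ)) (by intro i; simp)
    (Fin.val_injective.injOn)

lemma card_filter_fin_eq (S : Finset ℕ) (h : ∀ i ∈ S, i < n) :
    (Finset.univ.filter fun i : Fin n => (i : ℕ) ∈ S).card = S.card := by
  refine le_antisymm (card_filter_fin_le S) ?_
  refine Finset.card_le_card_of_surjOn (fun i : Fin n => (i : ℕ)) ?_
  intro k hk
  exact ⟨⟨k, h k hk⟩, by simpa using hk, rfl⟩

lemma card_spikeSet_le (r n : ℕ) : (spikeSet r n).card ≤ r := by
  have := card_filter_fin_le (n := n) (Finset.range r)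
  simpa [spikeSet] using this

/-- A bound for the spikes. -/
def spikeBound (θ : ℕ → ℝ) (r : ℕ) : ℝ := ∑ i ∈ Finset.range r, |θ (i + 1)|

lemma spikeBound_nonneg (θ : ℕ → ℝ) (r : ℕ) : 0 ≤ spikeBound θ r :=
  Finset.sum_nonneg fun _ _ => abs_nonneg _

lemma abs_spikes_le (θ : ℕ → ℝ) (r n : ℕ) (i : Fin n) : |spikes θ r n i| ≤ spikeBound θ r := by
  unfold spikes
  split_ifs with h
  · exact Finset.single_le_sum (f := fun i => |θ (i + 1)|) (fun _ _ => abs_nonneg _)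
      (Finset.mem_range.2 h)
  · simpa using spikeBound_nonneg θ r

lemma prod_spikes_eq (θ : ℕ → ℝ) {r : ℕ} (hn : r ≤ n) :
    Polynomial.X ^ (n - r) * ∏ i ∈ Finset.Icc 1 r, (Polynomial.X - Polynomial.C (θ i : 𝕜))
      = ∏ i, (Polynomial.X - Polynomial.C (spikes θ r n i : 𝕜)) := by
  obtain ⟨m, rfl⟩ := Nat.exists_eq_add_of_le hn
  have h := Fin.prod_univ_eq_prod_range (fun k => Polynomial.X -
    Polynomial.C (((if k < r then θ (k + 1) else 0 : ℝ)) : 𝕜)) (r + m)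
  unfold spikes
  rw [h, Finset.prod_range_add, mul_comm]
  congr 1
  · have h2 := Finset.prod_Ico_add' (fun k => Polynomial.X - Polynomial.C (θ k : 𝕜)) 0 r 1
    rw [zero_add, ← Finset.range_eq_Ico] at h2
    refine Eq.trans ?_ (h2.symm.trans (Finset.prod_congr rfl fun k hk => ?_))
    · rfl
    · simp [Finset.mem_range.1 hk]
  · simp

end Spikes

/-! ### Almost sure decay of the deviation from a scalar corner. -/

section Deviation

variable {𝕜 : Type*} [RCLike 𝕜] {n : ℕ}

/-- The traceless part of a matrix. -/
def traceless (A : Matrix (Fin n) (Fin n) 𝕜) : Matrix (Fin n) (Fin n) 𝕜 :=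
  A - (A.trace / n) • (1 : Matrix (Fin n) (Fin n) 𝕜)

lemma trace_traceless (A : Matrix (Fin n) (Fin n) 𝕜) : (traceless A).trace = 0 := by
  rcases Nat.eq_zero_or_pos n with rfl | hn
  · simp [Matrix.trace]
  · have : (n : 𝕜) ≠ 0 := by exact_mod_cast hn.ne'
    simp [traceless, trace_sub, trace_smul, this]

lemma isHermitian_traceless {A : Matrix (Fin n) (Fin n) 𝕜} (hA : A.IsHermitian) :
    (traceless A).IsHermitian := by
  refine hA.sub ?_
  have htr : star A.trace = A.trace := by
    rw [← trace_conjTranspose, hA.eq]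
  rw [IsHermitian, conjTranspose_smul, conjTranspose_one]
  congr 1
  simp only [RCLike.star_def, map_div₀, map_natCast] at htr ⊢
  rw [htr]

lemma traceless_conj {U : Matrix (Fin n) (Fin n) 𝕜} (hU : U ∈ unitaryGroup (Fin n) 𝕜)
    (A : Matrix (Fin n) (Fin n) 𝕜) : traceless (U * A * star U) = U * traceless A * star U := by
  unfold traceless
  rw [trace_conj_unitary hU, Matrix.mul_sub, Matrix.sub_mul, Matrix.mul_smul, Matrix.smul_mul,
    Matrix.mul_one, mem_unitaryGroup_iff.1 hU]

/-- If z is an eigenvalue of X the inverse is 0 by convention, so no condition on z is needed and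
the moment bounds hold for every Hermitian X. -/
lemma isHermitian_tMat {X : Matrix (Fin n) (Fin n) 𝕜} (hX : X.IsHermitian) (z : ℝ) :
    (tMat X z).IsHermitian := by
  unfold tMat
  set M := (z : 𝕜) • (1 : Matrix (Fin n) (Fin n) 𝕜) - X with hM
  have hMh : M.IsHermitian := by
    refine IsHermitian.sub ?_ hX
    rw [IsHermitian, conjTranspose_smul, conjTranspose_one]
    simp
  have hcomm : M * X = X * M := by simp [hM, Matrix.sub_mul, Matrix.mul_sub]
  rw [IsHermitian, conjTranspose_mul, hX.eq, hMh.inv.eq]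
  by_cases h : IsUnit M.det
  · calc M⁻¹ * X = M⁻¹ * (X * M) * M⁻¹ := by
          rw [Matrix.mul_assoc, Matrix.mul_assoc, mul_nonsing_inv _ h, Matrix.mul_one]
      _ = X * M⁻¹ := by
          rw [← hcomm, ← Matrix.mul_assoc, nonsing_inv_mul _ h, Matrix.one_mul]
  · simp [nonsing_inv_apply_not_isUnit _ h]

lemma inv_eq_star_of_mem_unitaryGroup {U : Matrix (Fin n) (Fin n) 𝕜}
    (hU : U ∈ unitaryGroup (Fin n) 𝕜) : U⁻¹ = star U :=
  inv_eq_right_inv (mem_unitaryGroup_iff.1 hU)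

lemma tMat_conj {U : Matrix (Fin n) (Fin n) 𝕜} (hU : U ∈ unitaryGroup (Fin n) 𝕜)
    (X : Matrix (Fin n) (Fin n) 𝕜) (z : ℝ) :
    tMat (U * X * star U) z = U * tMat X z * star U := by
  have h1 : (z : 𝕜) • (1 : Matrix (Fin n) (Fin n) 𝕜) - U * X * star U
      = U * ((z : 𝕜) • (1 : Matrix (Fin n) (Fin n) 𝕜) - X) * star U := by
    rw [Matrix.mul_sub, Matrix.sub_mul, Matrix.mul_smul, Matrix.smul_mul,
      Matrix.mul_one, mem_unitaryGroup_iff.1 hU]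
  unfold tMat
  rw [h1, Matrix.mul_inv_rev, Matrix.mul_inv_rev, inv_eq_star_of_mem_unitaryGroup hU,
    inv_eq_star_of_mem_unitaryGroup (star_mem_unitaryGroup hU), star_star, ← Matrix.mul_assoc U,
    conj_unitary_mul hU]

/-- The normalized deviation from a scalar of the compression of `X (z - X)⁻¹` by `P`. -/
def deviation (z : ℝ) (X P : Matrix (Fin n) (Fin n) 𝕜) : ℝ :=
  frobSq (P * traceless (tMat X z) * P) / (1 + frobSq (traceless (tMat X z)) / n)

lemma deviation_nonneg (z : ℝ) (X P : Matrix (Fin n) (Fin n) 𝕜) : 0 ≤ deviation z X P := by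
  have := frobSq_nonneg (traceless (tMat X z))
  exact div_nonneg (frobSq_nonneg _) (by positivity)

/-- Only the relative position of X and P matters, which lets a rotation of X be traded for one of
P. -/
lemma deviation_conj {U : Matrix (Fin n) (Fin n) 𝕜} (hU : U ∈ unitaryGroup (Fin n) 𝕜) (z : ℝ)
    (X P : Matrix (Fin n) (Fin n) 𝕜) :
    deviation z (U * X * star U) (U * P * star U) = deviation z X P := by
  unfold deviation
  rw [tMat_conj hU, traceless_conj hU, conj_unitary_mul hU, conj_unitary_mul hU,
    frobSq_mul_unitary (star_mem_unitaryGroup hU), frobSq_unitary_mul hU,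
    frobSq_mul_unitary (star_mem_unitaryGroup hU), frobSq_unitary_mul hU]

/-- Inversion is det⁻¹ times the adjugate, measurable also at singular matrices, where continuity
may fail. -/
lemma measurable_matrix_inv :
    Measurable fun M : Matrix (Fin n) (Fin n) 𝕜 => M⁻¹ := by
  have h : (fun M : Matrix (Fin n) (Fin n) 𝕜 => M⁻¹) = fun M => (M.det)⁻¹ • M.adjugate := by
    ext1 M
    rw [inv_def, Ring.inverse_eq_inv']
  rw [h]
  have h1 : Measurable fun M : Matrix (Fin n) (Fin n) 𝕜 => (M.det)⁻¹ :=
    (Continuous.matrix_det continuous_id).measurable.inv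
  have h2 : Measurable fun M : Matrix (Fin n) (Fin n) 𝕜 => M.adjugate :=
    (Continuous.matrix_adjugate continuous_id).measurable
  exact h1.smul h2

lemma continuous_frobSq : Continuous (frobSq : Matrix (Fin n) (Fin n) 𝕜 → ℝ) := by
  unfold frobSq
  refine continuous_finsetSum _ fun i _ => continuous_finsetSum _ fun j _ => ?_
  exact (continuous_id.matrix_elem i j).norm.pow 2

lemma continuous_traceless :
    Continuous (traceless : Matrix (Fin n) (Fin n) 𝕜 → Matrix (Fin n) (Fin n) 𝕜) := by
  unfold traceless
  exact continuous_id.sub ((continuous_id.matrix_trace.div_const _).smul continuous_const)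

lemma measurable_traceless_tMat (z : ℝ) :
    Measurable fun X : Matrix (Fin n) (Fin n) 𝕜 => traceless (tMat X z) := by
  refine continuous_traceless.measurable.comp ?_
  have h1 : Measurable fun X : Matrix (Fin n) (Fin n) 𝕜 =>
      ((z : 𝕜) • (1 : Matrix (Fin n) (Fin n) 𝕜) - X)⁻¹ :=
    measurable_matrix_inv.comp (continuous_const.sub continuous_id).measurable
  have h2 : Continuous fun p : Matrix (Fin n) (Fin n) 𝕜 × Matrix (Fin n) (Fin n) 𝕜 => p.1 * p.2 :=
    continuous_fst.matrix_mul continuous_snd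
  exact h2.measurable.comp (measurable_id.prodMk h1)

lemma measurable_deviation (z : ℝ) :
    Measurable fun p : Matrix (Fin n) (Fin n) 𝕜 × Matrix (Fin n) (Fin n) 𝕜 =>
      deviation z p.1 p.2 := by
  have h1 : Continuous fun p : Matrix (Fin n) (Fin n) 𝕜 × Matrix (Fin n) (Fin n) 𝕜 =>
      frobSq (p.2 * p.1 * p.2) / (1 + frobSq p.1 / n) := by
    refine (continuous_frobSq.comp ((continuous_snd.matrix_mul continuous_fst).matrix_mul
      continuous_snd)).div₀ (continuous_const.add ((continuous_frobSq.comp continuous_fst).div_const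
      _)) fun p => ?_
    have := frobSq_nonneg p.1
    positivity
  have h2 : Measurable fun p : Matrix (Fin n) (Fin n) 𝕜 × Matrix (Fin n) (Fin n) 𝕜 =>
      (traceless (tMat p.1 z), p.2) :=
    ((measurable_traceless_tMat z).comp measurable_fst).prodMk measurable_snd
  have h := h1.measurable.comp h2
  exact h

/-- The constant in the second moment bound for the deviation. -/
def deviationConst (θ : ℕ → ℝ) (r : ℕ) : ℝ := r ^ 4 * spikeBound θ r ^ 8 * (64 * haarConst)

/-- The moment bound carries F²/n⁴ = n⁻²(F/n)² with F the squared Frobenius norm, and the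
denominator of `deviation` cancels (F/n)². The bound is thus uniform in X, however close to z its
spectrum comes. -/
lemma integral_deviation_sq_le (z : ℝ) {X P : Matrix (Fin n) (Fin n) 𝕜} (hX : X.IsHermitian)
    (hn : 0 < n) {θ : ℕ → ℝ} {r : ℕ} {V : Matrix (Fin n) (Fin n) 𝕜}
    (hV : V ∈ unitaryGroup (Fin n) 𝕜)
    (hP : P = V * (diagonal fun i => (spikes θ r n i : 𝕜)) * star V) :
    ∫ U, deviation z X
      ((U : Matrix (Fin n) (Fin n) 𝕜) * P * star (U : Matrix (Fin n) (Fin n) 𝕜)) ^ 2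
      ∂(haarUnitary n 𝕜) ≤ deviationConst θ r / n ^ 2 := by
  have hn' : (0 : ℝ) < n := by exact_mod_cast hn
  have hH := haarConst_pos
  set B := traceless (tMat X z) with hBdef
  have hB : B.IsHermitian := isHermitian_traceless (isHermitian_tMat hX z)
  have h := integral_frobSq_sq_le hB (trace_traceless _)
    (fun i => spikes_of_notMem (θ := θ) (r := r)) (abs_spikes_le θ r n) hV hP
  have hF := frobSq_nonneg B
  set F := frobSq B
  unfold deviation
  simp only [← hBdef, div_pow]
  rw [integral_div, div_le_iff₀ (by positivity)]
  refine h.trans ?_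
  have hS := spikeBound_nonneg θ r
  have hcard : ((spikeSet r n).card : ℝ) ≤ r := by exact_mod_cast card_spikeSet_le r n
  calc ((spikeSet r n).card : ℝ) ^ 4 * spikeBound θ r ^ 8 * (64 * haarConst) * F ^ 2 / n ^ 4
      ≤ deviationConst θ r * F ^ 2 / n ^ 4 := by
        unfold deviationConst
        gcongr
    _ = deviationConst θ r / n ^ 2 * (F / n) ^ 2 := by field_simp
    _ ≤ deviationConst θ r / n ^ 2 * (1 + F / n) ^ 2 := by
        have : 0 ≤ deviationConst θ r := by unfold deviationConst; positivity
        gcongr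
        linarith

lemma continuous_conj_unitary (P : Matrix (Fin n) (Fin n) 𝕜) :
    Continuous fun U : unitaryGroup (Fin n) 𝕜 =>
      (U : Matrix (Fin n) (Fin n) 𝕜) * P * star (U : Matrix (Fin n) (Fin n) 𝕜) :=
  (continuous_subtype_val.matrix_mul continuous_const).matrix_mul continuous_subtype_val.star

lemma continuous_deviation_conj (z : ℝ) (X P : Matrix (Fin n) (Fin n) 𝕜) :
    Continuous fun U : unitaryGroup (Fin n) 𝕜 => deviation z X
      ((U : Matrix (Fin n) (Fin n) 𝕜) * P * star (U : Matrix (Fin n) (Fin n) 𝕜)) := by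
  unfold deviation
  exact (continuous_frobSq.comp (((continuous_conj_unitary P).matrix_mul
    continuous_const).matrix_mul (continuous_conj_unitary P))).div_const _

variable {Ω : Type*} [MeasurableSpace Ω] {Pr : Measure Ω}

/-- Summable second moments make the sum of the squares almost surely finite, so its terms tend to
0. The shift by r skips the sizes about which nothing is assumed. -/
lemma ae_tendsto_zero_of_lintegral_sq_le {r : ℕ} {f : ℕ → Ω → ℝ} {K : ℝ}
    (hm : ∀ n, r ≤ n → Measurable (f n))
    (hf : ∀ n, r ≤ n → ∫⁻ ω, ENNReal.ofReal (f n ω ^ 2) ∂Pr ≤ ENNReal.ofReal (K / n ^ 2)) :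
    ∀ᵐ ω ∂Pr, Tendsto (fun n => f n ω) atTop (𝓝 0) := by
  have hmeas : ∀ n, Measurable fun ω => ENNReal.ofReal (f (n + r) ω ^ 2) := fun n =>
    ((hm (n + r) (Nat.le_add_left _ _)).pow_const 2).ennreal_ofReal
  have hsum : ∫⁻ ω, ∑' n, ENNReal.ofReal (f (n + r) ω ^ 2) ∂Pr ≠ ∞ := by
    rw [lintegral_tsum fun n => (hmeas n).aemeasurable]
    have hs : Summable fun n : ℕ => |K| / ((n + r : ℕ) : ℝ) ^ 2 :=
      (summable_nat_add_iff r).2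
        ((Real.summable_nat_pow_inv.2 (by norm_num : 1 < 2)).mul_left |K|)
    refine ne_top_of_le_ne_top ?_ (ENNReal.tsum_le_tsum fun n =>
      (hf (n + r) (Nat.le_add_left _ _)).trans (ENNReal.ofReal_le_ofReal
        (div_le_div_of_nonneg_right (le_abs_self K) (by positivity))))
    exact hs.tsum_ofReal_ne_top
  filter_upwards [ae_lt_top (Measurable.tsum hmeas) hsum] with ω hω
  have h1 := ENNReal.tendsto_atTop_zero_of_tsum_ne_top hω.ne
  have h2 : Tendsto (fun n => f (n + r) ω ^ 2) atTop (𝓝 0) := by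
    have := (ENNReal.tendsto_toReal ENNReal.zero_ne_top).comp h1
    simpa [Function.comp_def, ENNReal.toReal_ofReal, sq_nonneg] using this
  have h3 : Tendsto (fun n => |f (n + r) ω|) atTop (𝓝 0) := by
    have := (Real.continuous_sqrt.tendsto 0).comp h2
    simpa [Function.comp_def, Real.sqrt_sq_eq_abs] using this
  exact (tendsto_add_atTop_iff_nat r).1 ((tendsto_zero_iff_abs_tendsto_zero _).2 h3)

variable [IsProbabilityMeasure Pr]

lemma measurable_conj (U : Matrix (Fin n) (Fin n) 𝕜) :
    Measurable fun M : Matrix (Fin n) (Fin n) 𝕜 => U * M * star U :=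
  ((continuous_const.matrix_mul continuous_id).matrix_mul continuous_const).measurable

lemma conj_star_conj {U : Matrix (Fin n) (Fin n) 𝕜} (hU : U ∈ unitaryGroup (Fin n) 𝕜)
    {B : Matrix (Fin n) (Fin n) 𝕜} : star U * (U * B * star U) * star (star U) = B := by
  rw [star_star, Matrix.mul_assoc, Matrix.mul_assoc, Matrix.mul_assoc,
    mem_unitaryGroup_iff'.1 hU, Matrix.mul_one, ← Matrix.mul_assoc, mem_unitaryGroup_iff'.1 hU,
    Matrix.one_mul]

/-- For independent matrices one of which has a conjugation invariant law, the second one may be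
conjugated without changing the mean of a conjugation invariant function. -/
lemma lintegral_conj_right_eq {X P : Ω → Matrix (Fin n) (Fin n) 𝕜} (hX : Measurable X)
    (hP : Measurable P) (hindep : IndepFun X P Pr)
    (hinv : IsConjInvariant Pr X ∨ IsConjInvariant Pr P)
    {F : Matrix (Fin n) (Fin n) 𝕜 × Matrix (Fin n) (Fin n) 𝕜 → ℝ≥0∞} (hF : Measurable F)
    (hFconj : ∀ U ∈ unitaryGroup (Fin n) 𝕜, ∀ A B,
      F (U * A * star U, U * B * star U) = F (A, B))
    {U : Matrix (Fin n) (Fin n) 𝕜} (hU : U ∈ unitaryGroup (Fin n) 𝕜) :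
    ∫⁻ ω, F (X ω, U * P ω * star U) ∂Pr = ∫⁻ ω, F (X ω, P ω) ∂Pr := by
  have key : ∀ X' P' : Ω → Matrix (Fin n) (Fin n) 𝕜, Measurable X' → Measurable P' →
      IndepFun X' P' Pr → Measure.map X' Pr = Measure.map X Pr →
      Measure.map P' Pr = Measure.map P Pr →
      ∫⁻ ω, F (X' ω, P' ω) ∂Pr = ∫⁻ ω, F (X ω, P ω) ∂Pr := by
    intro X' P' hX' hP' hi hXX hPP
    rw [← lintegral_map hF (hX'.prodMk hP'), ← lintegral_map hF (hX.prodMk hP),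
      (indepFun_iff_map_prod_eq_prod_map_map hX'.aemeasurable hP'.aemeasurable).1 hi,
      (indepFun_iff_map_prod_eq_prod_map_map hX.aemeasurable hP.aemeasurable).1 hindep, hXX, hPP]
  rcases hinv with h | h
  -- Conjugating both arguments by the adjoint of U moves the rotation from P to X, whose law
  -- absorbs it.
  · have hU' := star_mem_unitaryGroup hU
    have hpt : ∀ ω, F (X ω, U * P ω * star U) = F (star U * X ω * star (star U), P ω) := by
      intro ω
      rw [← hFconj (star U) hU', conj_star_conj hU]
    simp only [hpt]
    exact key _ _ ((measurable_conj (star U)).comp hX) hP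
      (hindep.comp (measurable_conj (star U)) measurable_id) (h _ hU') rfl
  · exact key _ _ hX ((measurable_conj U).comp hP)
      (hindep.comp measurable_id (measurable_conj U)) rfl (h U hU)

lemma measurable_matrix_conj :
    Measurable fun q : Matrix (Fin n) (Fin n) 𝕜 × Matrix (Fin n) (Fin n) 𝕜 =>
      q.1 * q.2 * star q.1 := by
  have hc : Continuous fun q : Matrix (Fin n) (Fin n) 𝕜 × Matrix (Fin n) (Fin n) 𝕜 =>
      q.1 * q.2 * star q.1 :=
    (continuous_fst.matrix_mul continuous_snd).matrix_mul continuous_fst.star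
  exact hc.measurable

/-- The mean is the same for U P U* with any fixed unitary U, hence equals its Haar average. After
Tonelli the inner integral is taken at fixed ω, where the uniform bound applies. -/
lemma lintegral_deviation_sq_le (z : ℝ) {X P : Ω → Matrix (Fin n) (Fin n) 𝕜} (hX : Measurable X)
    (hP : Measurable P) (hXh : ∀ ω, (X ω).IsHermitian) (hPh : ∀ ω, (P ω).IsHermitian)
    (hindep : IndepFun X P Pr) (hinv : IsConjInvariant Pr X ∨ IsConjInvariant Pr P) (hn : 0 < n)
    {θ : ℕ → ℝ} {r : ℕ}
    (hPs : ∀ ω, (P ω).charpoly = ∏ i, (Polynomial.X - Polynomial.C (spikes θ r n i : 𝕜))) :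
    ∫⁻ ω, ENNReal.ofReal (deviation z (X ω) (P ω) ^ 2) ∂Pr
      ≤ ENNReal.ofReal (deviationConst θ r / n ^ 2) := by
  set F : Matrix (Fin n) (Fin n) 𝕜 × Matrix (Fin n) (Fin n) 𝕜 → ℝ≥0∞ :=
    fun p => ENNReal.ofReal (deviation z p.1 p.2 ^ 2) with hFdef
  have hF : Measurable F := ((measurable_deviation z).pow_const 2).ennreal_ofReal
  have hswap : ∫⁻ ω, F (X ω, P ω) ∂Pr = ∫⁻ ω, ∫⁻ U, F (X ω, (U : Matrix (Fin n) (Fin n) 𝕜) * P ω *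
      star (U : Matrix (Fin n) (Fin n) 𝕜)) ∂(haarUnitary n 𝕜) ∂Pr := by
    rw [lintegral_lintegral_swap]
    · have : ∀ U : unitaryGroup (Fin n) 𝕜, ∫⁻ ω, F (X ω, (U : Matrix (Fin n) (Fin n) 𝕜) * P ω *
          star (U : Matrix (Fin n) (Fin n) 𝕜)) ∂Pr = ∫⁻ ω, F (X ω, P ω) ∂Pr := fun U =>
        lintegral_conj_right_eq hX hP hindep hinv hF
          (fun V hV A B => by simp only [hFdef, deviation_conj hV]) U.2
      simp [this]
    · have hp : Measurable fun p : Ω × unitaryGroup (Fin n) 𝕜 =>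
          ((p.2 : Matrix (Fin n) (Fin n) 𝕜), P p.1) :=
        (measurable_subtype_coe.comp measurable_snd).prodMk (hP.comp measurable_fst)
      have hm := measurable_matrix_conj.comp hp
      have h := hF.comp ((hX.comp measurable_fst).prodMk hm)
      exact h.aemeasurable
  change ∫⁻ ω, F (X ω, P ω) ∂Pr ≤ _
  rw [hswap]
  calc _ ≤ ∫⁻ _, ENNReal.ofReal (deviationConst θ r / n ^ 2) ∂Pr := by
        refine lintegral_mono fun ω => ?_
        obtain ⟨V, hV, hPV⟩ := exists_unitary_diagonal_of_charpoly_eq (hPh ω) _ (hPs ω)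
        have hc : Continuous fun U : unitaryGroup (Fin n) 𝕜 => deviation z (X ω)
            ((U : Matrix (Fin n) (Fin n) 𝕜) * P ω * star (U : Matrix (Fin n) (Fin n) 𝕜)) ^ 2 :=
          (continuous_deviation_conj z _ _).pow 2
        simp only [hFdef]
        rw [← ofReal_integral_eq_lintegral_ofReal (integrable_haarUnitary hc)
          (Eventually.of_forall fun _ => sq_nonneg _)]
        exact ENNReal.ofReal_le_ofReal (integral_deviation_sq_le z (hXh ω) hn hV hPV)
    _ = _ := by simp

end Deviation

end SpikedMatrix

namespace SpikedMatrix

open Matrix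

/-! ### Consequences of the limiting spectrum of X. -/

section SpectralLimits

variable {𝕜 : Type*} [RCLike 𝕜]

lemma integral_empiricalSpectralMeasure {n : ℕ} (M : Matrix (Fin n) (Fin n) 𝕜) (f : ℝ →ᵇ ℝ) :
    ∫ t, f t ∂(empiricalSpectralMeasure M) = (∑ i, f (eig M i)) / n := by
  unfold empiricalSpectralMeasure
  rw [integral_smul_measure, integral_finsetSum_measure fun _ _ => f.integrable _]
  simp only [integral_dirac, eig]
  rw [Fin.sum_univ_eq_sum_range (fun k => f (eigenvalueDesc M (k + 1))) n,
    Finset.range_eq_Ico, Finset.sum_Ico_add' (fun k => f (eigenvalueDesc M k)) 0 n 1]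
  simp [div_eq_inv_mul]
  exact Or.inl rfl

variable {X : (n : ℕ) → Matrix (Fin n) (Fin n) 𝕜} {μ : Measure ℝ} {a b : ℝ}

/-- A sequence of positive semidefinite matrices with limiting eigenvalue distribution `μ` whose
extreme eigenvalues converge to the edges `a` and `b` of the support. -/
structure HasSpectralLimit (X : (n : ℕ) → Matrix (Fin n) (Fin n) 𝕜) (μ : Measure ℝ) (a b : ℝ) :
    Prop where
  posSemidef : ∀ n, (X n).PosSemidef
  tendsto_integral : ∀ f : ℝ →ᵇ ℝ,
    Tendsto (fun n => (∑ i, f (eig (X n) i)) / n) atTop (𝓝 (∫ t, f t ∂μ))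
  tendsto_min : Tendsto (fun n => eigenvalueDesc (X n) n) atTop (𝓝 a)
  tendsto_max : Tendsto (fun n => eigenvalueDesc (X n) 1) atTop (𝓝 b)

namespace HasSpectralLimit

lemma eventually_mem_Ioo (h : HasSpectralLimit X μ a b) {α β : ℝ} (hα : α < a) (hβ : b < β) :
    ∀ᶠ n in atTop, ∀ i, eig (X n) i ∈ Ioo α β := by
  filter_upwards [h.tendsto_min.eventually_const_lt hα, h.tendsto_max.eventually_lt_const hβ]
    with n h1 h2 i
  have hanti := eig_antitone (h.posSemidef n).isHermitian
  have hn : 0 < n := i.pos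
  refine ⟨h1.trans_le ?_, lt_of_le_of_lt ?_ h2⟩
  · have : eigenvalueDesc (X n) n = eig (X n) ⟨n - 1, by omega⟩ := by
      unfold eig; congr 1; simp only; omega
    rw [this]
    exact hanti (Fin.le_def.2 (by simp only; omega))
  · exact hanti (a := ⟨0, hn⟩) (Fin.le_def.2 (Nat.zero_le _))

lemma nonneg (h : HasSpectralLimit X μ a b) : 0 ≤ a := by
  refine ge_of_tendsto h.tendsto_min ?_
  filter_upwards [eventually_gt_atTop 0] with n hn
  have : eigenvalueDesc (X n) n = eig (X n) ⟨n - 1, by omega⟩ := by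
    unfold eig; congr 1; simp only; omega
  rw [this]
  exact eig_nonneg (h.posSemidef n) _

/-- Convergence of linear eigenvalue statistics of functions continuous near `[a, b]`. -/
lemma tendsto_sum_div (h : HasSpectralLimit X μ a b) (hμ : ∀ᵐ t ∂μ, t ∈ Icc a b) (hab : a ≤ b)
    {α β : ℝ} (hα : α < a) (hβ : b < β) {g : ℝ → ℝ} (hg : ContinuousOn g (Icc α β)) :
    Tendsto (fun n => (∑ i, g (eig (X n) i)) / n) atTop (𝓝 (∫ t, g t ∂μ)) := by
  have hαβ : α ≤ β := by linarith
  -- Clamping the argument to [α, β] makes g bounded and continuous on ℝ, and changes it neither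
  -- μ-almost everywhere nor, eventually, at any eigenvalue.
  set f : ℝ →ᵇ ℝ := (BoundedContinuousFunction.mkOfCompact
    ⟨(Icc α β).domRestrict g, hg.domRestrict⟩).compContinuous ⟨projIcc α β hαβ, continuous_projIcc⟩
  have hf : ∀ t ∈ Icc α β, f t = g t := fun t ht => by
    simp [f, projIcc_of_mem hαβ ht]
  have hlim := h.tendsto_integral f
  have hint : ∫ t, f t ∂μ = ∫ t, g t ∂μ := by
    refine integral_congr_ae ?_
    filter_upwards [hμ] with t ht
    exact hf t ⟨hα.le.trans ht.1, ht.2.trans hβ.le⟩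
  rw [hint] at hlim
  refine hlim.congr' ?_
  filter_upwards [h.eventually_mem_Ioo hα hβ] with n hn
  congr 1
  exact Finset.sum_congr rfl fun i _ => hf _ (Ioo_subset_Icc_self (hn i))

/-- The number of eigenvalues charged by a nonnegative function of positive mean is unbounded. -/
lemma eventually_le_card (h : HasSpectralLimit X μ a b) (f : ℝ →ᵇ ℝ)
    (hf1 : ∀ t, f t ≤ 1) (hpos : 0 < ∫ t, f t ∂μ) (m : ℕ) :
    ∀ᶠ n in atTop, m ≤ (Finset.univ.filter fun i => 0 < f (eig (X n) i)).card := by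
  have hlim : Tendsto (fun n : ℕ => (n : ℝ) * ((∫ t, f t ∂μ) / 2)) atTop atTop :=
    tendsto_natCast_atTop_atTop.atTop_mul_const (by positivity)
  filter_upwards [(h.tendsto_integral f).eventually_const_lt (half_lt_self hpos),
    hlim.eventually_ge_atTop m, eventually_gt_atTop 0] with n h1 h2 hn
  have hn' : (0 : ℝ) < n := by exact_mod_cast hn
  rw [lt_div_iff₀ hn'] at h1
  have h3 : ∑ i, f (eig (X n) i)
      ≤ ((Finset.univ.filter fun i => 0 < f (eig (X n) i)).card : ℝ) := by
    rw [Finset.card_filter]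
    push_cast
    refine Finset.sum_le_sum fun i _ => ?_
    split_ifs with hi
    · exact_mod_cast hf1 _
    · exact not_lt.1 hi
  have h4 : (m : ℝ) ≤ ((Finset.univ.filter fun i => 0 < f (eig (X n) i)).card : ℝ) := by
    linarith
  exact_mod_cast h4

variable [IsProbabilityMeasure μ]

/-- The function `min 1 (max 0 (t - c))`, bounded and continuous. -/
def rampUp (c : ℝ) : ℝ →ᵇ ℝ :=
  BoundedContinuousFunction.ofNormedAddCommGroup (fun t => min 1 (max 0 (t - c))) (by fun_prop) 1
    fun t => by
      rw [Real.norm_of_nonneg (le_min zero_le_one (le_max_left _ _))]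
      exact min_le_left _ _

/-- The function `min 1 (max 0 (c - t))`, bounded and continuous. -/
def rampDown (c : ℝ) : ℝ →ᵇ ℝ :=
  BoundedContinuousFunction.ofNormedAddCommGroup (fun t => min 1 (max 0 (c - t))) (by fun_prop) 1
    fun t => by
      rw [Real.norm_of_nonneg (le_min zero_le_one (le_max_left _ _))]
      exact min_le_left _ _

lemma rampUp_pos_iff {c t : ℝ} : 0 < rampUp c t ↔ c < t := by
  simp [rampUp]

lemma rampDown_pos_iff {c t : ℝ} : 0 < rampDown c t ↔ t < c := by
  simp [rampDown]

lemma integral_pos_of_mem_support {f : ℝ →ᵇ ℝ} (hf : ∀ t, 0 ≤ f t) {U : Set ℝ} (hU : IsOpen U)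
    {x : ℝ} (hx : x ∈ μ.support) (hxU : x ∈ U) (hfU : ∀ t ∈ U, 0 < f t) : 0 < ∫ t, f t ∂μ := by
  rw [integral_pos_iff_support_of_nonneg hf (f.integrable μ)]
  exact ((Measure.mem_support_iff_forall x).1 hx U (hU.mem_nhds hxU)).trans_le
    (measure_mono fun t ht => (hfU t ht).ne')

/-- As b lies in the support, a ramp starting at c < b has positive mean, so a positive proportion
of the eigenvalues lies above c. -/
lemma eventually_le_card_gt (h : HasSpectralLimit X μ a b) (hb : b ∈ μ.support) {c : ℝ}
    (hc : c < b) (m : ℕ) :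
    ∀ᶠ n in atTop, m ≤ (Finset.univ.filter fun i => c < eig (X n) i).card := by
  have hpos := integral_pos_of_mem_support (μ := μ) (f := rampUp c)
    (fun t => le_min zero_le_one (le_max_left _ _)) isOpen_Ioi hb hc
    (fun t ht => rampUp_pos_iff.2 ht)
  simpa only [rampUp_pos_iff] using
    h.eventually_le_card (rampUp c) (fun t => min_le_left _ _) hpos m

lemma eventually_le_card_lt (h : HasSpectralLimit X μ a b) (ha : a ∈ μ.support) {c : ℝ}
    (hc : a < c) (m : ℕ) :
    ∀ᶠ n in atTop, m ≤ (Finset.univ.filter fun i => eig (X n) i < c).card := by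
  have hpos := integral_pos_of_mem_support (μ := μ) (f := rampDown c)
    (fun t => le_min zero_le_one (le_max_left _ _)) isOpen_Iio ha hc
    (fun t ht => rampDown_pos_iff.2 ht)
  simpa only [rampDown_pos_iff] using
    h.eventually_le_card (rampDown c) (fun t => min_le_left _ _) hpos m

end HasSpectralLimit

/-! ### Trace and Frobenius norm of X(z − X)⁻¹. -/

section TMatrix

variable {n : ℕ}

lemma tMat_diagonal {d : Fin n → ℝ} {z : ℝ} (hd : ∀ i, d i ≠ z) :
    tMat (diagonal fun i => (d i : 𝕜)) z = diagonal fun i => ((d i / (z - d i) : ℝ) : 𝕜) := by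
  have h1 : (z : 𝕜) • (1 : Matrix (Fin n) (Fin n) 𝕜) - (diagonal fun i => (d i : 𝕜))
      = diagonal fun i => ((z - d i : ℝ) : 𝕜) := by
    rw [smul_one_eq_diagonal, diagonal_sub]
    simp
  have h2 : (diagonal fun i => ((z - d i : ℝ) : 𝕜))⁻¹
      = diagonal fun i => (((z - d i)⁻¹ : ℝ) : 𝕜) := by
    apply inv_eq_right_inv
    rw [diagonal_mul_diagonal, ← diagonal_one]
    congr 1
    ext i
    rw [← RCLike.ofReal_mul, mul_inv_cancel₀ (sub_ne_zero.2 (hd i).symm), RCLike.ofReal_one]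
  rw [tMat, h1, h2, diagonal_mul_diagonal]
  congr 1
  ext i
  rw [← RCLike.ofReal_mul, div_eq_mul_inv]

lemma trace_tMat {X : Matrix (Fin n) (Fin n) 𝕜} (hX : X.IsHermitian) {z : ℝ}
    (hz : ∀ i, eig X i ≠ z) :
    (tMat X z).trace = ((∑ i, eig X i / (z - eig X i) : ℝ) : 𝕜) := by
  obtain ⟨W, hW, hXW⟩ := exists_unitary_diagonal_eig hX
  conv_lhs => rw [hXW]
  rw [tMat_conj hW, trace_conj_unitary hW, tMat_diagonal hz, trace_diagonal]
  simp

/-- Subtracting their mean from the values t/(z − t) does not increase the sum of squares. -/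
lemma frobSq_traceless_tMat_le {X : Matrix (Fin n) (Fin n) 𝕜} (hX : X.IsHermitian) {z : ℝ}
    (hz : ∀ i, eig X i ≠ z) :
    frobSq (traceless (tMat X z)) ≤ ∑ i, (eig X i / (z - eig X i)) ^ 2 := by
  obtain ⟨W, hW, hXW⟩ := exists_unitary_diagonal_eig hX
  conv_lhs => rw [hXW]
  set t : Fin n → ℝ := fun i => eig X i / (z - eig X i) with ht
  set τ : ℝ := (∑ i, t i) / n with hτ
  have h1 : traceless (diagonal fun i => (t i : 𝕜)) = diagonal fun i => ((t i - τ : ℝ) : 𝕜) := by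
    rw [traceless, trace_diagonal, smul_one_eq_diagonal, diagonal_sub]
    congr 1
    ext i
    simp [hτ]
  rw [tMat_conj hW, traceless_conj hW, frobSq_mul_unitary (star_mem_unitaryGroup hW),
    frobSq_unitary_mul hW, tMat_diagonal hz, h1, frobSq_diagonal]
  rcases Nat.eq_zero_or_pos n with rfl | hn
  · simp
  have hn' : (n : ℝ) ≠ 0 := by exact_mod_cast hn.ne'
  have h2 : ∑ i, (t i - τ) ^ 2 = ∑ i, t i ^ 2 - n * τ ^ 2 := by
    have h3 : ∑ i, t i = n * τ := by rw [hτ]; field_simp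
    have : ∀ i, (t i - τ) ^ 2 = t i ^ 2 - 2 * τ * t i + τ ^ 2 := fun i => by ring
    simp only [this, Finset.sum_add_distrib, Finset.sum_sub_distrib, ← Finset.mul_sum, h3,
      Finset.sum_const, Finset.card_univ, Fintype.card_fin, nsmul_eq_mul]
    ring
  rw [h2]
  have : 0 ≤ (n : ℝ) * τ ^ 2 := by positivity
  linarith

end TMatrix

/-! ### Eventual bounds on the eigenvalues of the spiked matrix. -/

section Spiked

variable {θ : ℕ → ℝ} {r : ℕ}

lemma exists_pos_le_abs (hθ : ∀ i < r, θ (i + 1) ≠ 0) :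
    ∃ m : ℝ, 0 < m ∧ ∀ i < r, m ≤ |θ (i + 1)| := by
  induction r with
  | zero => exact ⟨1, one_pos, fun i hi => absurd hi (Nat.not_lt_zero i)⟩
  | succ k ih =>
    obtain ⟨m, hm, hle⟩ := ih fun i hi => hθ i (hi.trans k.lt_succ_self)
    refine ⟨min m |θ (k + 1)|, lt_min hm (abs_pos.2 (hθ k k.lt_succ_self)), fun i hi => ?_⟩
    rcases Nat.lt_succ_iff_lt_or_eq.1 hi with h | rfl
    · exact (min_le_left _ _).trans (hle i h)
    · exact min_le_right _ _

/-- The diagonal matrix of the spikes. -/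
def spikeMatrix (𝕜 : Type*) [RCLike 𝕜] (θ : ℕ → ℝ) (r n : ℕ) : Matrix (Fin n) (Fin n) 𝕜 :=
  diagonal fun i => (spikes θ r n i : 𝕜)

/-- Both weights in the deviation can be undone: its denominator stays bounded because the spectrum
eventually keeps away from z, and the factors from P are bounded below on the first r coordinates
because no θ_i vanishes. -/
lemma tendsto_sum_traceless (h : HasSpectralLimit X μ a b) (hμ : ∀ᵐ t ∂μ, t ∈ Icc a b)
    (hab : a ≤ b) (hθ : ∀ i < r, θ (i + 1) ≠ 0) {z α β : ℝ} (hα : α < a) (hβ : b < β)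
    (hz : z ∉ Icc α β)
    (hdev : Tendsto (fun n => deviation z (X n) (spikeMatrix 𝕜 θ r n)) atTop (𝓝 0)) :
    Tendsto (fun n => ∑ i ∈ spikeSet r n, ∑ j ∈ spikeSet r n,
      ‖traceless (tMat (X n) z) i j‖ ^ 2) atTop (𝓝 0) := by
  obtain ⟨m, hm, hle⟩ := exists_pos_le_abs hθ
  have hg : ContinuousOn (fun t : ℝ => (t / (z - t)) ^ 2) (Icc α β) := by
    refine (continuousOn_id.div (continuousOn_const.sub continuousOn_id) fun t ht => ?_).pow 2
    exact sub_ne_zero.2 fun (h : z = t) => hz (h ▸ ht)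
  have hsum := h.tendsto_sum_div hμ hab hα hβ hg
  have hup : Tendsto (fun n => (m ^ 4)⁻¹ * (deviation z (X n) (spikeMatrix 𝕜 θ r n) *
      (1 + (∑ i, (eig (X n) i / (z - eig (X n) i)) ^ 2) / n))) atTop (𝓝 0) := by
    simpa using (hdev.mul (hsum.const_add 1)).const_mul (m ^ 4)⁻¹
  refine squeeze_zero' (Eventually.of_forall fun n => by positivity) ?_ hup
  filter_upwards [h.eventually_mem_Ioo hα hβ] with n hn
  have hne : ∀ i, eig (X n) i ≠ z := fun i hi => hz (hi ▸ Ioo_subset_Icc_self (hn i))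
  set B := traceless (tMat (X n) z) with hB
  have h1 : deviation z (X n) (spikeMatrix 𝕜 θ r n) * (1 + frobSq B / n)
      = ∑ i, ∑ j, (spikes θ r n i * spikes θ r n j) ^ 2 * ‖B i j‖ ^ 2 := by
    rw [← frobSq_diagonal_mul_mul_diagonal, deviation, ← hB]
    have := frobSq_nonneg B
    exact div_mul_cancel₀ _ (by positivity)
  have h2 : frobSq B / n ≤ (∑ i, (eig (X n) i / (z - eig (X n) i)) ^ 2) / n := by
    gcongr
    exact frobSq_traceless_tMat_le (h.posSemidef n).isHermitian hne
  have h3 : m ^ 4 * ∑ i ∈ spikeSet r n, ∑ j ∈ spikeSet r n, ‖B i j‖ ^ 2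
      ≤ ∑ i, ∑ j, (spikes θ r n i * spikes θ r n j) ^ 2 * ‖B i j‖ ^ 2 := by
    rw [Finset.mul_sum]
    refine (Finset.sum_le_sum fun i hi => ?_).trans (Finset.sum_le_sum_of_subset_of_nonneg
      (Finset.subset_univ _) fun _ _ _ => Finset.sum_nonneg fun _ _ => by positivity)
    rw [Finset.mul_sum]
    refine (Finset.sum_le_sum fun j hj => ?_).trans (Finset.sum_le_sum_of_subset_of_nonneg
      (Finset.subset_univ _) fun _ _ _ => by positivity)
    simp only [spikeSet, Finset.mem_filter, Finset.mem_univ, true_and] at hi hj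
    have hi' : m ≤ |spikes θ r n i| := by simpa [spikes, hi] using hle i hi
    have hj' : m ≤ |spikes θ r n j| := by simpa [spikes, hj] using hle j hj
    refine mul_le_mul_of_nonneg_right ?_ (by positivity)
    rw [← sq_abs, abs_mul]
    calc m ^ 4 = (m * m) ^ 2 := by ring
      _ ≤ _ := by gcongr
  rw [le_inv_mul_iff₀ (by positivity)]
  refine h3.trans (h1 ▸ ?_)
  gcongr
  exact deviation_nonneg _ _ _

/-- On the corner the traceless part tends to 0, and the scalar part, the normalised trace, tends to
T_μ(z) by convergence of the spectrum. -/
lemma eventually_isNearScalar (h : HasSpectralLimit X μ a b) (hμ : ∀ᵐ t ∂μ, t ∈ Icc a b)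
    (hab : a ≤ b) (hθ : ∀ i < r, θ (i + 1) ≠ 0) {z : ℝ} (hz : b < z ∨ z < a)
    (hdev : Tendsto (fun n => deviation z (X n) (spikeMatrix 𝕜 θ r n)) atTop (𝓝 0))
    {η : ℝ} (hη : 0 < η) :
    ∀ᶠ n in atTop, IsNearScalar (tMat (X n) z) (spikeSet r n) (Ttransform μ z) η := by
  obtain ⟨α, β, hα, hβ, hzαβ⟩ : ∃ α β, α < a ∧ b < β ∧ z ∉ Icc α β := by
    rcases hz with hz | hz
    · obtain ⟨β, h1, h2⟩ := exists_between hz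
      exact ⟨a - 1, β, by linarith, h1, fun h => absurd h.2 (not_le.2 h2)⟩
    · obtain ⟨α, h1, h2⟩ := exists_between hz
      exact ⟨α, b + 1, h2, by linarith, fun h => absurd h.1 (not_le.2 h1)⟩
  have hg : ContinuousOn (fun t : ℝ => t / (z - t)) (Icc α β) :=
    continuousOn_id.div (continuousOn_const.sub continuousOn_id) fun t ht =>
      sub_ne_zero.2 fun (h : z = t) => hzαβ (h ▸ ht)
  have h1 := h.tendsto_sum_div hμ hab hα hβ hg
  have h2 := tendsto_sum_traceless h hμ hab hθ hα hβ hzαβ hdev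
  have h3 : Tendsto (fun n => 2 * (∑ i ∈ spikeSet r n, ∑ j ∈ spikeSet r n,
      ‖traceless (tMat (X n) z) i j‖ ^ 2) + (r : ℝ) ^ 2 * (2 *
      ((∑ i, eig (X n) i / (z - eig (X n) i)) / n - Ttransform μ z) ^ 2)) atTop (𝓝 0) := by
    have h4 := (((h1.sub_const (Ttransform μ z)).pow 2).const_mul 2).const_mul ((r : ℝ) ^ 2)
    have h5 := (h2.const_mul 2).add h4
    simpa [Ttransform] using h5
  filter_upwards [h3.eventually_le_const (by positivity : 0 < η ^ 2),
    h.eventually_mem_Ioo hα hβ] with n hn hmem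
  have hne : ∀ i, eig (X n) i ≠ z := fun i hi => hzαβ (hi ▸ Ioo_subset_Icc_self (hmem i))
  refine isNearScalar_of_sum_le (le_trans ?_ hn)
  set τ : ℝ := (∑ i, eig (X n) i / (z - eig (X n) i)) / n with hτ
  have hentry : ∀ i j, ‖(tMat (X n) z - (Ttransform μ z : 𝕜) •
      (1 : Matrix (Fin n) (Fin n) 𝕜)) i j‖ ^ 2
      ≤ 2 * ‖traceless (tMat (X n) z) i j‖ ^ 2 + 2 * (τ - Ttransform μ z) ^ 2 := by
    intro i j
    have heq : (tMat (X n) z - (Ttransform μ z : 𝕜) • (1 : Matrix (Fin n) (Fin n) 𝕜)) i j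
        = traceless (tMat (X n) z) i j
          + ((τ - Ttransform μ z : ℝ) : 𝕜) * (1 : Matrix (Fin n) (Fin n) 𝕜) i j := by
      simp only [traceless, trace_tMat (h.posSemidef n).isHermitian hne, hτ, Matrix.sub_apply,
        Matrix.smul_apply, smul_eq_mul]
      push_cast
      ring
    have hone : ‖((τ - Ttransform μ z : ℝ) : 𝕜) * (1 : Matrix (Fin n) (Fin n) 𝕜) i j‖
        ≤ |τ - Ttransform μ z| := by
      rw [norm_mul, RCLike.norm_ofReal]
      refine mul_le_of_le_one_right (abs_nonneg _) ?_
      rw [one_apply]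
      split_ifs <;> simp
    rw [heq]
    calc _ ≤ (‖traceless (tMat (X n) z) i j‖ + |τ - Ttransform μ z|) ^ 2 := by
          gcongr
          exact (norm_add_le _ _).trans (by gcongr)
      _ ≤ 2 * ‖traceless (tMat (X n) z) i j‖ ^ 2 + 2 * |τ - Ttransform μ z| ^ 2 := by
          nlinarith [sq_nonneg (‖traceless (tMat (X n) z) i j‖ - |τ - Ttransform μ z|)]
      _ = _ := by rw [sq_abs]
  calc _ ≤ ∑ i ∈ spikeSet r n, ∑ j ∈ spikeSet r n,
        (2 * ‖traceless (tMat (X n) z) i j‖ ^ 2 + 2 * (τ - Ttransform μ z) ^ 2) :=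
        Finset.sum_le_sum fun i _ => Finset.sum_le_sum fun j _ => hentry i j
    _ = 2 * (∑ i ∈ spikeSet r n, ∑ j ∈ spikeSet r n, ‖traceless (tMat (X n) z) i j‖ ^ 2)
        + ((spikeSet r n).card : ℝ) ^ 2 * (2 * (τ - Ttransform μ z) ^ 2) := by
        simp only [Finset.sum_add_distrib, Finset.sum_const, nsmul_eq_mul, ← Finset.mul_sum]
        ring
    _ ≤ _ := by
        have hcard : ((spikeSet r n).card : ℝ) ≤ r := by exact_mod_cast card_spikeSet_le r n
        gcongr

/-- At η = 0 the expression equals T(cT − 1) > 0, and it is continuous in η. -/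
lemma exists_pos_error {c T C : ℝ} (hT : 0 < T) (hcT : 1 < c * T) :
    ∃ η, 0 < η ∧ 0 < c * T ^ 2 - T - (2 * c * T - 1) * η - C * η ^ 2 := by
  have hcont : Continuous fun η : ℝ => c * T ^ 2 - T - (2 * c * T - 1) * η - C * η ^ 2 := by
    fun_prop
  have h0 : 0 < c * T ^ 2 - T - (2 * c * T - 1) * 0 - C * 0 ^ 2 := by nlinarith
  have := (hcont.tendsto 0).eventually_const_lt h0
  obtain ⟨η, h1, h2⟩ := ((this.filter_mono nhdsWithin_le_nhds).and
    (self_mem_nhdsWithin : Ioi (0 : ℝ) ∈ 𝓝[>] 0)).exists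
  exact ⟨η, h2, h1⟩

lemma exists_pos_error' {c T : ℝ} (hc : 0 ≤ c) (hcT : c * T < 1) :
    ∃ η, 0 < η ∧ c * (T + η) ≤ 1 := by
  -- Dividing by c + 1 rather than c allows c = 0, the case without spikes of the relevant sign.
  refine ⟨(1 - c * T) / (c + 1), div_pos (by linarith) (by linarith), ?_⟩
  have h1 : c * ((1 - c * T) / (c + 1)) ≤ 1 - c * T := by
    rw [← mul_div_assoc, div_le_iff₀ (by linarith)]
    nlinarith
  linarith

/-- The coordinates with index in a set of natural numbers. -/
def coords (n : ℕ) (S : Finset ℕ) : Finset (Fin n) := Finset.univ.filter fun i => (i : ℕ) ∈ S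

lemma mem_coords {n : ℕ} {S : Finset ℕ} {i : Fin n} : i ∈ coords n S ↔ (i : ℕ) ∈ S := by
  simp [coords]

lemma mem_spikeSet {n : ℕ} {i : Fin n} : i ∈ spikeSet r n ↔ (i : ℕ) < r := by
  simp [spikeSet]

/-- The perturbed matrix in a basis in which the perturbation is diagonal. -/
abbrev spiked (X : (n : ℕ) → Matrix (Fin n) (Fin n) 𝕜) (θ : ℕ → ℝ) (r n : ℕ) :
    Matrix (Fin n) (Fin n) 𝕜 := X n * (1 + spikeMatrix 𝕜 θ r n)

lemma eigenvalueDesc_eq_eig {n k : ℕ} (M : Matrix (Fin n) (Fin n) 𝕜) (hk : 1 ≤ k) (hkn : k ≤ n) :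
    eigenvalueDesc M k = eig M ⟨k - 1, by omega⟩ := by
  unfold eig
  congr 1
  simp only
  omega

lemma eventually_lt_eigenvalueDesc (h : HasSpectralLimit X μ a b)
    (hμ : ∀ᵐ t ∂μ, t ∈ Icc a b) (hab : a ≤ b) (hθ : ∀ i < r, θ (i + 1) ≠ 0)
    {k : ℕ} (hk : 1 ≤ k) (hkr : k ≤ r) {z c : ℝ} (hz : b < z)
    (hc0 : 0 ≤ c) (hc : ∀ i < k, c ≤ θ (i + 1)) (hT : 0 < Ttransform μ z)
    (hcT : 1 < c * Ttransform μ z)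
    (hdev : Tendsto (fun n => deviation z (X n) (spikeMatrix 𝕜 θ r n)) atTop (𝓝 0)) :
    ∀ᶠ n in atTop, z < eigenvalueDesc (spiked X θ r n) k := by
  obtain ⟨η, hη, hlt⟩ := exists_pos_error (C := spikeBound θ r) hT hcT
  filter_upwards [eventually_isNearScalar h hμ hab hθ (Or.inl hz) hdev hη,
    h.eventually_mem_Ioo (sub_one_lt a) hz, eventually_ge_atTop k] with n hA hmem hn
  rw [eigenvalueDesc_eq_eig _ hk hn]
  refine lt_eig_mul_one_add (J := coords n (Finset.range k)) (h.posSemidef n)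
    (posDef_scalar_sub (h.posSemidef n).isHermitian fun i => (hmem i).2)
    (fun i => spikes_of_notMem) (fun i hi => ?_) (fun i hi => ?_) (abs_spikes_le θ r n) hη hcT hc0
    hA hlt _ ?_
  · rw [mem_coords, Finset.mem_range] at hi
    exact mem_spikeSet.2 (hi.trans_le hkr)
  · rw [mem_coords, Finset.mem_range] at hi
    simpa [spikes, hi.trans_le hkr] using hc i hi
  · rw [coords, card_filter_fin_eq _ fun i hi => (Finset.mem_range.1 hi).trans_le hn,
      Finset.card_range]
    simp only
    omega

lemma eventually_eigenvalueDesc_le (h : HasSpectralLimit X μ a b)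
    (hμ : ∀ᵐ t ∂μ, t ∈ Icc a b) (hab : a ≤ b) (hθ : ∀ i < r, θ (i + 1) ≠ 0)
    {k : ℕ} (hk : 1 ≤ k) {z c : ℝ} (hz : b < z) (hc0 : 0 ≤ c)
    (hc : ∀ i, k ≤ i + 1 → i < r → θ (i + 1) ≤ c) (hT : 0 < Ttransform μ z)
    (hcT : c * Ttransform μ z < 1)
    (hdev : Tendsto (fun n => deviation z (X n) (spikeMatrix 𝕜 θ r n)) atTop (𝓝 0)) :
    ∀ᶠ n in atTop, eigenvalueDesc (spiked X θ r n) k ≤ z := by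
  obtain ⟨η, hη, hlt⟩ := exists_pos_error' hc0 hcT
  filter_upwards [eventually_isNearScalar h hμ hab hθ (Or.inl hz) hdev hη,
    h.eventually_mem_Ioo (sub_one_lt a) hz, eventually_ge_atTop k] with n hA hmem hn
  rw [eigenvalueDesc_eq_eig _ hk hn]
  -- Without the coordinates carrying θ_1, …, θ_{k−1} every diagonal entry is at most c; the zero
  -- entries are covered by 0 ≤ c.
  refine eig_mul_one_add_le (J := coords n (Finset.range (k - 1))) (h.posSemidef n)
    (posDef_scalar_sub (h.posSemidef n).isHermitian fun i => (hmem i).2)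
    (fun i => spikes_of_notMem) (fun i hi => ?_) hc0 hη (by linarith) hlt hA _ ?_
  · rw [mem_coords, Finset.mem_range] at hi
    unfold spikes
    split_ifs with hir
    · exact hc i (by omega) hir
    · exact hc0
  · exact (card_filter_fin_le _).trans (by simp)

lemma eventually_eigenvalueDesc_lt (h : HasSpectralLimit X μ a b)
    (hμ : ∀ᵐ t ∂μ, t ∈ Icc a b) (hab : a ≤ b) (hθ : ∀ i < r, θ (i + 1) ≠ 0)
    {j : ℕ} (hj : j < r) {z c : ℝ} (hz : z < a)
    (hc0 : 0 ≤ c) (hc : ∀ i < r, r ≤ i + j + 1 → θ (i + 1) ≤ -c) (hT : Ttransform μ z < 0)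
    (hcT : 1 < c * -Ttransform μ z)
    (hdev : Tendsto (fun n => deviation z (X n) (spikeMatrix 𝕜 θ r n)) atTop (𝓝 0)) :
    ∀ᶠ n in atTop, eigenvalueDesc (spiked X θ r n) (n - j) < z := by
  obtain ⟨η, hη, hlt⟩ := exists_pos_error (C := spikeBound θ r) (neg_pos.2 hT) hcT
  filter_upwards [eventually_isNearScalar h hμ hab hθ (Or.inr hz) hdev hη,
    h.eventually_mem_Ioo hz (lt_add_one b), eventually_ge_atTop r] with n hA hmem hn
  rw [eigenvalueDesc_eq_eig _ (by omega) (by omega)]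
  -- The j + 1 coordinates carrying θ_{r−j}, …, θ_r, with indices counted from 0.
  refine eig_mul_one_add_lt (J := coords n (Finset.Ico (r - j - 1) r)) (h.posSemidef n)
    (posDef_sub_scalar (h.posSemidef n).isHermitian fun i => (hmem i).1)
    (fun i => spikes_of_notMem) (fun i hi => ?_) (fun i hi => ?_) (abs_spikes_le θ r n) hη hcT hc0
    (by rwa [neg_neg]) hlt _ ?_
  · rw [mem_coords, Finset.mem_Ico] at hi
    exact mem_spikeSet.2 hi.2
  · rw [mem_coords, Finset.mem_Ico] at hi
    simpa [spikes, hi.2] using hc i hi.2 (by omega)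
  · rw [coords, card_filter_fin_eq _ fun i hi => (Finset.mem_Ico.1 hi).2.trans_le hn,
      Nat.card_Ico]
    simp only
    omega

lemma eventually_le_eigenvalueDesc (h : HasSpectralLimit X μ a b)
    (hμ : ∀ᵐ t ∂μ, t ∈ Icc a b) (hab : a ≤ b) (hθ : ∀ i < r, θ (i + 1) ≠ 0)
    {j : ℕ} {z c : ℝ} (hz : z < a) (hc0 : 0 ≤ c)
    (hc : ∀ i, i + j < r → -c ≤ θ (i + 1)) (hT : Ttransform μ z < 0)
    (hcT : c * -Ttransform μ z < 1)
    (hdev : Tendsto (fun n => deviation z (X n) (spikeMatrix 𝕜 θ r n)) atTop (𝓝 0)) :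
    ∀ᶠ n in atTop, z ≤ eigenvalueDesc (spiked X θ r n) (n - j) := by
  obtain ⟨η, hη, hlt⟩ := exists_pos_error' hc0 hcT
  filter_upwards [eventually_isNearScalar h hμ hab hθ (Or.inr hz) hdev hη,
    h.eventually_mem_Ioo hz (lt_add_one b), eventually_gt_atTop j] with n hA hmem hn
  rw [eigenvalueDesc_eq_eig _ (by omega) (by omega)]
  -- For j > r the truncated difference r − j is 0, and the interval still has at most j elements.
  have hcard : (coords n (Finset.Ico (r - j) r)).card ≤ j :=
    (card_filter_fin_le _).trans (by rw [Nat.card_Ico]; omega)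
  refine le_eig_mul_one_add (J := coords n (Finset.Ico (r - j) r)) (h.posSemidef n)
    (posDef_sub_scalar (h.posSemidef n).isHermitian fun i => (hmem i).1)
    (fun i => spikes_of_notMem) (fun i hi => ?_) hc0 hη (by linarith) hlt (by rwa [neg_neg]) _ ?_
  · rw [mem_coords, Finset.mem_Ico] at hi
    unfold spikes
    split_ifs with hir
    · exact hc i (by omega)
    · linarith
  · simp only
    omega

variable [IsProbabilityMeasure μ]

/-- With k + r eigenvalues of X above c, a perturbation of rank at most r leaves at least k
eigenvalues not below c, whatever the spikes are. -/
lemma eventually_le_eigenvalueDesc_of_lt (h : HasSpectralLimit X μ a b)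
    (hb : b ∈ μ.support) {k : ℕ} (hk : 1 ≤ k) {c : ℝ} (hc : c < b) : ∀ᶠ n in atTop, c ≤ eigenvalueDesc (spiked X θ r n) k := by
  filter_upwards [h.eventually_le_card_gt hb hc (k + r), eventually_ge_atTop k] with n hcard hn
  rw [eigenvalueDesc_eq_eig _ hk hn]
  refine le_eig_of_card (I := spikeSet r n) (h.posSemidef n) (fun i => spikes_of_notMem)
    (J := Finset.univ.filter fun i => c < eig (X n) i) (fun i hi => ?_) _ ?_
  · simp only [Finset.mem_filter] at hi
    exact hi.2.le
  · have := card_spikeSet_le r n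
    simp only
    omega

lemma eventually_eigenvalueDesc_le_of_lt (h : HasSpectralLimit X μ a b)
    (ha : a ∈ μ.support) (j : ℕ) {c : ℝ} (hc : a < c) : ∀ᶠ n in atTop, eigenvalueDesc (spiked X θ r n) (n - j) ≤ c := by
  filter_upwards [h.eventually_le_card_lt ha hc (j + 1 + r), eventually_gt_atTop j] with n hcard hn
  rw [eigenvalueDesc_eq_eig _ (by omega) (by omega)]
  refine eig_le_of_card (I := spikeSet r n) (h.posSemidef n) (fun i => spikes_of_notMem)
    (J := Finset.univ.filter fun i => eig (X n) i < c) (fun i hi => ?_) _ ?_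
  · simp only [Finset.mem_filter] at hi
    exact hi.2.le
  · have := card_spikeSet_le r n
    simp only
    omega

end Spiked

end SpectralLimits

end SpikedMatrix

namespace SpikedMatrix

open Matrix

/-! ### Deterministic limits for matrices in general position. -/

section Limits

variable {𝕜 : Type*} [RCLike 𝕜] {X P : (n : ℕ) → Matrix (Fin n) (Fin n) 𝕜} {μ : Measure ℝ}
  {a b : ℝ} {θ : ℕ → ℝ} {r s : ℕ}

lemma hasSpectralLimit_of_convergesWeakly (hX : ∀ n, (X n).PosSemidef)
    (hlim : ConvergesWeakly (fun n => empiricalSpectralMeasure (X n)) μ)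
    (hmin : Tendsto (fun n => eigenvalueDesc (X n) n) atTop (𝓝 a))
    (hmax : Tendsto (fun n => eigenvalueDesc (X n) 1) atTop (𝓝 b)) :
    HasSpectralLimit X μ a b :=
  ⟨hX, fun f => by simpa only [integral_empiricalSpectralMeasure] using hlim f, hmin, hmax⟩

lemma charpoly_mul_one_add_eq_prod {n : ℕ} {X P : Matrix (Fin n) (Fin n) 𝕜} (hX : X.PosSemidef)
    (hP : P.IsHermitian) : (X * (1 + P)).charpoly = ∏ k ∈ Finset.Icc 1 n,
      (Polynomial.X - Polynomial.C (eigenvalueDesc (X * (1 + P)) k : 𝕜)) := by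
  obtain ⟨S, hS, hSX⟩ := exists_isHermitian_mul_self hX
  have h := charpoly_mul_eq (P := P) hSX
  simp only [eigenvalueDesc_congr h]
  rw [h, charpoly_eq_prod_eigenvalueDesc (isHermitian_sandwich hS hP)]

lemma charpoly_conj_unitary {n : ℕ} {U : Matrix (Fin n) (Fin n) 𝕜}
    (hU : U ∈ unitaryGroup (Fin n) 𝕜) (M : Matrix (Fin n) (Fin n) 𝕜) :
    (U * M * star U).charpoly = M.charpoly := by
  rw [Matrix.mul_assoc, charpoly_mul_comm, Matrix.mul_assoc, mem_unitaryGroup_iff'.1 hU,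
    Matrix.mul_one]

/-- Conjugating both sequences, the perturbation may be taken diagonal. -/
lemma HasSpectralLimit.exists_spiked (h : HasSpectralLimit X μ a b)
    (hP : ∀ n, r ≤ n → (P n).IsHermitian)
    (hPs : ∀ n, r ≤ n →
      (P n).charpoly = ∏ i, (Polynomial.X - Polynomial.C (spikes θ r n i : 𝕜))) :
    ∃ Y : (n : ℕ) → Matrix (Fin n) (Fin n) 𝕜, HasSpectralLimit Y μ a b ∧
      (∀ n, r ≤ n → ∀ z, deviation z (Y n) (spikeMatrix 𝕜 θ r n) = deviation z (X n) (P n)) ∧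
      ∀ n, r ≤ n → ∀ k,
        eigenvalueDesc (spiked Y θ r n) k = eigenvalueDesc (X n * (1 + P n)) k := by
  have hV : ∀ n, ∃ V ∈ unitaryGroup (Fin n) 𝕜, r ≤ n → P n = V * spikeMatrix 𝕜 θ r n * star V := by
    intro n
    by_cases hn : r ≤ n
    · obtain ⟨V, hV, hPV⟩ := exists_unitary_diagonal_of_charpoly_eq (hP n hn) _ (hPs n hn)
      exact ⟨V, hV, fun _ => hPV⟩
    · exact ⟨1, one_mem _, fun h => absurd h hn⟩
  choose V hV hPV using hV
  have hchar : ∀ n, (star (V n) * X n * V n).charpoly = (X n).charpoly := fun n => by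
    simpa using charpoly_conj_unitary (star_mem_unitaryGroup (hV n)) (X n)
  have hX : ∀ n, X n = V n * (star (V n) * X n * V n) * star (V n) := fun n => by
    have h1 := mem_unitaryGroup_iff.1 (hV n)
    calc X n = (V n * star (V n)) * X n * (V n * star (V n)) := by simp [h1]
      _ = _ := by simp only [Matrix.mul_assoc]
  refine ⟨fun n => star (V n) * X n * V n, ⟨fun n => ?_, fun f => ?_, ?_, ?_⟩, fun n hn z => ?_,
    fun n hn k => ?_⟩
  · exact (h.posSemidef n).conjTranspose_mul_mul_same (V n)
  · simpa only [eig_congr (hchar _)] using h.tendsto_integral f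
  · simpa only [eigenvalueDesc_congr (hchar _)] using h.tendsto_min
  · simpa only [eigenvalueDesc_congr (hchar _)] using h.tendsto_max
  · conv_rhs => rw [hX n, hPV n hn]
    rw [deviation_conj (hV n)]
  · refine eigenvalueDesc_congr ?_ k
    have h1 : X n * (1 + P n)
        = V n * (star (V n) * X n * V n * (1 + spikeMatrix 𝕜 θ r n)) * star (V n) := by
      have h2 : 1 + P n = V n * (1 + spikeMatrix 𝕜 θ r n) * star (V n) := by
        rw [Matrix.mul_add, Matrix.add_mul, ← hPV n hn, Matrix.mul_one,
          mem_unitaryGroup_iff.1 (hV n)]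
      conv_lhs => rw [h2, hX n]
      rw [conj_unitary_mul (hV n)]
    rw [h1, charpoly_conj_unitary (hV n)]

lemma tendsto_of_forall_rat_gt {l : ℕ → ℝ} (h1 : ∀ q : ℚ, b < q → ∀ᶠ n in atTop, l n ≤ q)
    (h2 : ∀ c < b, ∀ᶠ n in atTop, c ≤ l n) : Tendsto l atTop (𝓝 b) := by
  refine tendsto_order.2 ⟨fun c hc => ?_, fun c hc => ?_⟩
  · obtain ⟨d, hcd, hd⟩ := exists_between hc
    filter_upwards [h2 d hd] with n hn using hcd.trans_le hn
  · obtain ⟨q, hq, hqc⟩ := exists_rat_btwn hc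
    filter_upwards [h1 q hq] with n hn using hn.trans_lt hqc

lemma tendsto_of_forall_rat_lt {l : ℕ → ℝ} (h1 : ∀ q : ℚ, q < a → ∀ᶠ n in atTop, q ≤ l n)
    (h2 : ∀ c > a, ∀ᶠ n in atTop, l n ≤ c) : Tendsto l atTop (𝓝 a) := by
  refine tendsto_order.2 ⟨fun c hc => ?_, fun c hc => ?_⟩
  · obtain ⟨q, hcq, hq⟩ := exists_rat_btwn hc
    filter_upwards [h1 q hq] with n hn using hcq.trans_le hn
  · obtain ⟨d, hd, hdc⟩ := exists_between hc
    filter_upwards [h2 d hd] with n hn using hn.trans_lt hdc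

/-- A deterministic setting for the limits of the extreme eigenvalues of `X (1 + P)`: the matrices
`P n` have nonzero eigenvalues `θ 1, …, θ r`, and `X n` and `P n` are in general position. -/
structure IsGenericSpiked (X P : (n : ℕ) → Matrix (Fin n) (Fin n) 𝕜) (μ : Measure ℝ) (a b : ℝ)
    (θ : ℕ → ℝ) (r s : ℕ) : Prop where
  isGLB : IsGLB μ.support a
  isLUB : IsLUB μ.support b
  ne_dirac : μ ≠ Measure.dirac 0
  le : s ≤ r
  antitone : AntitoneOn θ (Icc 1 r)
  pos : ∀ i ∈ Icc 1 s, 0 < θ i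
  neg : ∀ i ∈ Icc (s + 1) r, θ i < 0
  isHermitian : ∀ n, r ≤ n → (P n).IsHermitian
  charpoly : ∀ n, r ≤ n →
    (P n).charpoly = ∏ i, (Polynomial.X - Polynomial.C (spikes θ r n i : 𝕜))
  hasSpectralLimit : HasSpectralLimit X μ a b
  tendsto_deviation : ∀ q : ℚ, Tendsto (fun n => deviation (q : ℝ) (X n) (P n)) atTop (𝓝 0)

/-- The support is closed and nonempty, so its supremum is attained. -/
lemma mem_support_of_isLUB [IsProbabilityMeasure μ] (hb : IsLUB μ.support b) : b ∈ μ.support :=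
  hb.mem_of_isClosed (Measure.nonempty_support (NeZero.ne μ)) Measure.isClosed_support

lemma mem_support_of_isGLB [IsProbabilityMeasure μ] (ha : IsGLB μ.support a) : a ∈ μ.support :=
  ha.mem_of_isClosed (Measure.nonempty_support (NeZero.ne μ)) Measure.isClosed_support

namespace IsGenericSpiked

lemma ne_zero (h : IsGenericSpiked X P μ a b θ r s) : ∀ i < r, θ (i + 1) ≠ 0 := fun i hi => by
  by_cases his : i < s
  · exact (h.pos _ ⟨by omega, by omega⟩).ne'
  · exact (h.neg _ ⟨by omega, by omega⟩).ne

lemma exists_spiked (h : IsGenericSpiked X P μ a b θ r s) :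
    ∃ Y : (n : ℕ) → Matrix (Fin n) (Fin n) 𝕜, HasSpectralLimit Y μ a b ∧
      (∀ q : ℚ, Tendsto (fun n => deviation (q : ℝ) (Y n) (spikeMatrix 𝕜 θ r n)) atTop (𝓝 0)) ∧
      ∀ n, r ≤ n → ∀ k,
        eigenvalueDesc (spiked Y θ r n) k = eigenvalueDesc (X n * (1 + P n)) k := by
  obtain ⟨Y, hY, hd, he⟩ := h.hasSpectralLimit.exists_spiked h.isHermitian h.charpoly
  refine ⟨Y, hY, fun q => (h.tendsto_deviation q).congr' ?_, he⟩
  filter_upwards [eventually_ge_atTop r] with n hn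
  exact (hd n hn q).symm

variable [IsProbabilityMeasure μ]

lemma edge_le (h : IsGenericSpiked X P μ a b θ r s) : a ≤ b :=
  h.isGLB.1 (mem_support_of_isLUB h.isLUB)

/-- Both tests use c = θ_k: the first k spikes are at least θ_k, and those from k on are at most
θ_k. -/
theorem tendsto_eigenvalueDesc_pos (h : IsGenericSpiked X P μ a b θ r s) {k : ℕ} (hk : 1 ≤ k)
    (hks : k ≤ s) :
    Tendsto (fun n => eigenvalueDesc (X n * (1 + P n)) k) atTop
      (𝓝 (if (θ k : EReal) > 1 / TtransformRight μ b then TinvRight μ b (1 / θ k) else b)) := by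
  obtain ⟨Y, hY, hd, he⟩ := h.exists_spiked
  have hae := ae_mem_Icc_of_support h.isGLB h.isLUB
  have hkr := hks.trans h.le
  have hpos := h.pos k ⟨hk, hks⟩
  refine Tendsto.congr' (by filter_upwards [eventually_ge_atTop r] with n hn using he n hn k)
    (tendsto_ite_TinvRight hae hY.nonneg h.ne_dirac hpos (fun q hq hT => ?_) (fun q hq hT => ?_)
      fun c hc => ?_)
  · exact eventually_lt_eigenvalueDesc hY hae h.edge_le h.ne_zero hk hkr hq hpos.le
      (fun i hi => h.antitone ⟨by omega, by omega⟩ ⟨hk, hkr⟩ (by omega))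
      (Ttransform_pos hae hY.nonneg h.ne_dirac hq) hT (hd q)
  · exact eventually_eigenvalueDesc_le hY hae h.edge_le h.ne_zero hk hq hpos.le
      (fun i hi hir => h.antitone ⟨hk, hkr⟩ ⟨by omega, by omega⟩ hi)
      (Ttransform_pos hae hY.nonneg h.ne_dirac hq) hT (hd q)
  · exact eventually_le_eigenvalueDesc_of_lt hY (mem_support_of_isLUB h.isLUB) hk hc

/-- Past s no spike is positive, so c = 0 is admissible and the upper test cT(q) < 1 is free at
every q > b. -/
theorem tendsto_eigenvalueDesc_right_edge (h : IsGenericSpiked X P μ a b θ r s) {k : ℕ}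
    (hk : s < k) : Tendsto (fun n => eigenvalueDesc (X n * (1 + P n)) k) atTop (𝓝 b) := by
  obtain ⟨Y, hY, hd, he⟩ := h.exists_spiked
  have hae := ae_mem_Icc_of_support h.isGLB h.isLUB
  refine Tendsto.congr' (by filter_upwards [eventually_ge_atTop r] with n hn using he n hn k)
    (tendsto_of_forall_rat_gt (fun q hq => ?_) fun c hc => ?_)
  · exact eventually_eigenvalueDesc_le hY hae h.edge_le h.ne_zero (by omega) hq le_rfl
      (fun i hi hir => (h.neg _ ⟨by omega, by omega⟩).le)
      (Ttransform_pos hae hY.nonneg h.ne_dirac hq) (by simp) (hd q)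
  · exact eventually_le_eigenvalueDesc_of_lt hY (mem_support_of_isLUB h.isLUB) (by omega) hc

/-- The mirror image with c = −θ_{r−j}: the last j + 1 spikes are at most θ_{r−j}, and those up to r
− j are at least θ_{r−j}. -/
theorem tendsto_eigenvalueDesc_neg (h : IsGenericSpiked X P μ a b θ r s) {j : ℕ}
    (hj : j < r - s) :
    Tendsto (fun n => eigenvalueDesc (X n * (1 + P n)) (n - j)) atTop
      (𝓝 (if (θ (r - j) : EReal) < 1 / TtransformLeft μ a
        then TinvLeft μ a (1 / θ (r - j)) else a)) := by
  obtain ⟨Y, hY, hd, he⟩ := h.exists_spiked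
  have hae := ae_mem_Icc_of_support h.isGLB h.isLUB
  have hneg := h.neg (r - j) ⟨by omega, by omega⟩
  refine Tendsto.congr' (by filter_upwards [eventually_ge_atTop r] with n hn using he n hn _)
    (tendsto_ite_TinvLeft hae hY.nonneg h.ne_dirac hneg (fun q hq hT => ?_) (fun q hq hT => ?_)
      fun c hc => ?_)
  · exact eventually_eigenvalueDesc_lt (c := -θ (r - j)) hY hae h.edge_le h.ne_zero (by omega) hq
      (by linarith) (fun i hi hij => by
        rw [neg_neg]
        exact h.antitone ⟨by omega, by omega⟩ ⟨by omega, by omega⟩ (by omega))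
      (Ttransform_neg hae hY.nonneg h.ne_dirac hq) (by rwa [neg_mul_neg]) (hd q)
  · exact eventually_le_eigenvalueDesc (c := -θ (r - j)) hY hae h.edge_le h.ne_zero hq
      (by linarith) (fun i hij => by
        rw [neg_neg]
        exact h.antitone ⟨by omega, by omega⟩ ⟨by omega, by omega⟩ (by omega))
      (Ttransform_neg hae hY.nonneg h.ne_dirac hq) (by rwa [neg_mul_neg]) (hd q)
  · exact eventually_eigenvalueDesc_le_of_lt hY (mem_support_of_isGLB h.isGLB) j hc

theorem tendsto_eigenvalueDesc_left_edge (h : IsGenericSpiked X P μ a b θ r s) {j : ℕ}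
    (hj : r - s ≤ j) :
    Tendsto (fun n => eigenvalueDesc (X n * (1 + P n)) (n - j)) atTop (𝓝 a) := by
  obtain ⟨Y, hY, hd, he⟩ := h.exists_spiked
  have hae := ae_mem_Icc_of_support h.isGLB h.isLUB
  refine Tendsto.congr' (by filter_upwards [eventually_ge_atTop r] with n hn using he n hn _)
    (tendsto_of_forall_rat_lt (fun q hq => ?_) fun c hc => ?_)
  · exact eventually_le_eigenvalueDesc hY hae h.edge_le h.ne_zero hq le_rfl
      (fun i hij => by
        rw [neg_zero]
        exact (h.pos _ ⟨by omega, by omega⟩).le)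
      (Ttransform_neg hae hY.nonneg h.ne_dirac hq) (by simp) (hd q)
  · exact eventually_eigenvalueDesc_le_of_lt hY (mem_support_of_isGLB h.isGLB) j hc

end IsGenericSpiked

end Limits

/-! ### From moment bounds to almost sure statements. -/

section Random

variable {𝕜 : Type*} [RCLike 𝕜] {Ω : Type*} [MeasurableSpace Ω] {Pr : Measure Ω}
  [IsProbabilityMeasure Pr] {X P : (n : ℕ) → Ω → Matrix (Fin n) (Fin n) 𝕜} {θ : ℕ → ℝ} {r : ℕ}

/-- Almost surely, the deviations of independent matrices in general position tend to zero. -/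
theorem ae_tendsto_deviation (hr : 1 ≤ r) (hX : ∀ n, Measurable (X n))
    (hXh : ∀ n ω, (X n ω).IsHermitian) (hP : ∀ n, r ≤ n → Measurable (P n))
    (hPh : ∀ n, r ≤ n → ∀ ω, (P n ω).IsHermitian)
    (hPs : ∀ n, r ≤ n → ∀ ω,
      (P n ω).charpoly = ∏ i, (Polynomial.X - Polynomial.C (spikes θ r n i : 𝕜)))
    (hindep : ∀ n, r ≤ n → IndepFun (X n) (P n) Pr)
    (hinv : ∀ n, r ≤ n → IsConjInvariant Pr (X n) ∨ IsConjInvariant Pr (P n)) (z : ℝ) :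
    ∀ᵐ ω ∂Pr, Tendsto (fun n => deviation z (X n ω) (P n ω)) atTop (𝓝 0) := by
  refine ae_tendsto_zero_of_lintegral_sq_le (r := r) (K := deviationConst θ r)
    (f := fun n ω => deviation z (X n ω) (P n ω)) (fun n hn => ?_) fun n hn => ?_
  · have hXP : Measurable fun ω => (X n ω, P n ω) := (hX n).prodMk (hP n hn)
    have h := (measurable_deviation z).comp hXP
    exact h
  · exact lintegral_deviation_sq_le z (hX n) (hP n hn) (hXh n) (hPh n hn) (hindep n hn)
      (hinv n hn) (hr.trans hn) (hPs n hn)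

end Random

end SpikedMatrix

end

theorem theorem2p6 {𝕜 : Type*} [RCLike 𝕜]
    {Ω : Type*} [MeasurableSpace Ω] (Pr : Measure Ω) [IsProbabilityMeasure Pr]
    -- the random matrices `X_n`, nonnegative definite
    (X : (n : ℕ) → Ω → Matrix (Fin n) (Fin n) 𝕜)
    (hXmeas : ∀ n, Measurable (X n))
    (hXpos : ∀ n ω, (X n ω).PosSemidef)
    -- the limiting eigenvalue distribution and the edges of its support
    (μX : Measure ℝ) [IsProbabilityMeasure μX] (hμcompact : IsCompact μX.support)
    (hμne : μX ≠ Measure.dirac 0)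
    (a b : ℝ) (ha : IsGLB μX.support a) (hb : IsLUB μX.support b)
    (hXlim : ∀ᵐ ω ∂Pr,
      SpikedMatrix.ConvergesWeakly (fun n => SpikedMatrix.empiricalSpectralMeasure (X n ω)) μX)
    (hXmin : ∀ᵐ ω ∂Pr, Tendsto (fun n => SpikedMatrix.eigenvalueDesc (X n ω) n) atTop (𝓝 a))
    (hXmax : ∀ᵐ ω ∂Pr, Tendsto (fun n => SpikedMatrix.eigenvalueDesc (X n ω) 1) atTop (𝓝 b))
    -- the numbers `θ_1 ≥ ⋯ ≥ θ_s > 0 > θ_{s+1} ≥ ⋯ ≥ θ_r`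
    (r s : ℕ) (hr : 1 ≤ r) (hsr : s ≤ r) (θ : ℕ → ℝ)
    (hθanti : AntitoneOn θ (Set.Icc 1 r))
    (hθpos : ∀ i ∈ Set.Icc 1 s, 0 < θ i)
    (hθneg : ∀ i ∈ Set.Icc (s + 1) r, θ i < 0)
    -- the random Hermitian matrices `P_n`, with nonzero eigenvalues `θ_1, …, θ_r`
    (P : (n : ℕ) → Ω → Matrix (Fin n) (Fin n) 𝕜)
    (hPmeas : ∀ n, r ≤ n → Measurable (P n))
    (hPherm : ∀ n, r ≤ n → ∀ ω, (P n ω).IsHermitian)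
    (hPspec : ∀ n, r ≤ n → ∀ ω, (P n ω).charpoly =
      Polynomial.X ^ (n - r) * ∏ i ∈ Finset.Icc 1 r, (Polynomial.X - Polynomial.C (θ i : 𝕜)))
    -- independence, and invariance of one of the two
    (hindep : ∀ n, r ≤ n → IndepFun (X n) (P n) Pr)
    (hinv : ∀ n, r ≤ n →
      SpikedMatrix.IsConjInvariant Pr (X n) ∨ SpikedMatrix.IsConjInvariant Pr (P n)) :
    -- the eigenvalues of `X_n (I_n + P_n)` are real
    (∀ n, r ≤ n → ∀ ω, (X n ω * (1 + P n ω)).charpoly = ∏ k ∈ Finset.Icc 1 n,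
      (Polynomial.X -
        Polynomial.C (SpikedMatrix.eigenvalueDesc (X n ω * (1 + P n ω)) k : 𝕜))) ∧
    -- `T_μ` is a bijection from `(b, ∞)` onto `(0, T_μ(b^+))`
    -- and from `(-∞, a)` onto `(T_μ(a^-), 0)`
    Set.BijOn (SpikedMatrix.Ttransform μX) (Set.Ioi b)
      {y : ℝ | 0 < y ∧ (y : EReal) < SpikedMatrix.TtransformRight μX b} ∧
    Set.BijOn (SpikedMatrix.Ttransform μX) (Set.Iio a)
      {y : ℝ | SpikedMatrix.TtransformLeft μX a < (y : EReal) ∧ y < 0} ∧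
    -- the largest eigenvalues
    (∀ i, 1 ≤ i → i ≤ s → ∀ᵐ ω ∂Pr,
      Tendsto (fun n => SpikedMatrix.eigenvalueDesc (X n ω * (1 + P n ω)) i) atTop
        (𝓝 (if (θ i : EReal) > 1 / SpikedMatrix.TtransformRight μX b
            then SpikedMatrix.TinvRight μX b (1 / θ i) else b))) ∧
    (∀ i, s < i → ∀ᵐ ω ∂Pr,
      Tendsto (fun n => SpikedMatrix.eigenvalueDesc (X n ω * (1 + P n ω)) i) atTop (𝓝 b)) ∧
    -- the smallest eigenvalues
    (∀ j, j < r - s → ∀ᵐ ω ∂Pr,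
      Tendsto (fun n => SpikedMatrix.eigenvalueDesc (X n ω * (1 + P n ω)) (n - j)) atTop
        (𝓝 (if (θ (r - j) : EReal) < 1 / SpikedMatrix.TtransformLeft μX a
            then SpikedMatrix.TinvLeft μX a (1 / θ (r - j)) else a))) ∧
    (∀ j, r - s ≤ j → ∀ᵐ ω ∂Pr,
      Tendsto (fun n => SpikedMatrix.eigenvalueDesc (X n ω * (1 + P n ω)) (n - j)) atTop
        (𝓝 a)) := by
  have hgen : ∀ᵐ ω ∂Pr, SpikedMatrix.IsGenericSpiked (fun n => X n ω) (fun n => P n ω) μX a b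
      θ r s := by
    have hPs : ∀ n, r ≤ n → ∀ ω, (P n ω).charpoly =
        ∏ i, (Polynomial.X - Polynomial.C (SpikedMatrix.spikes θ r n i : 𝕜)) := fun n hn ω =>
      (hPspec n hn ω).trans (SpikedMatrix.prod_spikes_eq θ hn)
    -- Monotonicity of T makes rational test points sufficient, so the exceptional null sets are
    -- countably many.
    have hdev : ∀ᵐ ω ∂Pr, ∀ q : ℚ, Tendsto
        (fun n => SpikedMatrix.deviation (q : ℝ) (X n ω) (P n ω)) atTop (𝓝 0) := by
      exact ae_all_iff.2 fun q => SpikedMatrix.ae_tendsto_deviation hr hXmeas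
        (fun n ω => (hXpos n ω).isHermitian) hPmeas hPherm hPs hindep hinv q
    filter_upwards [hXlim, hXmin, hXmax, hdev] with ω h1 h2 h3 h4
    exact ⟨ha, hb, hμne, hsr, hθanti, hθpos, hθneg, fun n hn => hPherm n hn ω,
      fun n hn => hPs n hn ω,
      SpikedMatrix.hasSpectralLimit_of_convergesWeakly (fun n => hXpos n ω) h1 h2 h3, h4⟩
  have hae := SpikedMatrix.ae_mem_Icc_of_support ha hb
  -- The edge a is deterministic, so a single ω in the almost sure event decides its sign.
  have ha0 : 0 ≤ a := by
    obtain ⟨ω, hω⟩ := hgen.exists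
    exact hω.hasSpectralLimit.nonneg
  refine ⟨fun n hn ω => SpikedMatrix.charpoly_mul_one_add_eq_prod (hXpos n ω) (hPherm n hn ω),
    SpikedMatrix.Ttransform_bijOn_right hae ha0 hμne,
    SpikedMatrix.Ttransform_bijOn_left hae ha0 hμne, fun i hi his => ?_, fun i hi => ?_,
    fun j hj => ?_, fun j hj => ?_⟩
  · filter_upwards [hgen] with ω hω using hω.tendsto_eigenvalueDesc_pos hi his
  · filter_upwards [hgen] with ω hω using hω.tendsto_eigenvalueDesc_right_edge hi
  · filter_upwards [hgen] with ω hω using hω.tendsto_eigenvalueDesc_neg hj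
  · filter_upwards [hgen] with ω hω using hω.tendsto_eigenvalueDesc_left_edge hj
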